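/- Logarithms are to base 2, and algorithms are randomized programs over finitely many stacks of bits (equivalently, multi-tape machines); each elementary operation, coin flip and oracle call costs one step, and running times hold for all outcomes of the coins and of the oracle answers. \textsc{Linear-2-RL} with feature dimension $d$: the algorithm has oracle access to a Markov decision process with two actions, deterministic transitions $P(s,a)$, random rewards $R(s,a)$ in $[0,1]$ and an end state $\bot$ which every policy reaches from every state within $H = O(d)$ steps, and to features $\psi(s),\psi(s,a)\in\mathbb{Q}^d$ such that, for some $\theta\in\mathbb{R}^d$, the optimal value functions satisfy $V^*(s)=\langle\theta,\psi(s)\rangle$ and $Q^*(s,a)=\langle\theta,\psi(s,a)\rangle$ for all $s,a$. The algorithm is given $d$, $H$ and the starting state $s_0$. It may query, for any state $s$ and action $a$, a fresh sample of $R(s,a)$, the state $P(s,a)$, and the features $\psi(s)$ and $\psi(s,a)$; states are bit strings, rewards are rational, and all inputs and outputs of the oracle have size polynomial in $d$. It has to output (as the sequence of actions taken from $s_0$ until $\bot$) a policy $\pi$ with $V^\pi(s_0) > V^*(s_0) - 1/4$. It is solved in time $t(d)$ with error probability $p$ if, for all choices of the constants hidden in $H = O(d)$ and in "polynomial", some algorithm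 runs in time $O(t(d))$ and outputs such a policy with probability at least $1-p$ on every instance. \textsc{Unique-3-SAT} on $v$ variables: given a 3-CNF formula with $v$ variables and $O(v)$ clauses that has at most one satisfying assignment, decide whether it is satisfiable. It is solved in time $t(v)$ with error probability $p$ if some algorithm runs in time $O(t(v))$, answers YES with probability at least $1-p$ on satisfiable formulas, and answers NO with probability $1$ on unsatisfiable ones. \textbf{Proposition.} If \textsc{Linear-2-RL} with feature dimension $d$ can be solved in time $d^{\log d/(72\log\log d)}$ with error probability $1/10$, then there is a constant $C$ such that \textsc{Unique-3-SAT} on $v$ variables can be solved in time $2^{C v/\log v}$ with error probability $1/8$. -/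

import Mathlib

open scoped ENNReal

/-! # Machine model

Randomized oracle programs over finitely many stacks of bits (each program mentions only finitely
many of the registers; a stack machine with finite control is a multi-tape Turing machine up to
constant factors).  Every elementary operation, every test, every coin flip and every oracle call
costs one step. -/

namespace Machine

/-- Bit strings. -/
abbrev Str := List Bool

/-- Programs.  Registers are stacks of bits; the head of the list is the top of the stack. -/
inductive Prog where
  /-- push a bit onto register `i` -/
  | push (i : ℕ) (b : Bool)
  /-- pop the top bit of register `i` (no effect on an empty register) -/
  | pop (i : ℕ)
  /-- push a uniformly random bit onto register `i` -/
  | flip (i : ℕ)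
  /-- send the content of register `i` to the oracle and overwrite register `j` by its answer -/
  | ask (i j : ℕ)
  /-- sequential composition -/
  | seq (p q : Prog)
  /-- three-way branch: register `i` is empty / has top bit `false` / has top bit `true` -/
  | branch (i : ℕ) (p q r : Prog)
  /-- while register `i` is nonempty, execute `p` -/
  | loop (i : ℕ) (p : Prog)

/-- Contents of the registers. -/
abbrev Store := ℕ → Str

/-- A configuration: what is left to execute (the control state) and the registers. -/
structure Config where
  todo : List Prog
  regs : Store

/-- A (possibly randomized) oracle; the answers to different calls are independent. -/
abbrev Oracle := Str → PMF Str

/-- The oracle that gives no information: machines without an oracle are run with it. -/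
noncomputable def noOracle : Oracle := fun _ => PMF.pure []

/-- One step of computation.  A configuration with nothing left to execute has halted. -/
noncomputable def step (O : Oracle) : Config → PMF Config
  | ⟨[], σ⟩ => PMF.pure ⟨[], σ⟩
  | ⟨.push i b :: k, σ⟩ => PMF.pure ⟨k, Function.update σ i (b :: σ i)⟩
  | ⟨.pop i :: k, σ⟩ => PMF.pure ⟨k, Function.update σ i (σ i).tail⟩
  | ⟨.flip i :: k, σ⟩ =>
      (PMF.uniformOfFintype Bool).map fun b => ⟨k, Function.update σ i (b :: σ i)⟩
  | ⟨.ask i j :: k, σ⟩ => (O (σ i)).map fun y => ⟨k, Function.update σ j y⟩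
  | ⟨.seq p q :: k, σ⟩ => PMF.pure ⟨p :: q :: k, σ⟩
  | ⟨.branch i p q r :: k, σ⟩ =>
      match σ i with
      | [] => PMF.pure ⟨p :: k, σ⟩
      | false :: _ => PMF.pure ⟨q :: k, σ⟩
      | true :: _ => PMF.pure ⟨r :: k, σ⟩
  | ⟨.loop i p :: k, σ⟩ =>
      match σ i with
      | [] => PMF.pure ⟨k, σ⟩
      | _ :: _ => PMF.pure ⟨p :: .loop i p :: k, σ⟩

/-- The distribution of the configuration after `n` steps. -/
noncomputable def run (O : Oracle) : ℕ → Config → PMF Config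
  | 0, c => PMF.pure c
  | n + 1, c => (step O c).bind (run O n)

/-- The input is in register `0`, all other registers are empty. -/
def initial (p : Prog) (x : Str) : Config := ⟨[p], Function.update (fun _ => []) 0 x⟩

/-- Whatever the coins and the oracle answers are, `p` halts on `x` after at most `T` steps. -/
def HaltsWithin (O : Oracle) (p : Prog) (x : Str) (T : ℕ) : Prop :=
  ∀ c ∈ (run O T (initial p x)).support, c.todo = []

/-- The distribution of the output (the content of register `0` after `T` steps). -/
noncomputable def output (O : Oracle) (p : Prog) (x : Str) (T : ℕ) : PMF Str :=
  (run O T (initial p x)).map fun c => c.regs 0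

/-- The probability that the output has the property `A`. -/
noncomputable def outputProb (O : Oracle) (p : Prog) (x : Str) (T : ℕ) (A : Str → Prop) : ℝ≥0∞ :=
  (output O p x T).toOuterMeasure {y | A y}

/-- Unary code `1ⁿ0` of a natural number. -/
def encUnary (n : ℕ) : Str := List.replicate n true ++ [false]

/-- Self-delimiting binary code of a natural number: every binary digit (least significant first)
is preceded by `1`, and a `0` closes the code. -/
def encNat (n : ℕ) : Str := (n.bits.flatMap fun b => [true, b]) ++ [false]

/-- Code of a rational number in lowest terms: sign, numerator, denominator in binary. -/
def encRat (q : ℚ) : Str := decide (q < 0) :: (encNat q.num.natAbs ++ encNat q.den)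

end Machine

/-! # Unique-3-SAT -/

namespace ThreeSat

open Machine

/-- A literal: a variable and the truth value that makes the literal true. -/
abbrev Literal (v : ℕ) := Fin v × Bool

/-- A clause: a disjunction of three literals (not necessarily distinct). -/
abbrev Clause (v : ℕ) := Literal v × Literal v × Literal v

/-- A 3-CNF formula in `v` variables: a conjunction of clauses. -/
abbrev CNF (v : ℕ) := List (Clause v)

/-- The assignment `w` satisfies the formula `φ`. -/
def Satisfies {v : ℕ} (w : Fin v → Bool) (φ : CNF v) : Prop :=
  ∀ C ∈ φ, w C.1.1 = C.1.2 ∨ w C.2.1.1 = C.2.1.2 ∨ w C.2.2.1 = C.2.2.2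

def Satisfiable {v : ℕ} (φ : CNF v) : Prop := ∃ w, Satisfies w φ

/-- The promise: there is at most one satisfying assignment. -/
def UniquePromise {v : ℕ} (φ : CNF v) : Prop :=
  ∀ w w', Satisfies w φ → Satisfies w' φ → w = w'

def encLiteral {v : ℕ} (l : Literal v) : Str := l.2 :: encUnary l.1

def encClause {v : ℕ} (C : Clause v) : Str :=
  encLiteral C.1 ++ encLiteral C.2.1 ++ encLiteral C.2.2

/-- Code of a formula: the number of variables, then the clauses, each of them preceded by `1`,
then a `0`. -/
def encCNF {v : ℕ} (φ : CNF v) : Str :=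
  encUnary v ++ (φ.flatMap fun C => true :: encClause C) ++ [false]

/-- `Unique-3-SAT` on `v` variables and `O(v)` clauses can be solved in time `O(t v)` with (one-sided)
error probability `ε`: some program, without oracle, on all formulas satisfying the promise
with `v` variables and at most `c * v` clauses, halts within `T v = O(t v)` steps (for every `c`),
answers YES with probability at least `1 - ε` if the formula is satisfiable,
and answers NO with probability `1` if it is not. -/
def UniqueThreeSatSolvableInTime (t : ℕ → ℝ) (ε : ℝ≥0∞) : Prop :=
  ∃ p : Prog, ∀ c : ℕ, ∃ T : ℕ → ℕ,
    (fun v => (T v : ℝ)) =O[Filter.atTop] t ∧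
    ∀ (v : ℕ) (φ : CNF v), φ.length ≤ c * v → UniquePromise φ →
      HaltsWithin noOracle p (encCNF φ) (T v) ∧
      (Satisfiable φ → 1 - ε ≤ outputProb noOracle p (encCNF φ) (T v) (· = [true])) ∧
      (¬ Satisfiable φ → outputProb noOracle p (encCNF φ) (T v) (· = [false]) = 1)

end ThreeSat

/-! # Linear-2-RL -/

namespace RL

open Machine

/-- A Markov decision process with deterministic transitions, two actions, stochastic rewards in
`[0, 1]` and bounded horizon.  The end state `⊥` is `none`.  As states and rewards are
communicated to algorithms, states have bit string codes and the sampled rewards are rational. -/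
structure MDP where
  State : Type
  code : State → Str
  code_injective : Function.Injective code
  /-- the starting state -/
  start : State
  /-- the transition function -/
  next : State → Bool → Option State
  /-- the distribution of the reward -/
  reward : State → Bool → PMF ℚ
  reward_mem : ∀ s a, ∀ q ∈ (reward s a).support, 0 ≤ q ∧ q ≤ 1
  horizon : ℕ
  /-- every policy reaches the end state after at most `horizon` steps -/
  horizon_spec : ∀ (π : State → Bool) (s : State),
    (fun o : Option State => o.bind fun s' => next s' (π s'))^[horizon] (some s) = none

namespace MDP

variable (M : MDP)

/-- Deterministic stationary policies. -/
abbrev Policy := M.State → Bool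

/-- The state at time `t`, for the policy `π` started in `s`. -/
def stateAt (π : M.Policy) (s : M.State) (t : ℕ) : Option M.State :=
  (fun o : Option M.State => o.bind fun s' => M.next s' (π s'))^[t] (some s)

/-- The expected reward for action `a` in state `s`. -/
noncomputable def meanReward (s : M.State) (a : Bool) : ℝ :=
  ∑' q : ℚ, (M.reward s a q).toReal * (q : ℝ)

/-- The value `V^π(s)`: the expected total reward collected until the end state is reached.  As
the transitions are deterministic, it is the sum of the expected rewards along the trajectory. -/
noncomputable def V (π : M.Policy) (s : M.State) : ℝ :=
  ∑ t ∈ Finset.range M.horizon, (M.stateAt π s t).elim 0 fun s' => M.meanReward s' (π s')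

/-- The value `Q^π(s, a)`: take action `a` first and follow `π` afterwards. -/
noncomputable def Q (π : M.Policy) (s : M.State) (a : Bool) : ℝ :=
  M.meanReward s a + (M.next s a).elim 0 (M.V π)

/-- The optimal value function `V^*`. -/
noncomputable def VStar (s : M.State) : ℝ := ⨆ π : M.Policy, M.V π s

/-- The optimal action-value function `Q^*`. -/
noncomputable def QStar (s : M.State) (a : Bool) : ℝ := ⨆ π : M.Policy, M.Q π s a

/-- `π`, from the given state on, takes the actions in the list until the end state is reached (and
the list is long enough for that; actions after the end state has been reached are ignored). -/
def Executes (π : M.Policy) : Option M.State → List Bool → Prop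
  | none, _ => True
  | some _, [] => False
  | some s, a :: as => π s = a ∧ Executes π (M.next s a) as

/-- The sequence of actions describes a good policy: one with `V^π > V^* - 1/4` at the start. -/
def IsGood (as : List Bool) : Prop :=
  ∃ π : M.Policy, M.Executes π (some M.start) as ∧ M.VStar M.start - 1 / 4 < M.V π M.start

/-- A `d`-dimensional feature map on states and on state-action pairs. -/
structure Features (d : ℕ) where
  onState : M.State → Fin d → ℚ
  onPair : M.State → Bool → Fin d → ℚ

variable {M}

/-- `V^*` and `Q^*` are linear in the features, with a common coefficient vector. -/
def Features.Linear {d : ℕ} (ψ : M.Features d) : Prop :=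
  ∃ θ : Fin d → ℝ,
    (∀ s, M.VStar s = ∑ i, θ i * (ψ.onState s i : ℝ)) ∧
    (∀ s a, M.QStar s a = ∑ i, θ i * (ψ.onPair s a i : ℝ))

variable (M)

open Classical in
/-- The state with the given code, if there is one. -/
noncomputable def decode (x : Str) : Option M.State :=
  if h : ∃ s, M.code s = x then some h.choose else none

/-- Code of a successor state: `0` for the end state. -/
def encNext : Option M.State → Str
  | none => [false]
  | some s => true :: M.code s

/-- Code of a vector of rationals. -/
def encVector {d : ℕ} (x : Fin d → ℚ) : Str := (List.ofFn fun i => encRat (x i)).flatten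

/-- The access to the MDP and its features.  The two leading bits of a query select the reward
function, the transition function, the features of a state, or the features of a
state-action pair; then come the action (if needed) and the code of the state.  A reward query is
answered by a fresh sample.  Malformed queries are answered by the empty string. -/
noncomputable def oracle {d : ℕ} (ψ : M.Features d) : Oracle
  | false :: false :: a :: x =>
      (M.decode x).elim (PMF.pure []) fun s => (M.reward s a).map encRat
  | false :: true :: a :: x => (M.decode x).elim (PMF.pure []) fun s =>
      PMF.pure (M.encNext (M.next s a))
  | true :: false :: x => (M.decode x).elim (PMF.pure []) fun s =>
      PMF.pure (encVector (ψ.onState s))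
  | true :: true :: a :: x => (M.decode x).elim (PMF.pure []) fun s =>
      PMF.pure (encVector (ψ.onPair s a))
  | _ => PMF.pure []

/-- The instances of `Linear-2-RL` with feature dimension `d`, where `κ` is the constant hidden in
"horizon `O(d)`" and "inputs and outputs of the oracle of size polynomial in `d`". -/
structure IsInstance (κ d : ℕ) (ψ : M.Features d) : Prop where
  linear : ψ.Linear
  horizon_le : M.horizon ≤ κ * d
  code_le : ∀ s, (M.code s).length ≤ κ * d ^ κ
  answer_le : ∀ x, ∀ y ∈ (M.oracle ψ x).support, y.length ≤ κ * d ^ κ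

/-- The input of the algorithm besides the oracle: feature dimension, horizon, starting state. -/
def input (d : ℕ) : Str := encUnary d ++ encUnary M.horizon ++ M.code M.start

end MDP

/-- `Linear-2-RL` with feature dimension `d` can be solved in time `O(t d)` with error probability
`ε`: for all choices of the constant `κ`, some oracle program, on all instances of feature
dimension `d`, halts within `T d = O(t d)` steps and outputs, with probability at least
`1 - ε`, a good policy (as a sequence of actions). -/
def LinearTwoRLSolvableInTime (t : ℕ → ℝ) (ε : ℝ≥0∞) : Prop :=
  ∀ κ : ℕ, ∃ p : Prog, ∃ T : ℕ → ℕ,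
    (fun d => (T d : ℝ)) =O[Filter.atTop] t ∧
    ∀ (d : ℕ) (M : MDP) (ψ : M.Features d), M.IsInstance κ d ψ →
      HaltsWithin (M.oracle ψ) p (M.input d) (T d) ∧
      1 - ε ≤ outputProb (M.oracle ψ) p (M.input d) (T d) M.IsGood

end RL

/-!
Local search for a satisfying assignment `w` of `φ` is turned into a deterministic decision process:
a state consists of a counter and an assignment, and the actions flip one of the three variables of
the first falsified clause.  At least one flip reduces the Hamming distance to `w`, so the least
possible number of flips in total is the counter plus the distance, which no action decreases and
some action preserves.  It is a quadratic polynomial in bits that can be computed without knowing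
`w`.  The reward, which is given only at the end, is `1` with a probability that is the `r`-th power
of an affine function of this number.  The optimal value is then given by the same formula in all
states, and it is linear in the `2 r`-th tensor power of those bits: these are the features.

The rewards depend on `w`, but they need not be known.  If the search stops because the counter is
full, the probability of a reward is at most `((V + 3) / 2 ^ B) ^ r`, for `V` variables and `B` bits
of the counter.  So an algorithm for `Linear-2-RL` can be run with all rewards answered by `0`: if
it never asks for the reward of a satisfying assignment, which would decide `φ`, such answers are
wrong with small probability only, and a policy of value above `3 / 4 - r (V + 1) / 2 ^ B` ends in a
satisfying assignment.  With `r` about `V ^ (1 / 3)` and `B` about `r log V`, the dimension `d` has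
`log d` of order `V ^ (1 / 3) log V`.  Both `d ^ (log d / (72 log log d))` and `(2 ^ B / V) ^ r` are
then exponential in `V ^ (2 / 3) log V`, and the constant `72` makes the second one larger.
-/

/-! ## Deterministic execution -/

namespace Machine

theorem run_succ_of_step_eq_pure {O : Oracle} {c c' : Config} (h : step O c = PMF.pure c')
    (N : ℕ) : run O (N + 1) c = run O N c' := by
  rw [run, h, PMF.pure_bind]

/-- Total correctness of `p` with a time bound: started on `σ`, the program `p` makes at most `T`
steps, all of them deterministic, and ends with the registers `σ'`. -/
def Runs (p : Prog) (σ σ' : Store) (T : ℕ) : Prop :=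
  ∃ t ≤ T, ∀ (k : List Prog) (N : ℕ), run noOracle (t + N) ⟨p :: k, σ⟩ = run noOracle N ⟨k, σ'⟩

namespace Runs

variable {p q r : Prog} {σ σ' σ₁ σ₂ : Store} {i : ℕ} {T T' T₁ T₂ : ℕ}

theorem mono (h : Runs p σ σ' T) (hT : T ≤ T') : Runs p σ σ' T' :=
  let ⟨t, ht, hr⟩ := h
  ⟨t, ht.trans hT, hr⟩

theorem congr (h : Runs p σ σ₁ T) (hσ : σ₁ = σ₂) : Runs p σ σ₂ T := hσ ▸ h

theorem push (i : ℕ) (b : Bool) (σ : Store) :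
    Runs (.push i b) σ (Function.update σ i (b :: σ i)) 1 :=
  ⟨1, le_rfl, fun k N => by rw [add_comm]; exact run_succ_of_step_eq_pure rfl N⟩

theorem pop (i : ℕ) (σ : Store) : Runs (.pop i) σ (Function.update σ i (σ i).tail) 1 :=
  ⟨1, le_rfl, fun k N => by rw [add_comm]; exact run_succ_of_step_eq_pure rfl N⟩

theorem seq (hp : Runs p σ σ₁ T₁) (hq : Runs q σ₁ σ₂ T₂) :
    Runs (.seq p q) σ σ₂ (T₁ + T₂ + 1) := by
  obtain ⟨t₁, ht₁, hp⟩ := hp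
  obtain ⟨t₂, ht₂, hq⟩ := hq
  refine ⟨t₁ + t₂ + 1, by omega, fun k N => ?_⟩
  rw [show t₁ + t₂ + 1 + N = (t₁ + (t₂ + N)) + 1 by omega,
    run_succ_of_step_eq_pure (c' := ⟨p :: q :: k, σ⟩) rfl, hp, hq]

theorem of_step_eq_pure (hp : Runs q σ σ' T)
    (h : ∀ k, step noOracle ⟨p :: k, σ⟩ = PMF.pure ⟨q :: k, σ⟩) : Runs p σ σ' (T + 1) := by
  obtain ⟨t, ht, hp⟩ := hp
  refine ⟨t + 1, by omega, fun k N => ?_⟩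
  rw [add_right_comm, run_succ_of_step_eq_pure (h k), hp]

theorem branch_nil (h : σ i = []) (hp : Runs p σ σ' T) :
    Runs (.branch i p q r) σ σ' (T + 1) :=
  hp.of_step_eq_pure fun k => by simp only [step, h]

theorem branch_cons {p : Bool → Prog} {a : Bool} {l : Str} (h : σ i = a :: l)
    (hp : Runs (p a) σ σ' T) : Runs (.branch i q (p false) (p true)) σ σ' (T + 1) :=
  hp.of_step_eq_pure fun k => by cases a <;> simp only [step, h]

theorem loop_nil (h : σ i = []) : Runs (.loop i p) σ σ 1 :=
  ⟨1, le_rfl, fun k N => by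
    rw [add_comm, run_succ_of_step_eq_pure (c' := ⟨k, σ⟩) (by simp only [step, h])]⟩

theorem loop_cons {a : Bool} {l : Str} (h : σ i = a :: l) (hp : Runs p σ σ₁ T₁)
    (hl : Runs (.loop i p) σ₁ σ₂ T₂) : Runs (.loop i p) σ σ₂ (T₁ + T₂ + 1) := by
  obtain ⟨t₁, ht₁, hp⟩ := hp
  obtain ⟨t₂, ht₂, hl⟩ := hl
  refine ⟨t₁ + t₂ + 1, by omega, fun k N => ?_⟩
  rw [show t₁ + t₂ + 1 + N = (t₁ + (t₂ + N)) + 1 by omega,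
    run_succ_of_step_eq_pure (c' := ⟨p :: .loop i p :: k, σ⟩) (by simp only [step, h]), hp, hl]

end Runs

/-- The program without effect. -/
def Prog.skip : Prog := .seq (.push 0 false) (.pop 0)

theorem Runs.skip (σ : Store) : Runs .skip σ σ 3 :=
  ((Runs.push 0 false σ).seq (Runs.pop 0 _)).congr (by simp)

/-- The program that empties register `i`. -/
def Prog.clear (i : ℕ) : Prog := .loop i (.pop i)

theorem Runs.clear (i : ℕ) (σ : Store) :
    Runs (.clear i) σ (Function.update σ i []) (2 * (σ i).length + 1) := by
  induction hl : σ i generalizing σ with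
  | nil => exact (Runs.loop_nil hl).congr (by rw [← hl, Function.update_eq_self])
  | cons a l ih =>
    have hrest := ih (Function.update σ i l) (Function.update_self ..)
    rw [Function.update_idem] at hrest
    have hpop := Runs.pop i σ
    rw [hl, List.tail_cons] at hpop
    exact (Runs.loop_cons hl hpop hrest).mono (by simp only [List.length_cons]; omega)

/-- The program that empties the registers `b, …, b + m - 1`. -/
def Prog.clearFrom (b : ℕ) : ℕ → Prog
  | 0 => .skip
  | m + 1 => .seq (.clearFrom b m) (.clear (b + m))

theorem Runs.clearFrom {b m B : ℕ} {σ : Store} (hB : ∀ i < m, (σ (b + i)).length ≤ B) :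
    Runs (.clearFrom b m) σ (fun i => if b ≤ i ∧ i < b + m then [] else σ i)
      (m * (2 * B + 2) + 3) := by
  induction m with
  | zero => exact (Runs.skip σ).congr (by funext i; rw [if_neg (by omega)]) |>.mono (by omega)
  | succ m ih =>
    refine ((ih fun i hi => hB i (by omega)).seq (Runs.clear (b + m) _)).congr ?_ |>.mono ?_
    · funext i
      simp only [Function.update_apply]
      split_ifs <;> first | rfl | omega
    · have := hB m (by omega)
      simp only [lt_irrefl, and_false, if_false, add_mul]
      omega

/-- The program that consumes register `i` bit by bit and executes `p a` after reading the bit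
`a`. -/
def Prog.forEach (i : ℕ) (p : Bool → Prog) : Prog :=
  .loop i (.branch i .skip (.seq (.pop i) (p false)) (.seq (.pop i) (p true)))

/-- The invariant `st u v` is the store when `u` has been read and `v` is still to be read. -/
theorem Runs.forEach {i E : ℕ} {p : Bool → Prog} {l : Str} {st : Str → Str → Store}
    (hst : ∀ u v, st u v i = v)
    (hp : ∀ u a v, l = u ++ a :: v →
      Runs (p a) (Function.update (st u (a :: v)) i v) (st (u ++ [a]) v) E) :
    Runs (.forEach i p) (st [] l) (st l []) (l.length * (E + 4) + 1) := by
  suffices ∀ v u, l = u ++ v →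
      Runs (.forEach i p) (st u v) (st l []) (v.length * (E + 4) + 1) from this l [] rfl
  intro v
  induction v with
  | nil =>
    rintro u rfl
    exact (Runs.loop_nil (hst _ _)).congr (by rw [List.append_nil]) |>.mono (by omega)
  | cons a v ih =>
    intro u hl
    have hpop := Runs.pop i (st u (a :: v))
    rw [hst, List.tail_cons] at hpop
    have hbody : Runs (.branch i .skip (.seq (.pop i) (p false)) (.seq (.pop i) (p true)))
        (st u (a :: v)) (st (u ++ [a]) v) (1 + E + 1 + 1) :=
      Runs.branch_cons (p := fun a => .seq (.pop i) (p a)) (hst _ _) (hpop.seq (hp u a v hl))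
    refine (Runs.loop_cons (hst _ _) hbody (ih (u ++ [a]) (by simp [hl]))).mono ?_
    simp only [List.length_cons, add_mul]
    omega

/-- The program that pushes the bit `a` onto all registers in a list. -/
def Prog.pushAll (a : Bool) : List ℕ → Prog
  | [] => .skip
  | j :: js => .seq (.pushAll a js) (.push j a)

theorem Runs.pushAll (a : Bool) {js : List ℕ} (hjs : js.Nodup) (σ : Store) :
    Runs (.pushAll a js) σ (fun x => if x ∈ js then a :: σ x else σ x) (2 * js.length + 3) := by
  induction js with
  | nil => exact (Runs.skip σ).congr (by simp)
  | cons j js ih =>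
    obtain ⟨hj, hjs⟩ := List.nodup_cons.mp hjs
    refine ((ih hjs).seq (Runs.push j a _)).congr ?_ |>.mono
      (by simp only [List.length_cons]; omega)
    funext x
    by_cases hx : x = j
    · subst hx; simp [hj]
    · simp [hx]

/-- The program that moves the content of register `i`, reversed, onto all registers in a list. -/
def Prog.transfer (i : ℕ) (js : List ℕ) : Prog := .forEach i fun a => .pushAll a js

theorem Runs.transfer {i : ℕ} {js : List ℕ} (hjs : js.Nodup) (hi : i ∉ js) (σ : Store) :
    Runs (.transfer i js) σ
      (fun x => if x = i then [] else if x ∈ js then (σ i).reverse ++ σ x else σ x)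
      ((σ i).length * (2 * js.length + 7) + 1) := by
  let st : Str → Str → Store := fun u v x =>
    if x = i then v else if x ∈ js then u.reverse ++ σ x else σ x
  have hstart : st [] (σ i) = σ := by
    funext x
    by_cases hx : x = i <;> simp [st, hx]
  have hloop := Runs.forEach (st := st) (E := 2 * js.length + 3) (l := σ i)
    (p := fun a => .pushAll a js) (fun _ _ => if_pos rfl) fun u a v _ =>
      (Runs.pushAll a hjs _).congr <| by
        funext x
        by_cases hx : x = i
        · subst hx; simp [st, hi]
        · by_cases hxj : x ∈ js <;> simp [st, hx, hxj]
  rw [hstart] at hloop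
  exact hloop

/-- The program that moves the content of register `i` to register `j`, through register `b`. -/
def Prog.move (i j b : ℕ) : Prog := .seq (.clear j) (.seq (.transfer i [b]) (.transfer b [j]))

theorem Runs.move {i j b : ℕ} (hij : i ≠ j) (hib : i ≠ b) (hjb : j ≠ b) {σ : Store}
    (hb : σ b = []) : Runs (.move i j b) σ (Function.update (Function.update σ i []) j (σ i))
      (2 * (σ j).length + 18 * (σ i).length + 5) := by
  refine ((Runs.clear j σ).seq ((Runs.transfer (js := [b]) (by simp) (by simpa) _).seq
    (Runs.transfer (js := [j]) (by simp) (by simpa using hjb.symm) _))).congr ?_ |>.mono ?_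
  · funext x
    by_cases hxj : x = j
    · subst hxj; simp [hij, hij.symm, hib.symm, hjb, hjb.symm, hb]
    by_cases hxb : x = b
    · subst hxb; simp [hib.symm, hjb.symm, hb]
    simp [hxj, hxb, Function.update_apply]
  · simp [hij, hib.symm, hjb.symm, hb]
    omega

end Machine

/-! ## Functions computable in polynomial time -/

namespace Machine

/-- `τ` is bounded by a polynomial in `S`.  The base `S x + 2` makes every polynomial a power. -/
def PolyBounded {X : Type*} (S τ : X → ℕ) : Prop := ∃ k, ∀ x, τ x ≤ (S x + 2) ^ k

namespace PolyBounded

variable {X Y : Type*} {S τ τ' : X → ℕ}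

theorem mono (h : PolyBounded S τ) (h' : ∀ x, τ' x ≤ τ x) : PolyBounded S τ' :=
  let ⟨k, hk⟩ := h
  ⟨k, fun x => (h' x).trans (hk x)⟩

theorem const (c : ℕ) : PolyBounded S (fun _ => c) :=
  ⟨c, fun x => Nat.lt_two_pow_self.le.trans (Nat.pow_le_pow_left (by omega) c)⟩

theorem of_le (h : ∀ x, τ x ≤ S x) : PolyBounded S τ :=
  ⟨1, fun x => by rw [pow_one]; exact (h x).trans (by omega)⟩

theorem self : PolyBounded S S := of_le fun _ => le_rfl

theorem add (h : PolyBounded S τ) (h' : PolyBounded S τ') :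
    PolyBounded S (fun x => τ x + τ' x) := by
  obtain ⟨k, hk⟩ := h
  obtain ⟨l, hl⟩ := h'
  refine ⟨max k l + 1, fun x => ?_⟩
  calc τ x + τ' x ≤ (S x + 2) ^ k + (S x + 2) ^ l := add_le_add (hk x) (hl x)
    _ ≤ (S x + 2) ^ max k l + (S x + 2) ^ max k l :=
      add_le_add (Nat.pow_le_pow_right (by omega) (le_max_left k l))
        (Nat.pow_le_pow_right (by omega) (le_max_right k l))
    _ = (S x + 2) ^ max k l * 2 := (mul_two _).symm
    _ ≤ (S x + 2) ^ (max k l + 1) := by rw [pow_succ]; gcongr; omega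

theorem mul (h : PolyBounded S τ) (h' : PolyBounded S τ') :
    PolyBounded S (fun x => τ x * τ' x) := by
  obtain ⟨k, hk⟩ := h
  obtain ⟨l, hl⟩ := h'
  exact ⟨k + l, fun x => by rw [pow_add]; exact Nat.mul_le_mul (hk x) (hl x)⟩

theorem pow (h : PolyBounded S τ) (n : ℕ) : PolyBounded S (fun x => τ x ^ n) := by
  obtain ⟨k, hk⟩ := h
  exact ⟨k * n, fun x => by rw [pow_mul]; exact Nat.pow_le_pow_left (hk x) n⟩

theorem comp {S' τ'' : Y → ℕ} (h : PolyBounded S' τ'') (F : X → Y)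
    (hF : PolyBounded S (fun x => S' (F x))) : PolyBounded S (fun x => τ'' (F x)) :=
  let ⟨k, hk⟩ := h
  ((hF.add (const 2)).pow k).mono fun x => hk (F x)

theorem exists_common {ι : Type*} (s : List ι) {τ : ι → X → ℕ}
    (h : ∀ i ∈ s, PolyBounded S (τ i)) :
    ∃ B, PolyBounded S B ∧ ∀ i ∈ s, ∀ x, τ i x ≤ B x := by
  induction s with
  | nil => exact ⟨fun _ => 0, const 0, by simp⟩
  | cons i s ih =>
    obtain ⟨B, hB, hs⟩ := ih fun j hj => h j (List.mem_cons_of_mem _ hj)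
    refine ⟨_, (h i List.mem_cons_self).add hB, fun j hj x => ?_⟩
    rcases List.mem_cons.mp hj with rfl | hj
    · exact Nat.le_add_right _ _
    · exact (hs j hj x).trans (Nat.le_add_left _ _)

end PolyBounded

/-- The store `σ` holds the values at `x` of the functions in the list `V`, at the locations `ρ`;
the registers from `b` on are empty and serve as working space. -/
structure Holds {X : Type*} (V : List (X → Str)) (b : ℕ) (ρ : List ℕ) (x : X) (σ : Store) :
    Prop where
  lt : ∀ i ∈ ρ, i < b
  empty : ∀ i, b ≤ i → σ i = []
  values : ρ.map σ = V.map fun g => g x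

/-- The functions in the list `V` together with an additional string argument, which comes
first. -/
abbrev extend {X : Type*} (V : List (X → Str)) : List (X × Str → Str) :=
  Prod.snd :: V.map fun g y => g y.1

namespace Holds

variable {X : Type*} {V : List (X → Str)} {b b' i : ℕ} {ρ : List ℕ} {x : X} {σ : Store}

theorem update (h : Holds V b ρ x σ) (w : Str) (hi : b ≤ i) (hb : i < b') :
    Holds V b' ρ x (Function.update σ i w) where
  lt j hj := (h.lt j hj).trans_le (hi.trans hb.le)
  empty j hj := by rw [Function.update_of_ne (by omega), h.empty j (by omega)]
  values := by
    rw [← h.values]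
    exact List.map_congr_left fun j hj =>
      Function.update_of_ne ((h.lt j hj).trans_le hi).ne w σ

theorem mono (h : Holds V b ρ x σ) (hb : b ≤ b') : Holds V b' ρ x σ where
  lt j hj := (h.lt j hj).trans_le hb
  empty j hj := h.empty j (hb.trans hj)
  values := h.values

theorem extend (h : Holds V b ρ x σ) (hi : i < b) {w : Str} (hw : σ i = w) :
    Holds (extend V) b (i :: ρ) (x, w) σ where
  lt := List.forall_mem_cons.mpr ⟨hi, h.lt⟩
  empty := h.empty
  values := by simp [hw, h.values, Function.comp_def]

theorem update_eq_self (h : Holds V b ρ x σ) (hi : b ≤ i) : Function.update σ i [] = σ := by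
  rw [← h.empty i hi, Function.update_eq_self]

theorem exists_location (h : Holds V b ρ x σ) {n : ℕ} {g : X → Str} (hn : V[n]? = some g) :
    ∃ i, ρ[n]? = some i ∧ i < b ∧ σ i = g x := by
  have hval := congrArg (fun l => l[n]?) h.values
  simp only [List.getElem?_map, hn, Option.map_some, Option.map_eq_some_iff] at hval
  obtain ⟨i, hi, hσ⟩ := hval
  exact ⟨i, hi, h.lt i (List.mem_of_getElem? hi), hσ⟩

end Holds

/-- The string `f x` can be computed, in time polynomial in `S x`, from the strings `g x`, for `g`
in the list `V`: for any locations `ρ` of the latter and any target register `j`, all below `b`,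
some program that uses the registers from `b` on as working space assigns `f x` to register `j`.
The time for clearing the target register is counted separately, as its old content is arbitrary. -/
structure PolyComputable {X : Type*} (V : List (X → Str)) (S : X → ℕ) (f : X → Str) : Prop where
  length_bounded : PolyBounded S fun x => (f x).length
  exists_program : ∀ (b : ℕ) (ρ : List ℕ) (j : ℕ), j < b → ∃ (p : Prog) (τ : X → ℕ),
    PolyBounded S τ ∧ ∀ x σ, Holds V b ρ x σ →
      Runs p σ (Function.update σ j (f x)) (τ x + 2 * (σ j).length)

namespace PolyComputable

variable {X : Type*} {V : List (X → Str)} {S : X → ℕ}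

theorem congr {f f' : X → Str} (h : PolyComputable V S f) (hf : ∀ x, f x = f' x) :
    PolyComputable V S f' :=
  (funext hf : f = f') ▸ h

theorem var (n : ℕ) {g : X → Str} (hn : V[n]? = some g)
    (hb : PolyBounded S fun x => (g x).length) : PolyComputable V S g := by
  refine ⟨hb, fun b ρ j hj => ?_⟩
  rcases hi : ρ[n]? with _ | i
  · exact ⟨.skip, fun _ => 0, .const 0, fun x σ h =>
      absurd (hi.symm.trans (h.exists_location hn).choose_spec.1) (by simp)⟩
  refine ⟨if i = j then .skip else .seq (.clear j) (.seq (.transfer i [b]) (.transfer b [i, j])),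
    fun x => 20 * (g x).length + 5, ((PolyBounded.const 20).mul hb).add (.const 5),
    fun x σ h => ?_⟩
  obtain ⟨_, hi', hib, hval⟩ := h.exists_location hn
  obtain rfl := Option.some_injective _ (hi.symm.trans hi')
  have hb := h.empty b le_rfl
  split_ifs with hij
  · refine (Runs.skip σ).congr ?_ |>.mono (by dsimp only; omega)
    rw [← hval, hij, Function.update_eq_self]
  · refine ((Runs.clear j σ).seq ((Runs.transfer (js := [b]) (by simp) (by simp; omega) _).seq
      (Runs.transfer (js := [i, j]) (by simpa) (by simp; omega) _))).congr ?_ |>.mono ?_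
    · funext y
      simp only [List.mem_cons, List.not_mem_nil, or_false]
      by_cases hy : y = j
      · subst hy; simp [hij, hj.ne, hj.ne', hib.ne', hb, hval]
      by_cases hyi : y = i
      · subst hyi; simp [hij, hib.ne, hib.ne', hj.ne', hb]
      by_cases hyb : y = b
      · subst hyb; simp [hj.ne', hb]
      simp [hy, hyi, hyb]
    · simp [hij, hib.ne', hj.ne', hb, hval]
      omega

theorem const (s : Str) : PolyComputable V S (fun _ => s) := by
  refine ⟨.const _, fun b ρ j _ => ?_⟩
  induction s with
  | nil => exact ⟨.clear j, fun _ => 1, .const 1, fun x σ _ =>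
      (Runs.clear j σ).mono (by dsimp only; omega)⟩
  | cons a s ih =>
    obtain ⟨p, τ, hτ, hp⟩ := ih
    exact ⟨.seq p (.push j a), fun x => τ x + 2, hτ.add (.const 2), fun x σ h =>
      ((hp x σ h).seq (Runs.push j a _)).congr (by simp) |>.mono (by dsimp only; omega)⟩

theorem cons {f : X → Str} (a : Bool) (hf : PolyComputable V S f) :
    PolyComputable V S (fun x => a :: f x) := by
  refine ⟨hf.length_bounded.add (.const 1), fun b ρ j hj => ?_⟩
  obtain ⟨p, τ, hτ, hp⟩ := hf.exists_program b ρ j hj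
  exact ⟨.seq p (.push j a), fun x => τ x + 2, hτ.add (.const 2), fun x σ h =>
    ((hp x σ h).seq (Runs.push j a _)).congr (by simp) |>.mono (by dsimp only; omega)⟩

theorem tail {f : X → Str} (hf : PolyComputable V S f) :
    PolyComputable V S (fun x => (f x).tail) := by
  refine ⟨hf.length_bounded.mono fun x => by simp, fun b ρ j hj => ?_⟩
  obtain ⟨p, τ, hτ, hp⟩ := hf.exists_program b ρ j hj
  exact ⟨.seq p (.pop j), fun x => τ x + 2, hτ.add (.const 2), fun x σ h =>
    ((hp x σ h).seq (Runs.pop j _)).congr (by simp) |>.mono (by dsimp only; omega)⟩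

theorem exists_program_list {hs : List (X → Str)} (hhs : ∀ h ∈ hs, PolyComputable V S h)
    (b : ℕ) (ρ : List ℕ) : ∃ (p : Prog) (τ : X → ℕ), PolyBounded S τ ∧ ∀ x σ, Holds V b ρ x σ →
      ∃ σ', Runs p σ σ' (τ x) ∧ (∀ i < b, σ' i = σ i) ∧
        Holds hs (b + hs.length) (List.range' b hs.length) x σ' := by
  induction hs generalizing b with
  | nil => exact ⟨.skip, fun _ => 3, .const 3, fun x σ h =>
      ⟨σ, Runs.skip σ, fun _ _ => rfl, by simp, h.empty, rfl⟩⟩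
  | cons h hs ih =>
    obtain ⟨p, τ, hτ, hp⟩ := (hhs h List.mem_cons_self).exists_program (b + 1) ρ b (by omega)
    obtain ⟨q, τ', hτ', hq⟩ := ih (fun g hg => hhs g (List.mem_cons_of_mem _ hg)) (b + 1)
    refine ⟨.seq p q, fun x => τ x + τ' x + 1, (hτ.add hτ').add (.const 1), fun x σ hσ => ?_⟩
    obtain ⟨σ', hr, hsame, hh⟩ := hq x _ (hσ.update (h x) le_rfl (Nat.lt_succ_self b))
    refine ⟨σ', ((hp x σ (hσ.mono (Nat.le_succ b))).seq hr).mono ?_, fun i hi => ?_, ?_, ?_, ?_⟩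
    · simp [hσ.empty b le_rfl]
    · rw [hsame i (by omega), Function.update_of_ne hi.ne]
    · intro i hi; rw [List.mem_range'_1] at hi; exact hi.2
    · intro i hi; exact hh.empty i (by simp only [List.length_cons] at hi; omega)
    · simp [List.range'_succ, hsame b, hh.values]

theorem comp {Y : Type*} {W : List (Y → Str)} {S' : Y → ℕ} {G : Y → Str}
    (hG : PolyComputable W S' G) (F : X → Y)
    (hW : ∀ g ∈ W, PolyComputable V S (fun x => g (F x)))
    (hF : PolyBounded S (fun x => S' (F x))) : PolyComputable V S (fun x => G (F x)) := by
  refine ⟨hG.length_bounded.comp F hF, fun b ρ j hj => ?_⟩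
  obtain ⟨B, hB, hlen⟩ := PolyBounded.exists_common W fun g hg => (hW g hg).length_bounded
  obtain ⟨p, τ, hτ, hp⟩ := exists_program_list (hs := W.map fun g x => g (F x)) (b := b) (ρ := ρ)
    (List.forall_mem_map.mpr hW)
  simp only [List.length_map] at hp
  obtain ⟨q, τ', hτ', hq⟩ := hG.exists_program (b + W.length) (List.range' b W.length) j (by omega)
  refine ⟨.seq p (.seq q (.clearFrom b W.length)),
    fun x => τ x + τ' (F x) + W.length * (2 * B x + 2) + 5,
    ((hτ.add (hτ'.comp F hF)).add ((PolyBounded.const _).mul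
      (((PolyBounded.const 2).mul hB).add (.const 2)))).add (.const 5), fun x σ h => ?_⟩
  obtain ⟨σ', hr, hsame, hh⟩ := hp x σ h
  have hh' : Holds W (b + W.length) (List.range' b W.length) (F x) σ' :=
    ⟨hh.lt, hh.empty, by simpa [Function.comp_def] using hh.values⟩
  have hbound : ∀ i < W.length, (Function.update σ' j (G (F x)) (b + i)).length ≤ B x := by
    intro i hi
    have hval := congrArg (fun l => l[i]?) hh'.values
    simp only [List.getElem?_map, List.getElem?_range' hi, List.getElem?_eq_getElem hi,
      Option.map_some, Option.some_inj, one_mul] at hval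
    rw [Function.update_of_ne (by omega), hval]
    exact hlen _ (List.getElem_mem hi) x
  refine (hr.seq ((hq (F x) σ' hh').seq (Runs.clearFrom hbound))).congr ?_ |>.mono ?_
  · funext i
    by_cases hib : i < b
    · rw [if_neg (by omega)]
      simp only [Function.update_apply, hsame i hib]
    · rw [Function.update_of_ne (show i ≠ j by omega) _ σ, h.empty i (by omega)]
      split_ifs with hi
      · rfl
      · rw [Function.update_of_ne (by omega), hh.empty i (by omega)]
  · rw [hsame j hj]
    dsimp only
    omega

theorem cases {f g : X → Str} {h : Bool → X → Str} (hf : PolyComputable V S f)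
    (hg : PolyComputable V S g) (hh : ∀ a, PolyComputable V S (h a)) :
    PolyComputable V S (fun x => (f x).casesOn (g x) (fun a _ => h a x)) := by
  refine ⟨((hg.length_bounded.add (hh false).length_bounded).add (hh true).length_bounded).mono
    fun x => ?_, fun b ρ j hj => ?_⟩
  · rcases f x with _ | ⟨_ | _, _⟩ <;> simp <;> omega
  obtain ⟨p, τ, hτ, hp⟩ := hf.exists_program (b + 1) ρ b (by omega)
  obtain ⟨q, τ', hτ', hq⟩ := hg.exists_program b ρ j hj
  choose r υ hυ hr using fun a => (hh a).exists_program b ρ j hj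
  refine ⟨.seq p (.branch b (.seq (.clear b) q) (.seq (.clear b) (r false))
      (.seq (.clear b) (r true))),
    fun x => τ x + τ' x + υ false x + υ true x + 2 * (f x).length + 4,
    ((((hτ.add hτ').add (hυ false)).add (hυ true)).add
      ((PolyBounded.const 2).mul hf.length_bounded)).add (.const 4), fun x σ hσ => ?_⟩
  have heval := hp x σ (hσ.mono (Nat.le_succ b))
  rw [hσ.empty b le_rfl] at heval
  have hclear : Runs (.clear b) (Function.update σ b (f x)) σ (2 * (f x).length + 1) :=
    (Runs.clear b _).congr (by rw [Function.update_idem, hσ.update_eq_self le_rfl]) |>.mono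
      (by simp)
  rcases hfx : f x with _ | ⟨a, l⟩
  · exact (heval.seq (Runs.branch_nil (by simp [hfx]) (hclear.seq (hq x σ hσ)))).mono
      (by simp only [hfx, List.length_nil]; omega)
  · refine (heval.seq (Runs.branch_cons (p := fun a => .seq (.clear b) (r a)) (l := l)
      (by simp [hfx]) (hclear.seq (hr a x σ hσ)))).mono ?_
    cases a <;> simp only [hfx, List.length_nil, List.length_cons] <;> omega

theorem runs_forEach_foldl {l : Str} {init : Str} {h : Bool → Str → Str} {b E : ℕ}
    {p : Bool → Prog} {σ : Store}
    (hp : ∀ u a v, l = u ++ a :: v →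
      let τ := Function.update (Function.update σ b v) (b + 1) (u.foldl (fun s a => h a s) init)
      Runs (p a) τ (Function.update τ (b + 1) (h a (u.foldl (fun s a => h a s) init))) E) :
    Runs (.forEach b p) (Function.update (Function.update σ b l) (b + 1) init)
      (Function.update (Function.update σ b []) (b + 1) (l.foldl (fun s a => h a s) init))
      (l.length * (E + 4) + 1) := by
  refine Runs.forEach (st := fun u v => Function.update (Function.update σ b v) (b + 1)
    (u.foldl (fun s a => h a s) init)) (fun u v => by simp) fun u a v hl => ?_
  have hupdate (w w' : Str) : Function.update (Function.update (Function.update σ b w) (b + 1) w')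
      b v = Function.update (Function.update σ b v) (b + 1) w' := by
    rw [Function.update_comm (by omega), Function.update_idem]
  rw [hupdate]
  exact (hp u a v hl).congr (by simp)

theorem foldl {l init : X → Str} {h : Bool → X → Str → Str} (hl : PolyComputable V S l)
    (hinit : PolyComputable V S init)
    (hh : ∀ a, PolyComputable (extend V) (fun y => S y.1 + y.2.length) fun y => h a y.1 y.2)
    {B : X → ℕ} (hB : PolyBounded S B)
    (hlen : ∀ x u v, l x = u ++ v → (u.foldl (fun s a => h a x s) (init x)).length ≤ B x) :
    PolyComputable V S fun x => (l x).foldl (fun s a => h a x s) (init x) := by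
  refine ⟨hB.mono fun x => hlen x (l x) [] (by simp), fun b ρ j hj => ?_⟩
  obtain ⟨p, τ, hτ, hp⟩ := hl.exists_program (b + 1) ρ b (by omega)
  obtain ⟨q, τ', hτ', hq⟩ := hinit.exists_program (b + 2) ρ (b + 1) (by omega)
  choose r υ hυ hr using fun a => (hh a).exists_program (b + 2) ((b + 1) :: ρ) (b + 1) (by omega)
  choose k hk using hυ
  let E : X → ℕ := fun x => (S x + B x + 2) ^ k false + (S x + B x + 2) ^ k true + 2 * B x
  have hSB : PolyBounded S fun x => S x + B x + 2 := (PolyBounded.self.add hB).add (.const 2)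
  have hE : PolyBounded S E :=
    ((hSB.pow _).add (hSB.pow _)).add ((PolyBounded.const 2).mul hB)
  refine ⟨.seq p (.seq q (.seq (.forEach b r) (.move (b + 1) j b))),
    fun x => τ x + τ' x + (l x).length * (E x + 4) + 18 * B x + 9,
    (((hτ.add hτ').add (hl.length_bounded.mul (hE.add (.const 4)))).add
      ((PolyBounded.const 18).mul hB)).add (.const 9), fun x σ hσ => ?_⟩
  have hbody : ∀ u a v, l x = u ++ a :: v →
      let τ := Function.update (Function.update σ b v) (b + 1)
        (u.foldl (fun s a => h a x s) (init x))
      Runs (r a) τ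
        (Function.update τ (b + 1) (h a x (u.foldl (fun s a => h a x s) (init x)))) (E x) := by
    intro u a v hx
    have hs := hlen x u (a :: v) hx
    refine (hr a _ _ (((hσ.update v le_rfl (b' := b + 1) (by omega)).update _ le_rfl
      (by omega)).extend (i := b + 1) (by omega) (Function.update_self ..))).mono ?_
    have hpow : υ a (x, u.foldl (fun s a => h a x s) (init x)) ≤ (S x + B x + 2) ^ k a :=
      (hk a _).trans (Nat.pow_le_pow_left (Nat.add_le_add_right (Nat.add_le_add_left hs _) 2) (k a))
    rw [Function.update_self]
    cases a <;> simp only [E] <;> omega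
  have hfst := hp x σ (hσ.mono (Nat.le_succ b))
  have hsnd := hq x _ ((hσ.update (l x) le_rfl (Nat.lt_succ_self b)).mono (Nat.le_succ _))
  have hwhole := hlen x (l x) [] (by simp)
  refine (hfst.seq (hsnd.seq ((runs_forEach_foldl hbody).seq
    (Runs.move (i := b + 1) (j := j) (by omega) (by omega) hj.ne (by simp))))).congr ?_ |>.mono ?_
  · rw [Function.update_self, Function.update_idem, hσ.update_eq_self le_rfl,
      hσ.update_eq_self (Nat.le_succ b)]
  · have hjb : j ≠ b + 1 := by omega
    simp [hσ.empty b le_rfl, hσ.empty (b + 1) (Nat.le_succ b), hj.ne, hjb]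
    omega

end PolyComputable

end Machine

/-! ## Polynomial-time operations on strings -/

namespace Machine

/-- A function of one string that is computable in polynomial time. -/
abbrev PolyComputable₁ (G : Str → Str) : Prop := PolyComputable [id] List.length G

/-- A function of two strings that is computable in polynomial time. -/
abbrev PolyComputable₂ (G : Str → Str → Str) : Prop :=
  PolyComputable [Prod.fst, Prod.snd] (fun y => y.1.length + y.2.length) fun y => G y.1 y.2

/-- The Kronecker product of `0`-`1`-vectors. -/
def kron (u w : Str) : Str := u.flatMap fun a => bif a then w else List.replicate w.length false

theorem length_kron (u w : Str) : (kron u w).length = u.length * w.length := by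
  induction u with
  | nil => simp [kron]
  | cons a u ih =>
    rw [kron] at ih ⊢
    cases a <;> simp [ih] <;> ring

theorem takeWhile_id_eq_foldr (l : Str) :
    l.takeWhile id = l.foldr (fun a w => bif a then true :: w else []) [] := by
  induction l with
  | nil => rfl
  | cons a l ih => cases a <;> simp [ih]

theorem dropWhile_eq_drop_length_takeWhile (l : Str) :
    l.dropWhile id = l.drop (l.takeWhile id).length := by
  conv_rhs => rw [← List.takeWhile_append_dropWhile (p := id) (l := l)]
  exact (List.drop_left' (by rw [List.takeWhile_append_dropWhile])).symm

theorem length_flatMap_le (u : Str) {s : Bool → Str} {m : ℕ} (hs : ∀ a, (s a).length ≤ m) :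
    (u.flatMap s).length ≤ u.length * m := by
  rw [List.length_flatMap]
  exact (List.sum_le_card_nsmul _ m (List.forall_mem_map.mpr fun a _ => hs a)).trans (by simp)

namespace PolyComputable

variable {X : Type*} {V : List (X → Str)} {S : X → ℕ} {f g : X → Str} {c c' : X → Bool}

theorem comp₁ {G : Str → Str} (hG : PolyComputable₁ G) (hf : PolyComputable V S f) :
    PolyComputable V S fun x => G (f x) :=
  hG.comp f (by simpa using hf) hf.length_bounded

theorem comp₂ {G : Str → Str → Str} (hG : PolyComputable₂ G) (hf : PolyComputable V S f)
    (hg : PolyComputable V S g) : PolyComputable V S fun x => G (f x) (g x) :=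
  hG.comp (fun x => (f x, g x)) (by simpa using ⟨hf, hg⟩) (hf.length_bounded.add hg.length_bounded)

theorem id : PolyComputable₁ id := .var 0 rfl .self

theorem fst : PolyComputable₂ fun u _ => u := .var 0 rfl (.of_le fun _ => Nat.le_add_right _ _)

theorem snd : PolyComputable₂ fun _ w => w := .var 1 rfl (.of_le fun _ => Nat.le_add_left _ _)

theorem lift (hV : ∀ g ∈ V, PolyBounded S fun x => (g x).length) (hf : PolyComputable V S f) :
    PolyComputable (extend V) (fun y => S y.1 + y.2.length) fun y => f y.1 := by
  have hS : PolyBounded (fun y : X × Str => S y.1 + y.2.length) fun y => S y.1 :=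
    .of_le fun _ => Nat.le_add_right _ _
  refine hf.comp Prod.fst (fun g hg => ?_) hS
  obtain ⟨i, hi, rfl⟩ := List.getElem_of_mem hg
  exact .var (i + 1) (by simp [hi]) ((hV _ hg).comp Prod.fst hS)

theorem accumulator {W : List (X × Str → Str)} {S' : X × Str → ℕ}
    (hS' : ∀ y, y.2.length ≤ S' y := by exact fun _ => Nat.le_add_left _ _) :
    PolyComputable (Prod.snd :: W) S' fun y => y.2 :=
  .var 0 rfl (.of_le hS')

theorem iterate {l init : X → Str} {h : X → Str → Str} (hl : PolyComputable V S l)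
    (hinit : PolyComputable V S init)
    (hh : PolyComputable (extend V) (fun y => S y.1 + y.2.length) fun y => h y.1 y.2)
    {B : X → ℕ} (hB : PolyBounded S B)
    (hlen : ∀ x, ∀ m ≤ (l x).length, ((h x)^[m] (init x)).length ≤ B x) :
    PolyComputable V S fun x => (h x)^[(l x).length] (init x) :=
  (foldl hl hinit (h := fun _ => h) (fun _ => hh) hB fun x u v hx => by
    rw [List.foldl_const]
    exact hlen x _ (by simp [hx])).congr fun x => List.foldl_const ..

section Bits

theorem cond (hc : PolyComputable V S fun x => [c x]) (hf : PolyComputable V S f)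
    (hg : PolyComputable V S g) : PolyComputable V S fun x => bif c x then f x else g x :=
  (cases hc hf (h := fun a x => bif a then f x else g x)
    (Bool.rec hg hf)).congr fun _ => rfl

theorem ite {p : X → Prop} [∀ x, Decidable (p x)] (hp : PolyComputable V S fun x => [decide (p x)])
    (hf : PolyComputable V S f) (hg : PolyComputable V S g) :
    PolyComputable V S fun x => if p x then f x else g x :=
  (cond hp hf hg).congr fun _ => Bool.cond_decide ..

theorem not (hc : PolyComputable V S fun x => [c x]) : PolyComputable V S fun x => [!c x] :=
  (cond hc (const [false]) (const [true])).congr fun x => by cases c x <;> rfl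

theorem and (hc : PolyComputable V S fun x => [c x]) (hc' : PolyComputable V S fun x => [c' x]) :
    PolyComputable V S fun x => [c x && c' x] :=
  (cond hc hc' (const [false])).congr fun x => by cases c x <;> rfl

theorem or (hc : PolyComputable V S fun x => [c x]) (hc' : PolyComputable V S fun x => [c' x]) :
    PolyComputable V S fun x => [c x || c' x] :=
  (cond hc (const [true]) hc').congr fun x => by cases c x <;> rfl

theorem beq (hc : PolyComputable V S fun x => [c x]) (hc' : PolyComputable V S fun x => [c' x]) :
    PolyComputable V S fun x => [c x == c' x] :=
  (cond hc hc' (not hc')).congr fun x => by cases c x <;> simp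

theorem isEmpty (hf : PolyComputable V S f) : PolyComputable V S fun x => [(f x).isEmpty] :=
  (cases hf (const [true]) (fun _ => const [false])).congr fun x => by cases f x <;> rfl

theorem headD (hf : PolyComputable V S f) : PolyComputable V S fun x => [(f x).headD false] :=
  (cases hf (const [false]) (fun a => const [a])).congr fun x => by cases f x <;> rfl

theorem cons_bit (hc : PolyComputable V S fun x => [c x]) (hf : PolyComputable V S f) :
    PolyComputable V S fun x => c x :: f x :=
  (cond hc (cons true hf) (cons false hf)).congr fun x => by cases c x <;> rfl

end Bits

section Lists

theorem reverse (hf : PolyComputable V S f) : PolyComputable V S fun x => (f x).reverse :=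
  comp₁ ((foldl id (const []) (h := fun a _ w => a :: w) (fun a => cons a accumulator) .self
    fun x u v (hx : x = u ++ v) => by simp [hx]).congr fun x => by simp) hf

theorem append (hf : PolyComputable V S f) (hg : PolyComputable V S g) :
    PolyComputable V S fun x => f x ++ g x :=
  comp₂ (G := (· ++ ·)) ((foldl (reverse fst) snd (h := fun a _ w => a :: w)
    (fun a => cons a accumulator) .self fun x u v hx => by
      have := congrArg List.length hx
      simp only [List.length_reverse, List.length_append] at this
      simp
      omega).congr fun x => by simp) hf hg

theorem drop {u : X → Str} (hu : PolyComputable V S u) (hf : PolyComputable V S f) :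
    PolyComputable V S fun x => (f x).drop (u x).length :=
  comp₂ (G := fun u w => w.drop u.length) ((iterate fst snd (h := fun _ => List.tail)
    (tail accumulator) .self fun x m _ => by rw [List.tail_iterate]; simp; omega).congr fun x =>
      List.tail_iterate ..) hu hf

theorem replicate (a : Bool) {u : X → Str} (hu : PolyComputable V S u) :
    PolyComputable V S fun x => List.replicate (u x).length a := by
  have hiterate (m : ℕ) : (List.cons a)^[m] [] = List.replicate m a := by
    induction m with
    | zero => rfl
    | succ m ih => rw [Function.iterate_succ_apply', ih, List.replicate_succ]
  exact comp₁ (G := fun u => List.replicate u.length a) ((iterate id (const [])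
    (h := fun _ => List.cons a) (cons a accumulator) .self fun x m hm => by
      rw [hiterate]; simpa using hm).congr fun x => hiterate _) hu

theorem take {u : X → Str} (hu : PolyComputable V S u) (hf : PolyComputable V S f) :
    PolyComputable V S fun x => (f x).take (u x).length :=
  (reverse (drop (drop hu hf) (reverse hf))).congr fun x => by
    rw [List.drop_reverse, List.reverse_reverse, List.length_drop]
    rcases le_total (u x).length (f x).length with h | h
    · rw [Nat.sub_sub_self h]
    · rw [List.take_of_length_le h, List.take_of_length_le (by omega)]

theorem takeWhile (hf : PolyComputable V S f) :
    PolyComputable V S fun x => (f x).takeWhile _root_.id :=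
  comp₁ (G := List.takeWhile _root_.id) ((foldl (reverse id) (const [])
    (h := fun a _ w => bif a then true :: w else [])
    (Bool.rec (const []) (cons true accumulator)) .self fun x u v hx => by
      have := congrArg List.length hx
      simp only [List.length_reverse, List.length_append] at this
      rw [← List.foldr_reverse, ← takeWhile_id_eq_foldr]
      exact (List.takeWhile_sublist _).length_le.trans (by simp at this ⊢; omega)).congr fun x => by
        rw [List.foldl_reverse, takeWhile_id_eq_foldr]; rfl) hf

theorem dropWhile (hf : PolyComputable V S f) :
    PolyComputable V S fun x => (f x).dropWhile _root_.id :=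
  (drop (takeWhile hf) hf).congr fun _ => (dropWhile_eq_drop_length_takeWhile _).symm

theorem decide_length_le {u w : X → Str} (hu : PolyComputable V S u) (hw : PolyComputable V S w) :
    PolyComputable V S fun x => [decide ((u x).length ≤ (w x).length)] :=
  (isEmpty (drop hw hu)).congr fun x => by
    rw [List.singleton_inj, Bool.eq_iff_iff]
    simp [List.isEmpty_iff]

theorem decide_length_eq {u w : X → Str} (hu : PolyComputable V S u) (hw : PolyComputable V S w) :
    PolyComputable V S fun x => [decide ((u x).length = (w x).length)] :=
  (and (decide_length_le hu hw) (decide_length_le hw hu)).congr fun x => by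
    simp [le_antisymm_iff]

theorem flatMap {s : Bool → X → Str} (hf : PolyComputable V S f)
    (hs : ∀ a, PolyComputable V S (s a)) :
    PolyComputable V S fun x => (f x).flatMap fun a => s a x := by
  let W : List (Str × Str × Str → Str) := [fun y => y.1, fun y => y.2.1, fun y => y.2.2]
  let S' : Str × Str × Str → ℕ := fun y => y.1.length + (y.2.1.length + y.2.2.length)
  have hfst : PolyComputable W S' fun y => y.1 := .var 0 rfl (.of_le fun _ => by simp [S'])
  have hW : ∀ g ∈ W, PolyBounded S' fun y => (g y).length := by
    simp only [W, List.mem_cons, List.not_mem_nil, or_false]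
    rintro g (rfl | rfl | rfl) <;> exact .of_le fun _ => by simp only [S']; omega
  have hblock (a : Bool) : PolyComputable W S' fun y => bif a then y.2.2 else y.2.1 := by
    cases a
    · exact .var 1 rfl (hW _ (by simp [W]))
    · exact .var 2 rfl (hW _ (by simp [W]))
  have hG : PolyComputable W S' fun y => y.1.flatMap fun a => bif a then y.2.2 else y.2.1 :=
    (foldl hfst (const []) (h := fun a y w => w ++ bif a then y.2.2 else y.2.1)
      (fun a => append accumulator (lift hW (hblock a))) (PolyBounded.self.mul .self)
      fun y u v hy => by
        rw [← List.flatMap_eq_foldl]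
        refine (length_flatMap_le u (m := S' y) fun a => ?_).trans
          (Nat.mul_le_mul_right _ (by simp only [S', hy, List.length_append]; omega))
        cases a <;> simp only [S', cond_true, cond_false] <;> omega).congr fun y =>
        List.flatMap_eq_foldl.symm
  refine (hG.comp (fun x => (f x, s false x, s true x)) ?_ (hf.length_bounded.add
    ((hs false).length_bounded.add (hs true).length_bounded))).congr fun x =>
      congrArg (fun h => (f x).flatMap h) (funext fun a => by cases a <;> rfl)
  simpa [W] using ⟨hf, hs false, hs true⟩

theorem kron (hf : PolyComputable V S f) (hg : PolyComputable V S g) :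
    PolyComputable V S fun x => kron (f x) (g x) :=
  flatMap hf (s := fun a x => bif a then g x else List.replicate (g x).length false)
    (Bool.rec (replicate false hg) hg)

theorem replicate_mul (hf : PolyComputable V S f) (hg : PolyComputable V S g) :
    PolyComputable V S fun x => List.replicate ((f x).length * (g x).length) true :=
  (replicate true (kron hf hg)).congr fun x => by rw [length_kron]

end Lists

end PolyComputable

end Machine

/-! ## Simulation of oracle programs -/

namespace Machine

section ProbabilityMassFunctions

variable {α β : Type*}

theorem bind_congr_of_mem_support {μ : PMF α} {f g : α → PMF β} (h : ∀ a ∈ μ.support, f a = g a) :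
    μ.bind f = μ.bind g := by
  ext b
  rw [PMF.bind_apply, PMF.bind_apply]
  refine tsum_congr fun a => ?_
  by_cases ha : μ a = 0
  · rw [ha, zero_mul, zero_mul]
  · rw [h a ((μ.mem_support_iff a).mpr ha)]

theorem toOuterMeasure_le_one (μ : PMF α) (s : Set α) : μ.toOuterMeasure s ≤ 1 := by
  rw [PMF.toOuterMeasure_apply, ← μ.tsum_coe]
  exact ENNReal.tsum_le_tsum fun a => Set.indicator_le_self _ _ _

theorem le_map_apply (μ : PMF α) (g : α → β) (a : α) : μ a ≤ μ.map g (g a) := by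
  classical
  rw [PMF.map_apply]
  exact (if_pos rfl).ge.trans (ENNReal.le_tsum a)

theorem tsum_pure_mul (a : α) (F : α → ℝ≥0∞) : ∑' b, PMF.pure a b * F b = F a := by
  classical
  rw [tsum_eq_single a fun b hb => by rw [PMF.pure_apply, if_neg hb, zero_mul],
    PMF.pure_apply, if_pos rfl, one_mul]

theorem tsum_mul_le_add (μ : PMF α) {F : α → ℝ≥0∞} (hF : ∀ b, F b ≤ 1) {a : α} {ε : ℝ≥0∞}
    (ha : 1 ≤ μ a + ε) : ∑' b, μ b * F b ≤ F a + ε := by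
  classical
  have hrest : ∑' b, (if b = a then 0 else μ b) ≤ ε := by
    have htotal := ENNReal.tsum_eq_add_tsum_ite (f := μ) a
    rw [μ.tsum_coe] at htotal
    rw [htotal] at ha
    exact (ENNReal.add_le_add_iff_left (μ.apply_ne_top a)).mp ha
  rw [ENNReal.tsum_eq_add_tsum_ite a]
  refine add_le_add (mul_le_of_le_one_left' (μ.coe_le_one a))
    ((ENNReal.tsum_le_tsum fun b => ?_).trans hrest)
  split_ifs
  · exact le_rfl
  · exact mul_le_of_le_one_right' (hF b)

end ProbabilityMassFunctions

section Flagged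

/-- The oracle query that is made by the next step, if any. -/
def query : Config → Option Str
  | ⟨.ask i _ :: _, σ⟩ => some (σ i)
  | _ => none

/-- The deterministic oracle with the given answers. -/
noncomputable def answerOracle (ans : Str → Str) : Oracle := fun q => PMF.pure (ans q)

/-- The distribution after `n` steps of the configuration and of a flag, where queries are answered
by `ans` and each query `q` for which `flagged q` holds raises the flag. -/
noncomputable def runFlagged (ans : Str → Str) (flagged : Str → Bool) :
    ℕ → Bool → Config → PMF (Bool × Config)
  | 0, f, c => PMF.pure (f, c)
  | n + 1, f, c => (step (answerOracle ans) c).bind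
      (runFlagged ans flagged n (f || (query c).any flagged))

variable {O : Oracle} {ans : Str → Str} {flagged : Str → Bool} {c : Config}

theorem step_eq_step_of_query_eq_none (h : query c = none) (O' : Oracle) :
    step O c = step O' c := by
  match c, h with
  | ⟨[], _⟩, _ | ⟨.push .. :: _, _⟩, _ | ⟨.pop .. :: _, _⟩, _ | ⟨.flip .. :: _, _⟩, _
  | ⟨.seq .. :: _, _⟩, _ | ⟨.branch .. :: _, _⟩, _ | ⟨.loop .. :: _, _⟩, _ => rfl

theorem exists_of_query_eq_some {q : Str} (h : query c = some q) :
    ∃ i j k σ, c = ⟨.ask i j :: k, σ⟩ ∧ σ i = q := by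
  match c, h with
  | ⟨.ask i j :: k, σ⟩, h => exact ⟨i, j, k, σ, rfl, Option.some_injective _ h⟩

theorem run_of_todo_eq_nil (O : Oracle) (n : ℕ) (σ : Store) :
    run O n ⟨[], σ⟩ = PMF.pure ⟨[], σ⟩ := by
  induction n with
  | zero => rfl
  | succ n ih => rw [run_succ_of_step_eq_pure (c' := ⟨[], σ⟩) rfl, ih]

theorem runFlagged_of_todo_eq_nil (n : ℕ) (f : Bool) (σ : Store) :
    runFlagged ans flagged n f ⟨[], σ⟩ = PMF.pure (f, ⟨[], σ⟩) := by
  induction n with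
  | zero => rfl
  | succ n ih =>
    rw [runFlagged, show query ⟨[], σ⟩ = none from rfl, Option.any_none, Bool.or_false]
    exact (PMF.pure_bind ..).trans ih

theorem support_run_answerOracle_subset (hans : ∀ q, ans q ∈ (O q).support) (n : ℕ) (c : Config) :
    (run (answerOracle ans) n c).support ⊆ (run O n c).support := by
  have hstep (c : Config) : (step (answerOracle ans) c).support ⊆ (step O c).support := by
    rcases hq : query c with _ | q
    · rw [step_eq_step_of_query_eq_none hq O]
    obtain ⟨i, j, k, σ, rfl, rfl⟩ := exists_of_query_eq_some hq
    simp only [step, answerOracle, PMF.pure_map, PMF.support_pure, PMF.support_map,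
      Set.singleton_subset_iff]
    exact ⟨_, hans _, rfl⟩
  induction n generalizing c with
  | zero => exact subset_rfl
  | succ n ih =>
    simp only [run, PMF.support_bind]
    exact Set.biUnion_mono (hstep c) fun c' _ => ih c'

theorem fst_eq_true_of_mem_support_runFlagged {n : ℕ} {c : Config} {y : Bool × Config}
    (h : y ∈ (runFlagged ans flagged n true c).support) : y.1 = true := by
  induction n generalizing c with
  | zero => rw [runFlagged, PMF.support_pure] at h; exact congrArg Prod.fst h
  | succ n ih =>
    rw [runFlagged, Bool.true_or, PMF.mem_support_bind_iff] at h
    exact h.elim fun c' hc' => ih hc'.2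

theorem fst_eq_false_of_mem_support_runFlagged (hflagged : ∀ q, flagged q = false) {n : ℕ}
    {c : Config} {y : Bool × Config} (h : y ∈ (runFlagged ans flagged n false c).support) :
    y.1 = false := by
  induction n generalizing c with
  | zero => rw [runFlagged, PMF.support_pure] at h; exact congrArg Prod.fst h
  | succ n ih =>
    have hquery : (query c).any flagged = false := by cases query c <;> simp [hflagged]
    rw [runFlagged, hquery, Bool.or_false, PMF.mem_support_bind_iff] at h
    exact h.elim fun c' hc' => ih hc'.2

theorem tsum_step_mul_le {F : Config → ℝ≥0∞} (hF : ∀ c, F c ≤ 1) {ε : ℝ≥0∞}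
    (hc : ∀ q, query c = some q → 1 ≤ O q (ans q) + ε) :
    ∑' c', step O c c' * F c' ≤ ∑' c', step (answerOracle ans) c c' * F c' + ε := by
  rcases hq : query c with _ | q
  · rw [step_eq_step_of_query_eq_none hq (answerOracle ans)]
    exact le_self_add
  obtain ⟨i, j, k, σ, rfl, rfl⟩ := exists_of_query_eq_some hq
  simp only [step, answerOracle, PMF.pure_map, tsum_pure_mul]
  exact tsum_mul_le_add _ hF ((hc _ hq).trans (add_le_add_left (le_map_apply _ _ _) ε))

/-- A union bound over the `n` steps. -/
theorem toOuterMeasure_run_le (A : Set Config) {ε : ℝ≥0∞}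
    (hε : ∀ q, flagged q = true ∨ 1 ≤ O q (ans q) + ε) (n : ℕ) (f : Bool) (c : Config) :
    (run O n c).toOuterMeasure A ≤
      (runFlagged ans flagged n f c).toOuterMeasure {y | y.1 = true ∨ y.2 ∈ A} + n * ε := by
  induction n generalizing f c with
  | zero =>
    simp only [run, runFlagged, Nat.cast_zero, zero_mul, add_zero]
    rw [PMF.toOuterMeasure_pure_apply, PMF.toOuterMeasure_pure_apply]
    split_ifs with hA hA'
    exacts [le_rfl, absurd (Or.inr hA) hA', zero_le, le_rfl]
  | succ n ih =>
    simp only [run, runFlagged, PMF.toOuterMeasure_bind_apply]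
    rcases hf : f || (query c).any flagged with _ | _
    · have hc (q : Str) (hq : query c = some q) : 1 ≤ O q (ans q) + ε := by
        rw [hq, Option.any_some, Bool.or_eq_false_iff] at hf
        exact (hε q).resolve_left (by simp [hf.2])
      refine (tsum_step_mul_le (fun _ => toOuterMeasure_le_one _ _) hc).trans ?_
      rw [Nat.cast_succ, add_mul, one_mul, ← add_assoc]
      refine add_le_add_left ?_ ε
      calc ∑' c', step (answerOracle ans) c c' * (run O n c').toOuterMeasure A
          ≤ ∑' c', step (answerOracle ans) c c' *
              ((runFlagged ans flagged n false c').toOuterMeasure {y | y.1 = true ∨ y.2 ∈ A} +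
                n * ε) := ENNReal.tsum_le_tsum fun c' => mul_le_mul_right (ih _ c') _
        _ = _ := by
          simp only [mul_add]
          rw [ENNReal.tsum_add, ENNReal.tsum_mul_right, PMF.tsum_coe, one_mul]
    · have hraised (c : Config) :
          (runFlagged ans flagged n true c).toOuterMeasure {y | y.1 = true ∨ y.2 ∈ A} = 1 :=
        (PMF.toOuterMeasure_apply_eq_one_iff _ _).mpr fun y hy =>
          Or.inl (fst_eq_true_of_mem_support_runFlagged hy)
      simp only [hraised, mul_one, PMF.tsum_coe]
      rw [← PMF.toOuterMeasure_bind_apply]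
      exact (toOuterMeasure_le_one _ _).trans le_self_add

end Flagged

end Machine

namespace Machine

section Registers

/-- All registers mentioned in the program are below `m`. -/
def Prog.Below (m : ℕ) : Prog → Prop
  | .push i _ => i < m
  | .pop i => i < m
  | .flip i => i < m
  | .ask i j => i < m ∧ j < m
  | .seq p q => p.Below m ∧ q.Below m
  | .branch i p q r => i < m ∧ p.Below m ∧ q.Below m ∧ r.Below m
  | .loop i p => i < m ∧ p.Below m

theorem Prog.Below.mono {m m' : ℕ} (h : m ≤ m') {p : Prog} (hp : p.Below m) : p.Below m' := by
  induction p with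
  | push | pop | flip => exact hp.trans_le h
  | ask => exact ⟨hp.1.trans_le h, hp.2.trans_le h⟩
  | seq _ _ ihp ihq => exact ⟨ihp hp.1, ihq hp.2⟩
  | branch _ _ _ _ ihp ihq ihr =>
    exact ⟨hp.1.trans_le h, ihp hp.2.1, ihq hp.2.2.1, ihr hp.2.2.2⟩
  | loop _ _ ihp => exact ⟨hp.1.trans_le h, ihp hp.2⟩

theorem Prog.exists_below (p : Prog) : ∃ m, p.Below m := by
  induction p with
  | push i | pop i | flip i => exact ⟨i + 1, i.lt_succ_self⟩
  | ask i j => exact ⟨i + j + 1, show i < _ by omega, show j < _ by omega⟩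
  | seq _ _ ihp ihq =>
    obtain ⟨a, ha⟩ := ihp
    obtain ⟨b, hb⟩ := ihq
    exact ⟨a + b, ha.mono (by omega), hb.mono (by omega)⟩
  | branch i _ _ _ ihp ihq ihr =>
    obtain ⟨a, ha⟩ := ihp
    obtain ⟨b, hb⟩ := ihq
    obtain ⟨c, hc⟩ := ihr
    exact ⟨a + b + c + i + 1, show i < _ by omega, ha.mono (by omega), hb.mono (by omega),
      hc.mono (by omega)⟩
  | loop i _ ihp =>
    obtain ⟨a, ha⟩ := ihp
    exact ⟨a + i + 1, show i < _ by omega, ha.mono (by omega)⟩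

/-- The registers from `m` on are empty, and no register is longer than `b`. -/
structure Within (m b : ℕ) (σ : Store) : Prop where
  empty : ∀ i, m ≤ i → σ i = []
  length_le : ∀ i, (σ i).length ≤ b

variable {m b b' a : ℕ} {σ : Store}

theorem Within.mono (h : Within m b σ) (hb : b ≤ b') : Within m b' σ :=
  ⟨h.empty, fun i => (h.length_le i).trans hb⟩

theorem Within.update (h : Within m b σ) {j : ℕ} (hj : j < m) {w : Str} (hb : b ≤ b')
    (hw : w.length ≤ b') : Within m b' (Function.update σ j w) where
  empty i hi := by rw [Function.update_of_ne (by omega), h.empty i hi]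
  length_le i := by
    rcases eq_or_ne i j with rfl | hij
    · rwa [Function.update_self]
    · rw [Function.update_of_ne hij]
      exact (h.length_le i).trans hb

/-- A configuration of a program below `m` with registers of length at most `b`. -/
structure Fits (m b : ℕ) (c : Config) : Prop where
  below : ∀ p ∈ c.todo, p.Below m
  within : Within m b c.regs

theorem Fits.step {O : Oracle} (hO : ∀ q, ∀ w ∈ (O q).support, w.length ≤ a) {c c' : Config}
    (h : Fits m b c) (hc' : c' ∈ (step O c).support) : Fits m (b + (a + 1)) c' := by
  have hb : b ≤ b + (a + 1) := by omega
  rcases c with ⟨_ | ⟨p, k⟩, σ⟩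
  · obtain rfl : c' = ⟨[], σ⟩ := by simpa [Machine.step] using hc'
    exact ⟨h.below, h.within.mono hb⟩
  obtain ⟨hp, hk⟩ := List.forall_mem_cons.mp h.below
  have hσ := h.within
  have hcons {q : Prog} {k : List Prog} (hq : q.Below m) (hk : ∀ p ∈ k, p.Below m) :
      Fits m (b + (a + 1)) ⟨q :: k, σ⟩ := ⟨List.forall_mem_cons.mpr ⟨hq, hk⟩, hσ.mono hb⟩
  have hset {j : ℕ} (hj : j < m) {w : Str} (hw : w.length ≤ (σ j).length + 1 ∨ w.length ≤ a) :
      Fits m (b + (a + 1)) ⟨k, Function.update σ j w⟩ :=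
    ⟨hk, hσ.update hj hb (by have := hσ.length_le j; dsimp only at this; omega)⟩
  cases p with simp only [Machine.step] at hc'
  | push i x =>
    obtain rfl := by simpa using hc'
    exact hset hp (Or.inl (by simp))
  | pop i =>
    obtain rfl := by simpa using hc'
    exact hset hp (Or.inl (by simp; omega))
  | flip i =>
    obtain ⟨x, -, rfl⟩ := (PMF.mem_support_map_iff ..).mp hc'
    exact hset hp (Or.inl (by simp))
  | ask i j =>
    obtain ⟨w, hw, rfl⟩ := (PMF.mem_support_map_iff ..).mp hc'
    exact hset hp.2 (Or.inr (hO _ w hw))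
  | seq p q =>
    obtain rfl := by simpa using hc'
    exact hcons hp.1 (List.forall_mem_cons.mpr ⟨hp.2, hk⟩)
  | branch i p q r =>
    split at hc' <;> obtain rfl := by simpa using hc'
    exacts [hcons hp.2.1 hk, hcons hp.2.2.1 hk, hcons hp.2.2.2 hk]
  | loop i p =>
    split at hc' <;> obtain rfl := by simpa using hc'
    exacts [⟨hk, hσ.mono hb⟩, hcons hp.2 (List.forall_mem_cons.mpr ⟨hp, hk⟩)]

end Registers

section Translation

/-- The program with its registers shifted by two and its oracle calls replaced by other
programs. -/
def Prog.translate (A : ℕ → ℕ → Prog) : Prog → Prog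
  | .push i b => .push (i + 2) b
  | .pop i => .pop (i + 2)
  | .flip i => .flip (i + 2)
  | .ask i j => A i j
  | .seq p q => .seq (p.translate A) (q.translate A)
  | .branch i p q r => .branch (i + 2) (p.translate A) (q.translate A) (r.translate A)
  | .loop i p => .loop (i + 2) (p.translate A)

/-- The registers of the simulation: the instance, the flag, and the simulated registers. -/
def simStore (x : Str) (f : Bool) (σ : Store) : Store
  | 0 => x
  | 1 => bif f then [true] else []
  | i + 2 => σ i

/-- The configuration of the simulation, which goes on with `rest` when the simulated program has
halted. -/
def simConfig (A : ℕ → ℕ → Prog) (rest : Prog) (x : Str) (f : Bool) (c : Config) : Config :=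
  ⟨c.todo.map (Prog.translate A) ++ [rest], simStore x f c.regs⟩

variable {A : ℕ → ℕ → Prog} {rest : Prog} {x : Str} {f : Bool} {σ : Store}

theorem update_simStore (i : ℕ) (w : Str) :
    Function.update (simStore x f σ) (i + 2) w = simStore x f (Function.update σ i w) := by
  funext a
  rcases a with _ | _ | a <;> simp [simStore, Function.update_apply]

theorem update_simStore_one (f' : Bool) :
    Function.update (simStore x f σ) 1 (bif f' then [true] else []) = simStore x f' σ := by
  funext a
  rcases a with _ | _ | a <;> simp [simStore]

theorem step_simConfig (O : Oracle) {c : Config} (hc : c.todo ≠ []) (hq : query c = none) :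
    step noOracle (simConfig A rest x f c) = (step O c).map (simConfig A rest x f) := by
  rcases c with ⟨_ | ⟨p, k⟩, σ⟩
  · exact absurd rfl hc
  cases p with
  | ask => simp [query] at hq
  | branch i | loop i =>
    rcases hi : σ i with _ | ⟨_ | _, l⟩ <;>
      simp [step, simConfig, Prog.translate, simStore, PMF.pure_map, hi]
  | flip =>
    simp only [step, simConfig, Prog.translate, simStore, PMF.map_comp, List.map_cons,
      List.cons_append, update_simStore]
    rfl
  | _ => simp [step, simConfig, Prog.translate, simStore, PMF.pure_map, update_simStore]

variable {ans : Str → Str} {flagged : Str → Bool} {m L M T : ℕ} {result : Bool → Store → Store}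

theorem run_simConfig_of_todo_eq_nil
    {c : Config} (hc : c.todo = []) (hrest : Runs rest (simStore x f c.regs) (result f c.regs) T)
    {n N : ℕ} (hN : T ≤ N) :
    run noOracle N (simConfig A rest x f c) =
      (runFlagged ans flagged n f c).map fun y => ⟨[], result y.1 y.2.regs⟩ := by
  obtain ⟨_, σ⟩ := c
  obtain rfl := hc
  obtain ⟨t, ht, hr⟩ := hrest
  obtain ⟨N, rfl⟩ := Nat.exists_eq_add_of_le (ht.trans hN)
  rw [runFlagged_of_todo_eq_nil, PMF.pure_map]
  exact (hr [] N).trans (run_of_todo_eq_nil ..)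

theorem run_simConfig {a : ℕ} (hans : ∀ q, (ans q).length ≤ a)
    (hA : ∀ i < m, ∀ j < m, ∀ f σ, Within m L σ → Runs (A i j) (simStore x f σ)
      (simStore x (f || flagged (σ i)) (Function.update σ j (ans (σ i)))) M)
    (hrest : ∀ f σ, Within m L σ → Runs rest (simStore x f σ) (result f σ) T)
    {n N b : ℕ} {c : Config} (hfits : Fits m b c) (hL : b + n * (a + 1) ≤ L)
    (hhalt : ∀ c' ∈ (run (answerOracle ans) n c).support, c'.todo = [])
    (hN : n * (M + 1) + T ≤ N) :
    run noOracle N (simConfig A rest x f c) =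
      (runFlagged ans flagged n f c).map fun y => ⟨[], result y.1 y.2.regs⟩ := by
  induction n generalizing f N b c with
  | zero =>
    exact run_simConfig_of_todo_eq_nil (hhalt c (by simp [run]))
      (hrest f _ (hfits.within.mono (by omega))) (by omega)
  | succ n ih => ?_
  by_cases hc : c.todo = []
  · exact run_simConfig_of_todo_eq_nil hc (hrest f _ (hfits.within.mono (by omega))) (by omega)
  rw [add_mul, one_mul] at hL hN
  have hnext (f : Bool) {N : ℕ} (hN : n * (M + 1) + T ≤ N) {c' : Config}
      (hc' : c' ∈ (step (answerOracle ans) c).support) :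
      run noOracle N (simConfig A rest x f c') =
        (runFlagged ans flagged n f c').map fun y => ⟨[], result y.1 y.2.regs⟩ := by
    have hfits' : Fits m (b + (a + 1)) c' := hfits.step (fun q w hw => ?_) hc'
    · refine ih hfits' (by omega) (fun c'' hc'' => hhalt c'' ?_) hN
      rw [run, PMF.mem_support_bind_iff]
      exact ⟨c', hc', hc''⟩
    · rw [answerOracle, PMF.support_pure, Set.mem_singleton_iff] at hw
      exact hw ▸ hans q
  rcases hq : query c with _ | q
  · obtain ⟨N, rfl⟩ := Nat.exists_eq_add_of_le' (show 1 ≤ N by omega)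
    rw [run, step_simConfig (answerOracle ans) hc hq, PMF.bind_map, runFlagged, hq,
      Option.any_none, Bool.or_false, PMF.map_bind]
    exact bind_congr_of_mem_support fun c' hc' => hnext f (by omega) hc'
  · obtain ⟨i, j, k, σ, rfl, rfl⟩ := exists_of_query_eq_some hq
    have hstep : step (answerOracle ans) ⟨.ask i j :: k, σ⟩ =
        PMF.pure ⟨k, Function.update σ j (ans (σ i))⟩ := PMF.pure_map ..
    obtain ⟨hi, hj⟩ := hfits.below _ List.mem_cons_self
    obtain ⟨t, ht, hr⟩ := hA i hi j hj f σ (hfits.within.mono (by omega))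
    obtain ⟨N, rfl⟩ := Nat.exists_eq_add_of_le (show t ≤ N by omega)
    rw [runFlagged, hstep, PMF.pure_bind, hq, Option.any_some]
    refine (hr _ N).trans (hnext _ (by omega) (c' := ⟨k, Function.update σ j (ans (σ i))⟩) ?_)
    rw [hstep, PMF.support_pure, Set.mem_singleton_iff]

end Translation

end Machine

namespace Machine

section SimulatingProgram

variable {X : Type*} {enc : X → Str} {S : X → ℕ} {ans : X → Str → Str}
  {flagged verdict : X → Str → Bool}

theorem holds_simStore {m b i : ℕ} (hm : m + 2 ≤ b) (hi : i + 2 < b) (x : X) (f : Bool)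
    {σ : Store} (hσ : ∀ k, m ≤ k → σ k = []) :
    Holds (extend [enc]) b [i + 2, 0] (x, σ i) (simStore (enc x) f σ) where
  lt := by simp only [List.mem_cons, List.not_mem_nil, or_false]; omega
  empty k hk := by
    obtain ⟨k, rfl⟩ := Nat.exists_eq_add_of_le' (show 2 ≤ k by omega)
    exact hσ k (by omega)
  values := rfl

theorem exists_program_answering
    (hans : PolyComputable (extend [enc]) (fun y => S y.1 + y.2.length) fun y => ans y.1 y.2)
    (hflagged : PolyComputable (extend [enc]) (fun y => S y.1 + y.2.length)
      fun y => [flagged y.1 y.2]) (m i j : ℕ) :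
    ∃ (p : Prog) (τ : X × Str → ℕ), PolyBounded (fun y => S y.1 + y.2.length) τ ∧
      ∀ x f σ, (∀ k, m ≤ k → σ k = []) → Runs p (simStore (enc x) f σ)
        (simStore (enc x) (f || flagged x (σ i)) (Function.update σ j (ans x (σ i))))
        (τ (x, σ i) + 2 * (σ j).length) := by
  obtain ⟨p, τ, hτ, hp⟩ := (hflagged.cond (.const [true]) (.const [])).exists_program
    (m + i + j + 3) [i + 2, 0] 1 (by omega)
  obtain ⟨q, υ, hυ, hq⟩ := hans.exists_program (m + i + j + 3) [i + 2, 0] (j + 2) (by omega)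
  refine ⟨.seq (.branch 1 p .skip .skip) q, fun y => τ y + υ y + 8,
    (hτ.add hυ).add (.const 8), fun x f σ hσ => ?_⟩
  have hholds (f : Bool) := holds_simStore (enc := enc) (b := m + i + j + 3) (i := i)
    (by omega) (by omega) x f hσ
  have hflag : Runs (.branch 1 p .skip .skip) (simStore (enc x) f σ)
      (simStore (enc x) (f || flagged x (σ i)) σ) (τ (x, σ i) + 4) := by
    cases f
    · have hrun := hp (x, σ i) _ (hholds false)
      rw [update_simStore_one] at hrun
      exact (Runs.branch_nil rfl hrun).mono (by simp [simStore])
    · exact (Runs.branch_cons (p := fun _ => .skip) (a := true) rfl (Runs.skip _)).mono (by omega)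
  have hanswer := hq (x, σ i) _ (hholds (f || flagged x (σ i)))
  rw [update_simStore] at hanswer
  exact (hflag.seq hanswer).mono (by simp only [simStore]; omega)

theorem exists_programs_answering
    (hans : PolyComputable (extend [enc]) (fun y => S y.1 + y.2.length) fun y => ans y.1 y.2)
    (hflagged : PolyComputable (extend [enc]) (fun y => S y.1 + y.2.length)
      fun y => [flagged y.1 y.2]) (m : ℕ) :
    ∃ (A : ℕ → ℕ → Prog) (k : ℕ), ∀ x L, ∀ i < m, ∀ j < m, ∀ f σ, Within m L σ →
      Runs (A i j) (simStore (enc x) f σ)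
        (simStore (enc x) (f || flagged x (σ i)) (Function.update σ j (ans x (σ i))))
        ((S x + L + 2) ^ k + 2 * L) := by
  choose A τ hτ hA using exists_program_answering hans hflagged m
  obtain ⟨B, ⟨k, hk⟩, hB⟩ := PolyBounded.exists_common (List.range m ×ˢ List.range m)
    (τ := fun ij => τ ij.1 ij.2) fun ij _ => hτ ij.1 ij.2
  refine ⟨A, k, fun x L i hi j hj f σ hσ => (hA i j x f σ hσ.empty).mono ?_⟩
  have htime : τ i j (x, σ i) ≤ (S x + L + 2) ^ k :=
    (hB (i, j) (by simp [hi, hj]) _).trans <| (hk _).trans <|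
      Nat.pow_le_pow_left (Nat.add_le_add_right (Nat.add_le_add_left (hσ.length_le i) _) _) k
  have := hσ.length_le j
  omega

theorem exists_program_deciding
    (hverdict : PolyComputable (extend [enc]) (fun y => S y.1 + y.2.length)
      fun y => [verdict y.1 y.2]) (m : ℕ) :
    ∃ (p : Prog) (k : ℕ), ∀ x L f σ, Within m L σ → Runs p (simStore (enc x) f σ)
      (Function.update (simStore (enc x) f σ) 0 [f || verdict x (σ 0)])
      ((S x + L + 2) ^ k + 2 * (enc x).length) := by
  obtain ⟨p, τ, hτ, hp⟩ := hverdict.exists_program (m + 3) [2, 0] 0 (by omega)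
  obtain ⟨q, υ, hυ, hq⟩ := (PolyComputable.const (V := extend [enc])
    (S := fun y => S y.1 + y.2.length) [true]).exists_program (m + 3) [2, 0] 0 (by omega)
  obtain ⟨k, hk⟩ := (hτ.add hυ).add (.const 1)
  refine ⟨.branch 1 p .skip q, k, fun x L f σ hσ => ?_⟩
  have hholds := holds_simStore (enc := enc) (b := m + 3) (i := 0) (by omega) (by omega) x f
    hσ.empty
  have htime : τ (x, σ 0) + υ (x, σ 0) + 1 ≤ (S x + L + 2) ^ k := (hk _).trans <|
    Nat.pow_le_pow_left (Nat.add_le_add_right (Nat.add_le_add_left (hσ.length_le 0) _) _) k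
  cases f
  · exact (Runs.branch_nil rfl (hp _ _ hholds)).mono (by simp only [simStore]; omega)
  · have hrun := Runs.branch_cons (i := 1) (q := p) (p := Bool.rec .skip q) (a := true) (l := [])
      rfl (hq _ _ hholds)
    exact hrun.mono (by simp only [simStore]; omega)

theorem exists_program_preparing {input : X → Str} (hinput : PolyComputable [enc] S input) :
    ∃ (p : Prog) (k : ℕ), ∀ x, Runs p (Function.update (fun _ => []) 0 (enc x))
      (simStore (enc x) false (Function.update (fun _ => []) 0 (input x))) ((S x + 2) ^ k) := by
  obtain ⟨p, τ, ⟨k, hk⟩, hp⟩ := hinput.exists_program 3 [0] 2 (by omega)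
  have hstart (x : X) : Function.update (fun _ => []) 0 (enc x) =
      simStore (enc x) false fun _ => [] := by
    funext i
    rcases i with _ | _ | i <;> simp [simStore]
  refine ⟨p, k, fun x => ?_⟩
  have hholds : Holds [enc] 3 [0] x (simStore (enc x) false fun _ => []) :=
    ⟨by simp, fun i hi => by obtain ⟨i, rfl⟩ := Nat.exists_eq_add_of_le' hi; rfl, rfl⟩
  rw [hstart, ← update_simStore]
  exact (hp x _ hholds).mono ((hk x).trans_eq' (by simp [simStore]))

theorem exists_program_simulating {input : X → Str} {T a : X → ℕ}
    (henc : ∀ x, (enc x).length ≤ S x) (hinput : PolyComputable [enc] S input)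
    (hans : PolyComputable (extend [enc]) (fun y => S y.1 + y.2.length) fun y => ans y.1 y.2)
    (hflagged : PolyComputable (extend [enc]) (fun y => S y.1 + y.2.length)
      fun y => [flagged y.1 y.2])
    (hverdict : PolyComputable (extend [enc]) (fun y => S y.1 + y.2.length)
      fun y => [verdict y.1 y.2])
    (ha : PolyBounded S a) (hlen : ∀ x q, (ans x q).length ≤ a x) (p : Prog) :
    ∃ (P : Prog) (τ : X → ℕ), PolyBounded (fun x => S x + T x) τ ∧ ∀ x N, τ x ≤ N →
      HaltsWithin (answerOracle (ans x)) p (input x) (T x) →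
      run noOracle N (initial P (enc x)) =
        (runFlagged (ans x) (flagged x) (T x) false (initial p (input x))).map fun y =>
          ⟨[], Function.update (simStore (enc x) y.1 y.2.regs) 0
            [y.1 || verdict x (y.2.regs 0)]⟩ := by
  obtain ⟨m, hm⟩ : ∃ m, p.Below (m + 1) := p.exists_below.imp fun m h => h.mono m.le_succ
  obtain ⟨P₁, k₁, h₁⟩ := exists_program_preparing hinput
  obtain ⟨A, k₂, h₂⟩ := exists_programs_answering hans hflagged (m + 1)
  obtain ⟨P₃, k₃, h₃⟩ := exists_program_deciding hverdict (m + 1)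
  let L (x : X) := (input x).length + T x * (a x + 1)
  refine ⟨.seq P₁ (.seq (p.translate A) P₃), fun x => (S x + 2) ^ k₁ + 2 +
    (T x * ((S x + L x + 2) ^ k₂ + 2 * L x + 1) + ((S x + L x + 2) ^ k₃ + 2 * (enc x).length)),
    ?_, fun x N hN hhalt => ?_⟩
  · have hS : PolyBounded (fun x => S x + T x) S := .of_le fun x => Nat.le_add_right _ _
    have hT : PolyBounded (fun x => S x + T x) T := .of_le fun x => Nat.le_add_left _ _
    have hL : PolyBounded (fun x => S x + T x) L :=
      (hinput.length_bounded.comp _root_.id hS).add (hT.mul ((ha.comp _root_.id hS).add (.const 1)))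
    have hSL := (hS.add hL).add (.const 2)
    exact (((hS.add (.const 2)).pow k₁).add (.const 2)).add
      ((hT.mul (((hSL.pow k₂).add ((PolyBounded.const 2).mul hL)).add (.const 1))).add
        ((hSL.pow k₃).add ((PolyBounded.const 2).mul (hS.mono henc))))
  · obtain ⟨t, ht, hr⟩ := h₁ x
    dsimp only at hN
    obtain ⟨N, rfl⟩ := Nat.exists_eq_add_of_le (show t + 2 ≤ N by omega)
    have hwithin : Within (m + 1) (input x).length (initial p (input x)).regs :=
      Within.update (b := 0) ⟨fun _ _ => rfl, fun _ => le_rfl⟩ m.succ_pos (Nat.zero_le _) le_rfl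
    have hfits : Fits (m + 1) (input x).length (initial p (input x)) :=
      ⟨by simpa [initial] using hm, hwithin⟩
    rw [← run_simConfig (hlen x) (h₂ x (L x)) (h₃ x (L x)) hfits le_rfl hhalt (N := N)
      (by omega), show t + 2 + N = t + (N + 1) + 1 by omega, initial,
      run_succ_of_step_eq_pure rfl, hr, run_succ_of_step_eq_pure rfl]
    rfl

end SimulatingProgram

end Machine

namespace RL

open Machine

/-! ## Values of Markov decision processes -/

/-- The distribution of a reward that is `1` with probability `p` and `0` otherwise. -/
noncomputable def zeroOneReward (p : ℝ≥0∞) (h : p ≤ 1) : PMF ℚ :=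
  (PMF.ofFintype (fun b : Bool => bif b then p else 1 - p) (by simp [h])).map
    fun b => bif b then 1 else 0

section ZeroOneReward

variable {p : ℝ≥0∞} {h : p ≤ 1}

theorem zeroOneReward_one : zeroOneReward p h 1 = p := by
  rw [zeroOneReward, PMF.map_apply, tsum_bool]; simp

theorem zeroOneReward_zero : zeroOneReward p h 0 = 1 - p := by
  rw [zeroOneReward, PMF.map_apply, tsum_bool]; simp

theorem eq_zero_or_eq_one_of_mem_support_zeroOneReward {q : ℚ}
    (hq : q ∈ (zeroOneReward p h).support) : q = 0 ∨ q = 1 := by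
  rw [zeroOneReward, PMF.support_map] at hq
  obtain ⟨b, -, rfl⟩ := hq
  cases b <;> simp

theorem tsum_zeroOneReward : ∑' q : ℚ, (zeroOneReward p h q).toReal * (q : ℝ) = p.toReal := by
  rw [tsum_eq_single 1 fun q hq => ?_, zeroOneReward_one, Rat.cast_one, mul_one]
  by_cases hsupp : q ∈ (zeroOneReward p h).support
  · simp [(eq_zero_or_eq_one_of_mem_support_zeroOneReward hsupp).resolve_right hq]
  · simp [(PMF.apply_eq_zero_iff _ _).mpr hsupp]

end ZeroOneReward

namespace MDP

/-- The expected total reward of the first `T` steps, for the policy `π` started in `o`, which may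
be the end state. -/
noncomputable def totalReward (M : MDP) (π : M.Policy) (o : Option M.State) (T : ℕ) : ℝ :=
  ∑ t ∈ Finset.range T, ((fun o : Option M.State => o.bind fun s' => M.next s' (π s'))^[t] o).elim 0
    fun s' => M.meanReward s' (π s')

/-- The function `G` solves the optimality equations for `V^*`. -/
structure IsBellmanSolution (M : MDP) (G : M.State → ℝ) : Prop where
  nonneg : ∀ s, 0 ≤ G s
  meanReward_add_le : ∀ s a, M.meanReward s a + (M.next s a).elim 0 G ≤ G s
  exists_eq : ∀ s, ∃ a, M.meanReward s a + (M.next s a).elim 0 G = G s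

/-- The state in which the end state is entered when the actions are taken from `s` on; further
actions have no effect. -/
def lastState (M : MDP) (s : M.State) (as : List Bool) : M.State :=
  as.foldl (fun s a => (M.next s a).getD s) s

variable {M : MDP} {G : M.State → ℝ} {π : M.Policy}

@[simp]
theorem totalReward_zero (o : Option M.State) : M.totalReward π o 0 = 0 :=
  Finset.sum_range_zero _

theorem totalReward_some_succ (s : M.State) (T : ℕ) :
    M.totalReward π (some s) (T + 1) =
      M.meanReward s (π s) + M.totalReward π (M.next s (π s)) T := by
  rw [totalReward, Finset.sum_range_succ']
  simp [totalReward, add_comm]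

@[simp]
theorem totalReward_none (T : ℕ) : M.totalReward π none T = 0 :=
  Finset.sum_eq_zero fun t _ => by rw [Function.iterate_fixed rfl]; rfl

theorem totalReward_le (hG : M.IsBellmanSolution G) (T : ℕ) (o : Option M.State) :
    M.totalReward π o T ≤ o.elim 0 G := by
  induction T generalizing o with
  | zero => cases o <;> simp [hG.nonneg]
  | succ T ih =>
    cases o with
    | none => simp
    | some s =>
      rw [totalReward_some_succ]
      exact (add_le_add_right (ih _) _).trans (hG.meanReward_add_le s (π s))

theorem totalReward_eq_of_greedy
    (hπ : ∀ s, M.meanReward s (π s) + (M.next s (π s)).elim 0 G = G s) (T : ℕ)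
    (o : Option M.State)
    (hT : (fun o : Option M.State => o.bind fun s' => M.next s' (π s'))^[T] o = none) :
    M.totalReward π o T = o.elim 0 G := by
  induction T generalizing o with
  | zero => rw [show o = none from hT]; simp
  | succ T ih =>
    cases o with
    | none => simp
    | some s => rw [totalReward_some_succ, ih (M.next s (π s)) hT]; exact hπ s

namespace IsBellmanSolution

theorem V_le (hG : M.IsBellmanSolution G) (π : M.Policy) (s : M.State) : M.V π s ≤ G s :=
  totalReward_le hG M.horizon (some s)

theorem Q_le (hG : M.IsBellmanSolution G) (π : M.Policy) (s : M.State) (a : Bool) :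
    M.Q π s a ≤ M.meanReward s a + (M.next s a).elim 0 G := by
  rw [Q]
  rcases M.next s a with _ | t
  · exact le_rfl
  · exact add_le_add_right (hG.V_le π t) _

theorem exists_V_eq (hG : M.IsBellmanSolution G) : ∃ π, M.V π = G := by
  choose π hπ using hG.exists_eq
  exact ⟨π, funext fun s => totalReward_eq_of_greedy hπ _ (some s) (M.horizon_spec π s)⟩

theorem VStar_eq (hG : M.IsBellmanSolution G) (s : M.State) : M.VStar s = G s := by
  obtain ⟨π, hπ⟩ := hG.exists_V_eq
  refine le_antisymm (ciSup_le fun π => hG.V_le π s) ?_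
  calc G s = M.V π s := by rw [hπ]
    _ ≤ M.VStar s := le_ciSup (f := fun π => M.V π s)
        ⟨G s, Set.forall_mem_range.mpr fun π => hG.V_le π s⟩ π

theorem QStar_eq (hG : M.IsBellmanSolution G) (s : M.State) (a : Bool) :
    M.QStar s a = M.meanReward s a + (M.next s a).elim 0 G := by
  obtain ⟨π, hπ⟩ := hG.exists_V_eq
  refine le_antisymm (ciSup_le fun π => hG.Q_le π s a) ?_
  calc M.meanReward s a + (M.next s a).elim 0 G = M.Q π s a := by rw [Q, hπ]
    _ ≤ M.QStar s a := le_ciSup (f := fun π => M.Q π s a)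
        ⟨_, Set.forall_mem_range.mpr fun π => hG.Q_le π s a⟩ π

end IsBellmanSolution

section LastState

variable {s t : M.State} {as : List Bool}

theorem lastState_cons {a : Bool} (h : M.next s a = some t) :
    M.lastState s (a :: as) = M.lastState t as := by
  simp [lastState, h]

theorem lastState_eq_self (h : ∀ a, M.next s a = none) : M.lastState s as = s := by
  induction as with
  | nil => rfl
  | cons a as ih => rwa [lastState, List.foldl_cons, h a]

theorem next_lastState_of_executes (hend : ∀ s a b, M.next s a = none → M.next s b = none)
    (h : M.Executes π (some s) as) (a : Bool) : M.next (M.lastState s as) a = none := by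
  induction as generalizing s with
  | nil => exact h.elim
  | cons b as ih =>
    obtain ⟨rfl, h⟩ := h
    rcases hn : M.next s (π s) with _ | t
    · rw [lastState_eq_self fun b => hend s _ b hn]
      exact hend s _ a hn
    · rw [hn] at h
      rw [lastState_cons hn]
      exact ih h

theorem totalReward_le_of_executes (hend : ∀ s a b, M.next s a = none → M.next s b = none)
    (hzero : ∀ s a, M.next s a ≠ none → M.meanReward s a = 0)
    (hlast : ∀ s a, M.next s a = none → M.meanReward s a ≤ G s) (hG : ∀ s, 0 ≤ G s)
    (h : M.Executes π (some s) as) (T : ℕ) :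
    M.totalReward π (some s) T ≤ G (M.lastState s as) := by
  induction as generalizing s T with
  | nil => exact h.elim
  | cons a as ih =>
    obtain ⟨rfl, h⟩ := h
    cases T with
    | zero => simpa using hG _
    | succ T =>
      rw [totalReward_some_succ]
      rcases hn : M.next s (π s) with _ | t
      · rw [lastState_eq_self fun b => hend s _ b hn, totalReward_none, add_zero]
        exact hlast s _ hn
      · rw [hn] at h
        rw [lastState_cons hn, hzero s _ (by simp [hn]), zero_add]
        exact ih h T

end LastState

end MDP

end RL

namespace Machine

/-! ## Binary counters -/

/-- The number with the given binary digits, least significant digit first; leading zeros are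
allowed, unlike in `Nat.bits`. -/
def binaryValue : Str → ℕ
  | [] => 0
  | b :: l => b.toNat + 2 * binaryValue l

/-- The digits of the successor of a number in binary. -/
def increment (l : Str) : Str :=
  List.replicate (l.takeWhile id).length false ++ true :: (l.dropWhile id).tail

@[simp]
theorem increment_nil : increment [] = [true] := by simp [increment]

@[simp]
theorem increment_cons_false (l : Str) : increment (false :: l) = true :: l := by simp [increment]

@[simp]
theorem increment_cons_true (l : Str) : increment (true :: l) = false :: increment l := by
  simp [increment, List.replicate_succ]

theorem length_increment {l : Str} (h : l.all id = false) : (increment l).length = l.length := by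
  induction l with
  | nil => simp at h
  | cons b l ih => cases b <;> simp_all

theorem binaryValue_increment (l : Str) : binaryValue (increment l) = binaryValue l + 1 := by
  induction l with
  | nil => simp [binaryValue]
  | cons b l ih =>
    cases b
    · simp only [increment_cons_false, binaryValue, Bool.toNat_true, Bool.toNat_false]
      omega
    · simp only [increment_cons_true, binaryValue, ih, Bool.toNat_true, Bool.toNat_false]
      omega

theorem binaryValue_lt (l : Str) : binaryValue l < 2 ^ l.length := by
  induction l with
  | nil => simp [binaryValue]
  | cons b l ih =>
    have := b.toNat_le
    rw [binaryValue, List.length_cons, pow_succ]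
    omega

theorem binaryValue_add_one_of_all {l : Str} (h : l.all id) : binaryValue l + 1 = 2 ^ l.length := by
  induction l with
  | nil => simp [binaryValue]
  | cons b l ih =>
    simp only [List.all_cons, id_eq, Bool.and_eq_true] at h
    rw [binaryValue, h.1, List.length_cons, pow_succ, ← ih h.2, Bool.toNat_true]
    omega

theorem binaryValue_replicate_false (n : ℕ) : binaryValue (List.replicate n false) = 0 := by
  induction n with
  | zero => rfl
  | succ n ih => simp [List.replicate_succ, binaryValue, ih]

theorem increment_bits (n : ℕ) : increment n.bits = (n + 1).bits := by
  induction n using Nat.binaryRec' with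
  | zero => simp
  | bit b n h ih =>
    rw [Nat.bits_append_bit n b h]
    cases b
    · rw [increment_cons_false, ← Nat.bits_append_bit n true fun _ => rfl]
      rfl
    · rw [increment_cons_true, ih, ← Nat.bits_append_bit (n + 1) false (by simp)]
      rfl

theorem getD_modify_not {w : Str} {i : ℕ} (hi : i < w.length) (j : ℕ) :
    (w.modify i not).getD j false = if i = j then !w.getD i false else w.getD j false := by
  rw [List.getD_eq_getElem?_getD, List.getElem?_modify]
  split_ifs with h
  · subst h; simp [hi]
  · simp

end Machine

namespace ThreeSat

open Machine

/-! ## Falsified clauses -/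

/-- The value of a literal under an assignment that is given by a string.  Bits beyond the end of
the string are `0`. -/
def Literal.eval {v : ℕ} (w : Str) (l : Literal v) : Bool := w.getD l.1 false == l.2

/-- The value of a clause under an assignment that is given by a string. -/
def Clause.eval {v : ℕ} (w : Str) (C : Clause v) : Bool :=
  Literal.eval w C.1 || Literal.eval w C.2.1 || Literal.eval w C.2.2

/-- The first clause of `φ` that is false under an assignment, if there is one. -/
def firstFalsified {v : ℕ} (φ : CNF v) (w : Str) : Option (Clause v) :=
  φ.find? fun C => !Clause.eval w C

theorem satisfies_iff_firstFalsified_eq_none {v : ℕ} {φ : CNF v} {w : Str} :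
    Satisfies (fun i : Fin v => w.getD i false) φ ↔ firstFalsified φ w = none := by
  rw [firstFalsified, List.find?_eq_none]
  refine forall₂_congr fun C _ => ?_
  simp only [Clause.eval, Literal.eval, Bool.not_eq_true', Bool.not_eq_false, Bool.or_eq_true,
    beq_iff_eq, or_assoc]

end ThreeSat

namespace RL

open Machine ThreeSat

/-! ## The decision process of a formula -/

/-- The states of the search for a satisfying assignment: a counter of `B` bits for the flips made
so far, the present assignment (of `V` bits, to match the length of the codes), and the phase.  One
flip takes up to two phases, as it chooses among three variables by means of two actions. -/
@[ext] structure SearchState (B V : ℕ) where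
  phase : Bool
  count : Str
  assign : Str
  length_count : count.length = B
  length_assign : assign.length = V

namespace SearchState

variable {v B V : ℕ} {φ : CNF v} {s t : SearchState B V} {C : Clause v} {a : Bool}

/-- The code of a state. -/
def code (s : SearchState B V) : Str := s.phase :: (s.count ++ s.assign)

theorem code_injective : Function.Injective (code : SearchState B V → Str) := by
  intro s t h
  obtain ⟨hphase, happend⟩ := List.cons.inj h
  obtain ⟨hcount, hassign⟩ := List.append_inj happend (by rw [s.length_count, t.length_count])
  exact SearchState.ext hphase hcount hassign

theorem length_code (s : SearchState B V) : s.code.length = 1 + B + V := by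
  rw [code, List.length_cons, List.length_append, s.length_count, s.length_assign]
  omega

theorem exists_code_eq {x : Str} (hx : x.length = 1 + B + V) :
    ∃ s : SearchState B V, s.code = x := by
  rcases x with _ | ⟨b, x⟩
  · rw [List.length_nil] at hx; omega
  · rw [List.length_cons] at hx
    exact ⟨⟨b, x.take B, x.drop B, by simp; omega, by simp; omega⟩, by simp [code]⟩

/-- The first falsified clause, unless the counter is full. -/
def clause (φ : CNF v) (s : SearchState B V) : Option (Clause v) :=
  if s.count.all id then none else firstFalsified φ s.assign

theorem all_count_of_clause (h : s.clause φ = some C) : s.count.all id = false := by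
  by_contra hall
  rw [clause, if_pos (by simpa using hall)] at h
  cases h

theorem firstFalsified_of_clause (h : s.clause φ = some C) :
    firstFalsified φ s.assign = some C := by
  rwa [clause, if_neg (by simp [all_count_of_clause h])] at h

theorem all_count_of_firstFalsified_ne_none (h : s.clause φ = none)
    (hs : firstFalsified φ s.assign ≠ none) : s.count.all id := by
  by_contra hcount
  rw [clause, if_neg hcount] at h
  exact hs h

/-- Flip the variable `i`. -/
def flip (s : SearchState B V) (h : s.count.all id = false) (i : ℕ) : SearchState B V :=
  ⟨false, increment s.count, s.assign.modify i not, by rw [length_increment h, s.length_count],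
    by rw [List.length_modify, s.length_assign]⟩

/-- Go to the second phase. -/
def toSecondPhase (s : SearchState B V) : SearchState B V := { s with phase := true }

/-- The effect of an action when the clause `C` is falsified: in the first phase, flip the first
variable of `C` or go to the second phase; in the second phase, flip one of the others. -/
def repair (s : SearchState B V) (h : s.count.all id = false) (C : Clause v) (a : Bool) :
    SearchState B V :=
  match s.phase, a with
  | false, true => s.flip h C.1.1
  | false, false => s.toSecondPhase
  | true, false => s.flip h C.2.1.1
  | true, true => s.flip h C.2.2.1

/-- The transition function. -/
def next (φ : CNF v) (s : SearchState B V) (a : Bool) : Option (SearchState B V) :=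
  match h : s.clause φ with
  | none => none
  | some C => some (s.repair (all_count_of_clause h) C a)

theorem next_of_clause_eq_none (h : s.clause φ = none) : s.next φ a = none := by
  unfold next
  split <;> simp_all

theorem next_of_clause_eq_some (h : s.clause φ = some C) :
    s.next φ a = some (s.repair (all_count_of_clause h) C a) := by
  unfold next
  split
  · simp_all
  · next h' => obtain rfl := Option.some.inj (h.symm.trans h'); rfl

theorem next_eq_none_iff : s.next φ a = none ↔ s.clause φ = none := by
  refine ⟨fun h => ?_, next_of_clause_eq_none⟩
  by_contra hC
  obtain ⟨C, hC⟩ := Option.ne_none_iff_exists'.mp hC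
  rw [next_of_clause_eq_some hC] at h
  cases h

/-- An upper bound on the number of steps that are left. -/
def stepsLeft (s : SearchState B V) : ℕ :=
  2 * (2 ^ B - 1 - binaryValue s.count) + (bif s.phase then 0 else 1) + 1

theorem stepsLeft_lt_of_next (h : s.next φ a = some t) : t.stepsLeft < s.stepsLeft := by
  rcases hC : s.clause φ with _ | C
  · rw [next_of_clause_eq_none hC] at h; cases h
  · rw [next_of_clause_eq_some hC, Option.some.injEq] at h
    have hlt := binaryValue_lt (increment s.count)
    rw [length_increment (all_count_of_clause hC), s.length_count, binaryValue_increment] at hlt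
    subst h
    rcases hphase : s.phase <;> cases a <;>
      simp [stepsLeft, repair, hphase, flip, toSecondPhase, binaryValue_increment] <;> omega

theorem stepsLeft_le (s : SearchState B V) : s.stepsLeft ≤ 2 * 2 ^ B := by
  have : 1 ≤ 2 ^ B := Nat.one_le_two_pow
  rw [stepsLeft]
  cases s.phase <;> simp <;> omega

theorem iterate_next_eq_none (φ : CNF v) (π : SearchState B V → Bool) (T : ℕ)
    (o : Option (SearchState B V)) (h : o.elim 0 stepsLeft ≤ T) :
    (fun o : Option (SearchState B V) => o.bind fun s => s.next φ (π s))^[T] o = none := by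
  induction T generalizing o with
  | zero =>
    cases o with
    | none => rfl
    | some s => simp [stepsLeft] at h
  | succ T ih =>
    rw [Function.iterate_succ_apply]
    apply ih
    cases o with
    | none => simp
    | some s =>
      rw [Option.bind_some]
      rcases hn : s.next φ (π s) with _ | t
      · simp
      · have := stepsLeft_lt_of_next hn
        simp only [Option.elim_some] at h ⊢
        omega

/-- The starting state. -/
def start (B V : ℕ) : SearchState B V :=
  ⟨false, List.replicate B false, List.replicate V false, List.length_replicate,
    List.length_replicate⟩

end SearchState

/-- The search for a satisfying assignment of `φ` as a decision process.  A reward is given only at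
the end, and with probability `p`. -/
noncomputable def searchMDP {v : ℕ} (φ : CNF v) (B V : ℕ) (p : SearchState B V → ℝ≥0∞)
    (hp : ∀ s, p s ≤ 1) : MDP where
  State := SearchState B V
  code := SearchState.code
  code_injective := SearchState.code_injective
  start := SearchState.start B V
  next := SearchState.next φ
  reward s _ := if s.clause φ = none then zeroOneReward (p s) (hp s) else PMF.pure 0
  reward_mem s _ q hq := by
    split_ifs at hq
    · rcases eq_zero_or_eq_one_of_mem_support_zeroOneReward hq with rfl | rfl <;> norm_num
    · rw [PMF.mem_support_pure_iff] at hq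
      norm_num [hq]
  horizon := 2 * 2 ^ B
  horizon_spec π s := SearchState.iterate_next_eq_none φ π _ _ s.stepsLeft_le

namespace searchMDP

variable {v B V : ℕ} {φ : CNF v} {p : SearchState B V → ℝ≥0∞} {hp : ∀ s, p s ≤ 1}
  {s : SearchState B V}

theorem reward_of_clause_eq_none (h : s.clause φ = none) (a : Bool) :
    (searchMDP φ B V p hp).reward s a = zeroOneReward (p s) (hp s) := if_pos h

theorem reward_of_clause_ne_none (h : s.clause φ ≠ none) (a : Bool) :
    (searchMDP φ B V p hp).reward s a = PMF.pure 0 := if_neg h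

theorem meanReward_of_clause_eq_none (h : s.clause φ = none) (a : Bool) :
    (searchMDP φ B V p hp).meanReward s a = (p s).toReal := by
  simp only [MDP.meanReward, reward_of_clause_eq_none h, tsum_zeroOneReward]

theorem meanReward_of_clause_ne_none (h : s.clause φ ≠ none) (a : Bool) :
    (searchMDP φ B V p hp).meanReward s a = 0 := by
  simp only [MDP.meanReward, reward_of_clause_ne_none h]
  rw [tsum_eq_single 0 fun q hq => by simp [hq], Rat.cast_zero, mul_zero]

end searchMDP

end RL

namespace RL

open Machine ThreeSat

/-! ## The optimal value function -/

/-- `1` if two bits differ, and `0` otherwise. -/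
def mismatch (a b : Bool) : ℝ := if a = b then 0 else 1

/-- The Hamming distance of the string `w` to `ws` on the first `V` bits. -/
def distance (ws : ℕ → Bool) (V : ℕ) (w : Str) : ℝ :=
  ∑ i ∈ Finset.range V, mismatch (w.getD i false) (ws i)

theorem mismatch_eq_zero_or_eq_one (a b : Bool) : mismatch a b = 0 ∨ mismatch a b = 1 := by
  unfold mismatch; split_ifs <;> simp

theorem mismatch_nonneg (a b : Bool) : 0 ≤ mismatch a b := by
  rcases mismatch_eq_zero_or_eq_one a b with h | h <;> norm_num [h]

theorem mismatch_le_one (a b : Bool) : mismatch a b ≤ 1 := by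
  rcases mismatch_eq_zero_or_eq_one a b with h | h <;> norm_num [h]

section Distance

variable {ws : ℕ → Bool} {V : ℕ} {w : Str}

theorem distance_nonneg : 0 ≤ distance ws V w :=
  Finset.sum_nonneg fun _ _ => mismatch_nonneg _ _

theorem distance_le : distance ws V w ≤ V := by
  refine (Finset.sum_le_sum fun i _ => mismatch_le_one (w.getD i false) (ws i)).trans ?_
  simp

theorem distance_modify_not (hw : w.length = V) {i : ℕ} (hi : i < V) :
    distance ws V (w.modify i not) =
      distance ws V w + 1 - 2 * mismatch (w.getD i false) (ws i) := by
  have hterm (j : ℕ) : mismatch ((w.modify i not).getD j false) (ws j) =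
      mismatch (w.getD j false) (ws j) +
        if i = j then 1 - 2 * mismatch (w.getD i false) (ws i) else 0 := by
    rw [getD_modify_not (hw ▸ hi)]
    split_ifs with h
    · subst h
      cases w.getD i false <;> cases ws i <;> norm_num [mismatch]
    · rw [add_zero]
  simp only [distance, hterm, Finset.sum_add_distrib, Finset.sum_ite_eq,
    if_pos (Finset.mem_range.mpr hi)]
  ring

end Distance

namespace SearchState

variable {v B V r : ℕ} {φ : CNF v} {ws : ℕ → Bool} {s t : SearchState B V} {C : Clause v}

/-- In the second phase, the bit `1` and the two assignments to choose from; in the first phase and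
at the end, the bit `0` and the present assignment twice. -/
def options (φ : CNF v) (s : SearchState B V) : Bool × Str × Str :=
  match s.clause φ, s.phase with
  | some C, true => (true, s.assign.modify C.2.1.1 not, s.assign.modify C.2.2.1 not)
  | _, _ => (false, s.assign, s.assign)

theorem options_of_clause_eq_none (h : s.clause φ = none) :
    s.options φ = (false, s.assign, s.assign) := by
  simp [options, h]

theorem options_of_phase_eq_false (h : s.phase = false) :
    s.options φ = (false, s.assign, s.assign) := by
  simp [options, h]

theorem options_of_phase_eq_true (hC : s.clause φ = some C) (h : s.phase = true) :
    s.options φ =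
      (true, s.assign.modify C.2.1.1 not, s.assign.modify C.2.2.1 not) := by
  simp [options, hC, h]

theorem length_options (s : SearchState B V) :
    (s.options φ).2.1.length = V ∧ (s.options φ).2.2.length = V := by
  unfold options
  split <;> simp [s.length_assign]

/-- The number of flips made so far plus the number of flips to come if every flip reduces the
distance to `ws` whenever possible.  If the two options change the distance by `δ₁, δ₂ = ±1`, then
the better one changes it by `(δ₁ + 1) * (δ₂ + 1) / 2 - 1`; the last summand compensates for the
fictitious choice in the first phase, where `δ₁ = δ₂ = 0`.  Thus the cost is a quadratic polynomial
in the bits of the state and of its options. -/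
noncomputable def cost (φ : CNF v) (ws : ℕ → Bool) (s : SearchState B V) : ℝ :=
  binaryValue s.count + distance ws V s.assign +
    (distance ws V (s.options φ).2.1 - distance ws V s.assign + 1) *
      (distance ws V (s.options φ).2.2 - distance ws V s.assign + 1) / 2 -
    (1 - bif (s.options φ).1 then 1 else 0) / 2

theorem cost_of_options (h : s.options φ = (false, s.assign, s.assign)) :
    s.cost φ ws = binaryValue s.count + distance ws V s.assign := by
  simp [cost, h]

theorem cost_of_phase_eq_true (hvV : v ≤ V) (hC : s.clause φ = some C) (h : s.phase = true) :
    s.cost φ ws = binaryValue s.count + distance ws V s.assign +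
      2 * (1 - mismatch (s.assign.getD C.2.1.1 false) (ws C.2.1.1)) *
        (1 - mismatch (s.assign.getD C.2.2.1 false) (ws C.2.2.1)) := by
  rw [cost, options_of_phase_eq_true hC h]
  dsimp only
  rw [distance_modify_not s.length_assign (C.2.1.1.2.trans_le hvV),
    distance_modify_not s.length_assign (C.2.2.1.2.trans_le hvV), cond_true]
  ring

theorem cost_flip (hvV : v ≤ V) (h : s.count.all id = false) (i : Fin v) :
    (s.flip h i).cost φ ws = binaryValue s.count + distance ws V s.assign + 2 -
      2 * mismatch (s.assign.getD i false) (ws i) := by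
  rw [cost_of_options (options_of_phase_eq_false rfl)]
  simp only [flip]
  rw [binaryValue_increment, distance_modify_not s.length_assign (i.2.trans_le hvV)]
  push_cast
  ring

theorem cost_mem_Icc (hvV : v ≤ V) (s : SearchState B V) :
    s.cost φ ws ∈ Set.Icc (binaryValue s.count + distance ws V s.assign)
      (binaryValue s.count + distance ws V s.assign + 2) := by
  rcases hC : s.clause φ with _ | C
  · norm_num [cost_of_options (options_of_clause_eq_none hC)]
  rcases hphase : s.phase
  · norm_num [cost_of_options (options_of_phase_eq_false hphase)]
  · rw [cost_of_phase_eq_true hvV hC hphase]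
    rcases mismatch_eq_zero_or_eq_one (s.assign.getD C.2.1.1 false) (ws C.2.1.1) with h | h <;>
    rcases mismatch_eq_zero_or_eq_one (s.assign.getD C.2.2.1 false) (ws C.2.2.1) with h' | h' <;>
    rw [h, h'] <;> norm_num

theorem cost_nonneg (hvV : v ≤ V) (s : SearchState B V) : 0 ≤ s.cost φ ws :=
  (add_nonneg (Nat.cast_nonneg _) distance_nonneg).trans (cost_mem_Icc hvV s).1

theorem cost_le (hvV : v ≤ V) (s : SearchState B V) : s.cost φ ws ≤ 2 ^ B + V + 1 := by
  have hcount : (binaryValue s.count : ℝ) + 1 ≤ 2 ^ B := by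
    exact_mod_cast s.length_count ▸ binaryValue_lt s.count
  have hdist : distance ws V s.assign ≤ V := distance_le
  linarith [(cost_mem_Icc (φ := φ) (ws := ws) hvV s).2]

theorem exists_mismatch_of_clause
    (hws : ∀ C ∈ φ, ws C.1.1 = C.1.2 ∨ ws C.2.1.1 = C.2.1.2 ∨ ws C.2.2.1 = C.2.2.2)
    (hC : s.clause φ = some C) :
    mismatch (s.assign.getD C.1.1 false) (ws C.1.1) = 1 ∨
      mismatch (s.assign.getD C.2.1.1 false) (ws C.2.1.1) = 1 ∨
      mismatch (s.assign.getD C.2.2.1 false) (ws C.2.2.1) = 1 := by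
  have hfalse := firstFalsified_of_clause hC
  have heval : Clause.eval s.assign C = false := by simpa using List.find?_some hfalse
  simp only [Clause.eval, Literal.eval, Bool.or_eq_false_iff, beq_eq_false_iff_ne] at heval
  obtain ⟨⟨h₁, h₂⟩, h₃⟩ := heval
  exact (hws C (List.mem_of_find?_eq_some hfalse)).imp (fun h => if_neg (h ▸ h₁))
    (Or.imp (fun h => if_neg (h ▸ h₂)) fun h => if_neg (h ▸ h₃))

/-- At least one of the three flips reduces the distance. -/
theorem cost_eq_min_repair (hvV : v ≤ V)
    (hws : ∀ C ∈ φ, ws C.1.1 = C.1.2 ∨ ws C.2.1.1 = C.2.1.2 ∨ ws C.2.2.1 = C.2.2.2)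
    (hC : s.clause φ = some C) :
    s.cost φ ws = min ((s.repair (all_count_of_clause hC) C false).cost φ ws)
      ((s.repair (all_count_of_clause hC) C true).cost φ ws) := by
  have hmismatch := exists_mismatch_of_clause hws hC
  rcases hphase : s.phase
  · have hsecond : s.toSecondPhase.clause φ = some C := hC
    simp only [repair, hphase, cost_of_options (options_of_phase_eq_false (φ := φ) hphase),
      cost_flip hvV, cost_of_phase_eq_true hvV hsecond rfl]
    simp only [toSecondPhase]
    rcases mismatch_eq_zero_or_eq_one (s.assign.getD C.1.1 false) (ws C.1.1) with h₁ | h₁ <;>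
    rcases mismatch_eq_zero_or_eq_one (s.assign.getD C.2.1.1 false) (ws C.2.1.1) with h₂ | h₂ <;>
    rcases mismatch_eq_zero_or_eq_one (s.assign.getD C.2.2.1 false) (ws C.2.2.1) with h₃ | h₃ <;>
    rw [h₁, h₂, h₃] at hmismatch ⊢ <;> first | (norm_num at hmismatch; done) | norm_num
  · simp only [repair, hphase, cost_of_phase_eq_true hvV hC hphase, cost_flip hvV]
    rcases mismatch_eq_zero_or_eq_one (s.assign.getD C.2.1.1 false) (ws C.2.1.1) with h₂ | h₂ <;>
    rcases mismatch_eq_zero_or_eq_one (s.assign.getD C.2.2.1 false) (ws C.2.2.1) with h₃ | h₃ <;>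
    rw [h₂, h₃] <;> norm_num

/-- The optimal value, if `ws` is a satisfying assignment.  The constants make sure that it is
strictly between `0` and `1`. -/
noncomputable def value (r : ℕ) (φ : CNF v) (ws : ℕ → Bool) (s : SearchState B V) : ℝ :=
  ((2 ^ B + V + 2 - s.cost φ ws) / (2 ^ B + V + 3)) ^ r

theorem value_pos (hvV : v ≤ V) (s : SearchState B V) : 0 < s.value r φ ws := by
  have := cost_le (φ := φ) (ws := ws) hvV s
  exact pow_pos (div_pos (by linarith) (by positivity)) _

theorem value_lt_one (hvV : v ≤ V) (hr : r ≠ 0) (s : SearchState B V) : s.value r φ ws < 1 := by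
  have hle := cost_le (φ := φ) (ws := ws) hvV s
  have hnonneg := cost_nonneg (φ := φ) (ws := ws) hvV s
  refine pow_lt_one₀ (div_nonneg (by linarith) (by positivity)) ?_ hr
  rw [div_lt_one (by positivity)]
  linarith

theorem value_le_value (hvV : v ≤ V) (h : t.cost φ ws ≤ s.cost φ ws) :
    s.value r φ ws ≤ t.value r φ ws := by
  have := cost_le (φ := φ) (ws := ws) hvV s
  rw [value, value]
  gcongr
  exact div_nonneg (by linarith) (by positivity)

theorem value_le_of_all_count (hvV : v ≤ V) (h : s.count.all id) :
    s.value r φ ws ≤ ((V + 3) / 2 ^ B) ^ r := by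
  have hcount : (binaryValue s.count : ℝ) + 1 = 2 ^ B := by
    exact_mod_cast s.length_count ▸ binaryValue_add_one_of_all h
  have hle := cost_le (φ := φ) (ws := ws) hvV s
  have hcost := (cost_mem_Icc (φ := φ) (ws := ws) hvV s).1
  have hdist : 0 ≤ distance ws V s.assign := distance_nonneg
  rw [value]
  refine pow_le_pow_left₀ (div_nonneg (by linarith) (by positivity)) ?_ _
  exact div_le_div₀ (by positivity) (by linarith) (by positivity) (by linarith)

theorem cost_start_le : (start B V).cost φ ws ≤ V := by
  rw [cost_of_options (options_of_phase_eq_false rfl)]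
  simpa only [start, binaryValue_replicate_false, Nat.cast_zero, zero_add] using distance_le

theorem one_sub_le_value_start :
    1 - r * ((V + 1) / 2 ^ B) ≤ (start B V).value r φ ws := by
  have hcost := cost_start_le (B := B) (V := V) (φ := φ) (ws := ws)
  have hle_one : ((V : ℝ) + 1) / (2 ^ B + V + 3) ≤ 1 := by
    rw [div_le_one (by positivity)]
    linarith [show (0 : ℝ) < 2 ^ B by positivity]
  calc 1 - r * ((V + 1) / 2 ^ B : ℝ) ≤ 1 + r * -((V + 1 : ℝ) / (2 ^ B + V + 3)) := by
        rw [mul_neg, ← sub_eq_add_neg]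
        gcongr
        linarith
    _ ≤ (1 + -((V + 1 : ℝ) / (2 ^ B + V + 3))) ^ r := one_add_mul_le_pow (by linarith) r
    _ = ((2 ^ B + 2) / (2 ^ B + V + 3)) ^ r := by
        congr 1
        field_simp
        ring
    _ ≤ (start B V).value r φ ws := by
        rw [value]
        gcongr
        linarith

end SearchState

end RL

namespace Machine

/-! ## Tensor powers of 0-1-vectors -/

/-- The scalar product of the vector `θ` with a bit string, viewed as a 0-1-vector. -/
def dot (θ : ℕ → ℝ) (l : Str) : ℝ :=
  ∑ i ∈ Finset.range l.length, θ i * (l.getD i false).toNat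

section Dot

variable {θ θ' : ℕ → ℝ}

@[simp]
theorem dot_nil : dot θ [] = 0 := rfl

theorem dot_cons (b : Bool) (l : Str) :
    dot θ (b :: l) = θ 0 * b.toNat + dot (fun i => θ (i + 1)) l := by
  rw [dot, List.length_cons, Finset.sum_range_succ', add_comm]
  rfl

theorem dot_congr {l : Str} (h : ∀ i < l.length, θ i = θ' i) : dot θ l = dot θ' l :=
  Finset.sum_congr rfl fun i hi => by rw [h i (Finset.mem_range.mp hi)]

theorem dot_append (l l' : Str) :
    dot θ (l ++ l') = dot θ l + dot (fun i => θ (i + l.length)) l' := by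
  induction l generalizing θ with
  | nil => simp
  | cons b l ih => simp only [List.cons_append, dot_cons, ih, add_assoc, List.length_cons]

theorem dot_replicate_false (n : ℕ) : dot θ (List.replicate n false) = 0 :=
  Finset.sum_eq_zero fun i _ => by simp

theorem dot_const_mul (c : ℝ) (l : Str) : dot (fun i => c * θ i) l = c * dot θ l := by
  simp only [dot, Finset.mul_sum, mul_assoc]

theorem dot_add (l : Str) : dot (fun i => θ i + θ' i) l = dot θ l + dot θ' l := by
  simp only [dot, add_mul, Finset.sum_add_distrib]

theorem dot_zero (l : Str) : dot (fun _ => 0) l = 0 := by simp [dot]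

theorem dot_kron (u w : Str) :
    dot (fun i => θ (i / w.length) * θ' (i % w.length)) (kron u w) = dot θ u * dot θ' w := by
  induction u generalizing θ with
  | nil => simp [kron]
  | cons b u ih =>
    rcases w.length.eq_zero_or_pos with hw | hw
    · rw [List.eq_nil_of_length_eq_zero (l := kron _ _) (by rw [length_kron, hw, mul_zero]),
        List.eq_nil_of_length_eq_zero hw, dot_nil, dot_nil, mul_zero]
    have hkron : kron (b :: u) w =
        (bif b then w else List.replicate w.length false) ++ kron u w := rfl
    have hlength : (bif b then w else List.replicate w.length false).length = w.length := by
      cases b <;> simp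
    rw [hkron, dot_append, hlength, dot_cons, add_mul, ← ih]
    congr 1
    · cases b
      · simp [dot_replicate_false]
      · rw [cond_true, Bool.toNat_true, Nat.cast_one, mul_one, ← dot_const_mul]
        refine dot_congr fun i hi => ?_
        rw [Nat.div_eq_of_lt hi, Nat.mod_eq_of_lt hi]
    · refine dot_congr fun i _ => ?_
      rw [Nat.add_div_right _ hw, Nat.add_mod_right]

theorem binaryValue_eq_dot (l : Str) : (binaryValue l : ℝ) = dot (fun i => 2 ^ i) l := by
  induction l with
  | nil => simp [binaryValue]
  | cons b l ih =>
    rw [binaryValue, dot_cons]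
    simp only [pow_succ', dot_const_mul, ← ih]
    push_cast
    ring

end Dot

/-- The function `f` is linear in the 0-1-vector `u`. -/
def LinearIn {X : Type} (u : X → Str) (f : X → ℝ) : Prop := ∃ θ, ∀ x, f x = dot θ (u x)

/-- The tensor power of a 0-1-vector. -/
def tensorPower (u : Str) : ℕ → Str
  | 0 => [true]
  | m + 1 => kron u (tensorPower u m)

theorem length_tensorPower (u : Str) (m : ℕ) : (tensorPower u m).length = u.length ^ m := by
  induction m with
  | zero => rfl
  | succ m ih => rw [tensorPower, length_kron, ih, pow_succ']

namespace LinearIn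

variable {X : Type} {u w : X → Str} {f g : X → ℝ} {n : ℕ}

theorem zero : LinearIn u fun _ => 0 := ⟨fun _ => 0, fun x => (dot_zero (u x)).symm⟩

theorem add (hf : LinearIn u f) (hg : LinearIn u g) : LinearIn u fun x => f x + g x := by
  obtain ⟨θ, hθ⟩ := hf
  obtain ⟨θ', hθ'⟩ := hg
  exact ⟨fun i => θ i + θ' i, fun x => by rw [dot_add, ← hθ, ← hθ']⟩

theorem const_mul (c : ℝ) (hf : LinearIn u f) : LinearIn u fun x => c * f x := by
  obtain ⟨θ, hθ⟩ := hf
  exact ⟨fun i => c * θ i, fun x => by rw [dot_const_mul, ← hθ]⟩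

theorem cons (c : ℝ) (b : X → Bool) (hf : LinearIn u f) :
    LinearIn (fun x => b x :: u x) fun x => c * (b x).toNat + f x := by
  obtain ⟨θ, hθ⟩ := hf
  exact ⟨fun i => i.casesOn c θ, fun x => by rw [dot_cons, ← hθ]; rfl⟩

theorem append (hu : ∀ x, (u x).length = n) (hf : LinearIn u f) (hg : LinearIn w g) :
    LinearIn (fun x => u x ++ w x) fun x => f x + g x := by
  obtain ⟨θ, hθ⟩ := hf
  obtain ⟨θ', hθ'⟩ := hg
  refine ⟨fun i => if i < n then θ i else θ' (i - n), fun x => ?_⟩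
  simp only [dot_append, hu, hθ, hθ']
  congr 1
  · exact dot_congr fun i hi => (if_pos (hi.trans_eq (hu x))).symm
  · exact dot_congr fun i _ => by simp

theorem mul (hw : ∀ x, (w x).length = n) (hf : LinearIn u f) (hg : LinearIn w g) :
    LinearIn (fun x => kron (u x) (w x)) fun x => f x * g x := by
  obtain ⟨θ, hθ⟩ := hf
  obtain ⟨θ', hθ'⟩ := hg
  refine ⟨fun i => θ (i / n) * θ' (i % n), fun x => ?_⟩
  simp only [hθ, hθ', ← dot_kron, hw]

theorem pow (hu : ∀ x, (u x).length = n) (hf : LinearIn u f) (m : ℕ) :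
    LinearIn (fun x => tensorPower (u x) m) fun x => f x ^ m := by
  induction m with
  | zero => exact ⟨fun _ => 1, fun x => by simp [tensorPower, dot]⟩
  | succ m ih =>
    simp only [pow_succ', tensorPower]
    exact hf.mul (fun x => by rw [length_tensorPower, hu]) ih

end LinearIn

end Machine

namespace RL

open Machine ThreeSat

/-! ## Features -/

theorem distance_eq_add_dot {ws : ℕ → Bool} {V : ℕ} {w : Str} (hw : w.length = V) :
    distance ws V w =
      distance ws V [] + dot (fun i => bif ws i then -1 else 1) w := by
  rw [distance, distance, dot, hw, ← Finset.sum_add_distrib]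
  refine Finset.sum_congr rfl fun i _ => ?_
  rw [List.getD_nil]
  cases w.getD i false <;> cases ws i <;> norm_num [mismatch]

theorem dot_eq_distance_sub {ws : ℕ → Bool} {V : ℕ} {w : Str} (hw : w.length = V) :
    dot (fun i => bif ws i then -1 else 1) w = distance ws V w - distance ws V [] := by
  rw [distance_eq_add_dot hw, add_sub_cancel_left]

namespace SearchState

variable {v B V : ℕ} {φ : CNF v}

/-- The bits in which `cost` is a quadratic polynomial; the leading `1` makes it homogeneous. -/
def bitVector (φ : CNF v) (s : SearchState B V) : Str :=
  true :: (s.options φ).1 :: (s.count ++ (s.assign ++ ((s.options φ).2.1 ++ (s.options φ).2.2)))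

theorem length_bitVector (s : SearchState B V) : (s.bitVector φ).length = 2 + B + 3 * V := by
  have hoptions := s.length_options (φ := φ)
  simp only [bitVector, List.length_cons, List.length_append, s.length_count, s.length_assign,
    hoptions]
  ring

theorem linearIn_bitVector (φ : CNF v) (ws : ℕ → Bool) (c c₀ c₁ a a₁ a₂ : ℝ) :
    LinearIn (bitVector φ : SearchState B V → Str) fun s =>
      c + c₀ * (s.options φ).1.toNat + c₁ * binaryValue s.count + a * distance ws V s.assign +
        a₁ * distance ws V (s.options φ).2.1 + a₂ * distance ws V (s.options φ).2.2 := by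
  have hdistance (a : ℝ) {w : SearchState B V → Str} (hw : ∀ s, (w s).length = V) :
      LinearIn w fun s => a * (distance ws V (w s) - distance ws V []) :=
    .const_mul a ⟨_, fun s => (dot_eq_distance_sub (hw s)).symm⟩
  have hassign : ∀ s : SearchState B V, s.assign.length = V := length_assign
  have hoptions := fun s : SearchState B V => s.length_options (φ := φ)
  have hcount : LinearIn (count : SearchState B V → Str) fun s => c₁ * (binaryValue s.count : ℝ) :=
    .const_mul c₁ ⟨_, fun s => binaryValue_eq_dot s.count⟩
  obtain ⟨θ, hθ⟩ := (((hcount.append length_count ((hdistance a hassign).append hassign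
    ((hdistance a₁ fun s => (hoptions s).1).append (fun s => (hoptions s).1)
      (hdistance a₂ fun s => (hoptions s).2)))).cons c₀ fun s => (s.options φ).1).cons
    (c + (a + a₁ + a₂) * distance ws V []) fun _ => true)
  refine ⟨θ, fun s => ?_⟩
  rw [bitVector, ← hθ, Bool.toNat_true]
  push_cast
  ring

/-- The 0-1-vector of the features of a state. -/
def featureVector (r : ℕ) (φ : CNF v) (s : SearchState B V) : Str :=
  tensorPower (kron (s.bitVector φ) (s.bitVector φ)) r

theorem length_featureVector (r : ℕ) (s : SearchState B V) :
    (s.featureVector r φ).length = (2 + B + 3 * V) ^ (2 * r) := by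
  rw [featureVector, length_tensorPower, length_kron, length_bitVector, ← pow_two, ← pow_mul]

theorem linearIn_value (r : ℕ) (ws : ℕ → Bool) :
    LinearIn (featureVector r φ : SearchState B V → Str) (value r φ ws) := by
  have hlength : ∀ s : SearchState B V, (s.bitVector φ).length = 2 + B + 3 * V := length_bitVector
  have hbase : LinearIn (fun s : SearchState B V => kron (s.bitVector φ) (s.bitVector φ))
      fun s => (2 ^ B + V + 2 - s.cost φ ws) / (2 ^ B + V + 3) := by
    have hlinear := (linearIn_bitVector φ ws (2 ^ B + V + 5 / 2) (-1 / 2) (-1) (-1) 0 0).mul hlength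
      (linearIn_bitVector φ ws 1 0 0 0 0 0)
    have hproduct := (linearIn_bitVector φ ws 1 0 0 (-1) 1 0).mul hlength
      (linearIn_bitVector φ ws 1 0 0 (-1) 0 1)
    obtain ⟨θ, hθ⟩ :=
      (hlinear.add (hproduct.const_mul (-1 / 2))).const_mul ((2 ^ B + V + 3 : ℝ)⁻¹)
    refine ⟨θ, fun s => ?_⟩
    simp only [← hθ, cost]
    rcases (s.options φ).1 <;>
      simp only [cond_true, cond_false, Bool.toNat_true, Bool.toNat_false] <;> push_cast <;> ring
  exact hbase.pow (fun s => by rw [length_kron, hlength]) r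

end SearchState

end RL

namespace RL

open Machine ThreeSat

/-! ## The instances of `Linear-2-RL` -/

theorem encRat_zero : encRat 0 = [false, false, true, true, false] := by
  simp [encRat, encNat]

theorem encRat_one : encRat 1 = [false, true, true, false, true, true, false] := by
  simp [encRat, encNat]

theorem length_encRat_toNat_le (b : Bool) : (encRat b.toNat).length ≤ 7 := by
  cases b
  · rw [Bool.toNat_false, Nat.cast_zero, encRat_zero]; decide
  · rw [Bool.toNat_true, Nat.cast_one, encRat_one]; decide

/-- The first `d` bits of a string as a rational vector. -/
def zeroOneVector (d : ℕ) (l : Str) : Fin d → ℚ := fun i => (l.getD i false).toNat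

theorem encVector_zeroOneVector {d : ℕ} {l : Str} (h : l.length = d) :
    MDP.encVector (zeroOneVector d l) = l.flatMap fun b => encRat b.toNat := by
  subst h
  rw [MDP.encVector, List.flatMap_def]
  congr 1
  exact List.ext_getElem (by simp) fun i _ _ => by simp [zeroOneVector]

theorem dot_eq_sum_zeroOneVector {d : ℕ} {l : Str} (h : l.length = d) (θ : ℕ → ℝ) :
    dot θ l = ∑ i : Fin d, θ i * (zeroOneVector d l i : ℝ) := by
  subst h
  simp only [dot, zeroOneVector, Rat.cast_natCast]
  exact (Fin.sum_univ_eq_sum_range (fun i => θ i * ((l.getD i false).toNat : ℝ)) _).symm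

namespace MDP

variable {M : MDP} {d : ℕ} {ψ : M.Features d}

/-- The answers of the oracle if there were no rewards. -/
noncomputable def zeroRewardAnswer (ψ : M.Features d) : Str → Str
  | false :: false :: _ :: x => (M.decode x).elim [] fun _ => encRat 0
  | false :: true :: a :: x => (M.decode x).elim [] fun s => M.encNext (M.next s a)
  | true :: false :: x => (M.decode x).elim [] fun s => encVector (ψ.onState s)
  | true :: true :: a :: x => (M.decode x).elim [] fun s => encVector (ψ.onPair s a)
  | _ => []

theorem decode_code (s : M.State) : M.decode (M.code s) = some s := by
  have h : ∃ t, M.code t = M.code s := ⟨s, rfl⟩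
  rw [decode, dif_pos h]
  exact congrArg some (M.code_injective h.choose_spec)

theorem code_of_decode_eq_some {x : Str} {s : M.State} (h : M.decode x = some s) :
    M.code s = x := by
  unfold decode at h
  split_ifs at h with hx
  obtain rfl := Option.some.inj h
  exact hx.choose_spec

theorem oracle_eq_reward_or_eq_pure (q : Str) :
    (∃ s a, q.drop 3 = M.code s ∧ M.oracle ψ q = (M.reward s a).map encRat ∧
      zeroRewardAnswer ψ q = encRat 0) ∨
    M.oracle ψ q = PMF.pure (zeroRewardAnswer ψ q) := by
  unfold zeroRewardAnswer
  split
  · next a x =>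
    rcases hx : M.decode x with _ | s
    · exact .inr (by simp [oracle, hx])
    · exact .inl ⟨s, a, (code_of_decode_eq_some hx).symm, by simp [oracle, hx], rfl⟩
  · next a x => exact .inr (by rcases hx : M.decode x <;> simp [oracle, hx])
  · next x => exact .inr (by rcases hx : M.decode x <;> simp [oracle, hx])
  · next a x => exact .inr (by rcases hx : M.decode x <;> simp [oracle, hx])
  · exact .inr (by unfold oracle; split <;> simp_all)

theorem length_zeroRewardAnswer_le {m : ℕ} (hm : 5 ≤ m)
    (hcode : ∀ s, (M.code s).length + 1 ≤ m) (hstate : ∀ s, (encVector (ψ.onState s)).length ≤ m)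
    (hpair : ∀ s a, (encVector (ψ.onPair s a)).length ≤ m) (q : Str) :
    (zeroRewardAnswer ψ q).length ≤ m := by
  have helim (x : Str) {f : M.State → Str} (hf : ∀ s, (f s).length ≤ m) :
      ((M.decode x).elim [] f).length ≤ m := by
    rcases M.decode x with _ | s
    · exact Nat.zero_le _
    · exact hf s
  unfold zeroRewardAnswer
  split
  · exact helim _ fun _ => by rw [encRat_zero]; exact hm
  · next a _ =>
    refine helim _ fun s => ?_
    rcases M.next s a with _ | t
    · exact le_trans (by simp [encNext]) hm
    · exact hcode t
  · exact helim _ hstate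
  · exact helim _ fun s => hpair s _
  · exact Nat.zero_le _

end MDP

namespace searchMDP

variable {v B V : ℕ} {φ : CNF v} {p : SearchState B V → ℝ≥0∞} {hp : ∀ s, p s ≤ 1}

theorem meanReward_add_next (s : SearchState B V) (a : Bool) :
    (searchMDP φ B V p hp).meanReward s a +
      ((searchMDP φ B V p hp).next s a).elim 0 (fun t => (p t).toReal) =
        (p ((s.next φ a).getD s)).toReal := by
  change _ + (s.next φ a).elim 0 (fun t => (p t).toReal) = _
  rcases hC : s.clause φ with _ | C
  · rw [meanReward_of_clause_eq_none hC, SearchState.next_of_clause_eq_none hC]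
    exact add_zero _
  · rw [meanReward_of_clause_ne_none (by simp [hC]), SearchState.next_of_clause_eq_some hC]
    exact zero_add _

theorem isBellmanSolution
    (h : ∀ (s : SearchState B V) (C : Clause v) (hC : s.clause φ = some C), (p s).toReal =
      max (p (s.repair (SearchState.all_count_of_clause hC) C false)).toReal
        (p (s.repair (SearchState.all_count_of_clause hC) C true)).toReal) :
    (searchMDP φ B V p hp).IsBellmanSolution fun s : SearchState B V => (p s).toReal where
  nonneg _ := ENNReal.toReal_nonneg
  meanReward_add_le s a := by
    refine (meanReward_add_next s a).trans_le ?_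
    rcases hC : SearchState.clause φ s with _ | C
    · rw [SearchState.next_of_clause_eq_none hC]; rfl
    · rw [SearchState.next_of_clause_eq_some hC, h s C hC]
      cases a
      · exact le_max_left _ _
      · exact le_max_right _ _
  exists_eq s := by
    suffices ∃ a, (p ((SearchState.next φ s a).getD s)).toReal = (p s).toReal from
      this.imp fun a ha => (meanReward_add_next s a).trans ha
    rcases hC : SearchState.clause φ s with _ | C
    · exact ⟨true, by rw [SearchState.next_of_clause_eq_none hC]; rfl⟩
    · simp only [SearchState.next_of_clause_eq_some hC, h s C hC]
      rcases max_choice (p (s.repair (SearchState.all_count_of_clause hC) C false)).toReal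
        (p (s.repair (SearchState.all_count_of_clause hC) C true)).toReal with hmax | hmax
      · exact ⟨false, hmax.symm⟩
      · exact ⟨true, hmax.symm⟩

end searchMDP

/-- Some satisfying assignment, if there is one. -/
noncomputable def satisfyingAssignment {v : ℕ} (φ : CNF v) (i : ℕ) : Bool :=
  open Classical in if h : Satisfiable φ then (if hi : i < v then h.choose ⟨i, hi⟩ else false)
  else false

theorem satisfies_satisfyingAssignment {v : ℕ} {φ : CNF v} (h : Satisfiable φ) :
    Satisfies (fun i => satisfyingAssignment φ i) φ := by
  simpa [satisfyingAssignment, h] using h.choose_spec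

open Classical in
/-- The probability of the reward in a final state.  In the other states, it is the value. -/
noncomputable def rewardProb {v B V : ℕ} (φ : CNF v) (r : ℕ) (s : SearchState B V) : ℝ≥0∞ :=
  min 1 (if Satisfiable φ then ENNReal.ofReal (s.value r φ (satisfyingAssignment φ)) else 0)

section RewardProb

variable {v B V r : ℕ} {φ : CNF v}

theorem rewardProb_le_one (s : SearchState B V) : rewardProb φ r s ≤ 1 := min_le_left _ _

theorem toReal_rewardProb (h : Satisfiable φ) (hvV : v ≤ V) (hr : r ≠ 0) (s : SearchState B V) :
    (rewardProb φ r s).toReal = s.value r φ (satisfyingAssignment φ) := by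
  rw [rewardProb, if_pos h, min_eq_right, ENNReal.toReal_ofReal (s.value_pos hvV).le]
  simpa using (s.value_lt_one hvV hr).le

theorem rewardProb_of_not_satisfiable (h : ¬ Satisfiable φ) (s : SearchState B V) :
    rewardProb φ r s = 0 := by simp [rewardProb, h]

theorem rewardProb_lt_one (hvV : v ≤ V) (hr : r ≠ 0) (s : SearchState B V) :
    rewardProb φ r s < 1 := by
  refine min_lt_iff.mpr (Or.inr ?_)
  split_ifs
  · simpa using s.value_lt_one hvV hr
  · exact one_pos

theorem rewardProb_le_of_all_count (hvV : v ≤ V) {s : SearchState B V} (h : s.count.all id) :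
    rewardProb φ r s ≤ ENNReal.ofReal (((V + 3) / 2 ^ B) ^ r) := by
  refine (min_le_right _ _).trans ?_
  split_ifs
  · exact ENNReal.ofReal_le_ofReal (SearchState.value_le_of_all_count hvV h)
  · exact zero_le

theorem toReal_rewardProb_eq_max_repair (hvV : v ≤ V) (hr : r ≠ 0) {s : SearchState B V}
    {C : Clause v} (hC : s.clause φ = some C) : (rewardProb φ r s).toReal =
      max (rewardProb φ r (s.repair (SearchState.all_count_of_clause hC) C false)).toReal
        (rewardProb φ r (s.repair (SearchState.all_count_of_clause hC) C true)).toReal := by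
  by_cases hφ : Satisfiable φ
  · have hcost := SearchState.cost_eq_min_repair hvV (satisfies_satisfyingAssignment hφ) hC
    simp only [toReal_rewardProb hφ hvV hr]
    refine le_antisymm ?_ (max_le ?_ ?_)
    · rcases min_choice ((s.repair (SearchState.all_count_of_clause hC) C false).cost φ
          (satisfyingAssignment φ))
        ((s.repair (SearchState.all_count_of_clause hC) C true).cost φ
          (satisfyingAssignment φ)) with hmin | hmin
      · exact (SearchState.value_le_value hvV (by rw [hcost, hmin])).trans (le_max_left _ _)
      · exact (SearchState.value_le_value hvV (by rw [hcost, hmin])).trans (le_max_right _ _)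
    · exact SearchState.value_le_value hvV (hcost.trans_le (min_le_left _ _))
    · exact SearchState.value_le_value hvV (hcost.trans_le (min_le_right _ _))
  · simp [rewardProb_of_not_satisfiable hφ]

theorem linearIn_rewardProb (hvV : v ≤ V) (hr : r ≠ 0) :
    LinearIn (SearchState.featureVector r φ : SearchState B V → Str)
      fun s => (rewardProb φ r s).toReal := by
  by_cases hφ : Satisfiable φ
  · simpa only [toReal_rewardProb hφ hvV hr] using
      SearchState.linearIn_value r (satisfyingAssignment φ)
  · simpa only [rewardProb_of_not_satisfiable hφ, ENNReal.toReal_zero] using LinearIn.zero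

end RewardProb

/-- The decision process of a formula. -/
noncomputable def formulaMDP {v : ℕ} (φ : CNF v) (B V r : ℕ) : MDP :=
  searchMDP φ B V (rewardProb φ r) rewardProb_le_one

/-- The features of the decision process of a formula.  The features of a pair are those of the
next state, as all rewards outside final states are zero. -/
noncomputable def formulaFeatures {v : ℕ} (φ : CNF v) (B V r : ℕ) :
    (formulaMDP φ B V r).Features ((2 + B + 3 * V) ^ (2 * r)) where
  onState (s : SearchState B V) := zeroOneVector _ (s.featureVector r φ)
  onPair (s : SearchState B V) a := zeroOneVector _ (((s.next φ a).getD s).featureVector r φ)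

namespace formulaMDP

variable {v B V r : ℕ} {φ : CNF v}

theorem isBellmanSolution (hvV : v ≤ V) (hr : r ≠ 0) :
    (formulaMDP φ B V r).IsBellmanSolution fun s : SearchState B V => (rewardProb φ r s).toReal :=
  searchMDP.isBellmanSolution fun _ _ hC => toReal_rewardProb_eq_max_repair hvV hr hC

theorem linear_formulaFeatures (hvV : v ≤ V) (hr : r ≠ 0) : (formulaFeatures φ B V r).Linear := by
  obtain ⟨θ, hθ⟩ := linearIn_rewardProb (φ := φ) (B := B) hvV hr
  have hsum (s : SearchState B V) : (rewardProb φ r s).toReal = ∑ i : Fin _, θ i *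
      (zeroOneVector ((2 + B + 3 * V) ^ (2 * r)) (s.featureVector r φ) i : ℝ) :=
    (hθ s).trans (dot_eq_sum_zeroOneVector (SearchState.length_featureVector r s) θ)
  have hG := isBellmanSolution (φ := φ) (B := B) hvV hr
  exact ⟨fun i => θ i, fun s => (hG.VStar_eq s).trans (hsum s),
    fun s a => ((hG.QStar_eq s a).trans (searchMDP.meanReward_add_next s a)).trans (hsum _)⟩

theorem reward_of_clause_eq_none {s : SearchState B V} (h : s.clause φ = none) (a : Bool) :
    (formulaMDP φ B V r).reward s a = zeroOneReward (rewardProb φ r s) (rewardProb_le_one s) :=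
  searchMDP.reward_of_clause_eq_none h a

theorem reward_of_clause_ne_none {s : SearchState B V} (h : s.clause φ ≠ none) (a : Bool) :
    (formulaMDP φ B V r).reward s a = PMF.pure 0 :=
  searchMDP.reward_of_clause_ne_none h a

theorem eq_zero_or_eq_one_of_mem_support_reward {s : SearchState B V} {a : Bool} {x : ℚ}
    (hx : x ∈ ((formulaMDP φ B V r).reward s a).support) : x = 0 ∨ x = 1 := by
  by_cases hC : s.clause φ = none
  · rw [reward_of_clause_eq_none hC] at hx
    exact eq_zero_or_eq_one_of_mem_support_zeroOneReward hx
  · rw [reward_of_clause_ne_none hC, PMF.mem_support_pure_iff] at hx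
    exact .inl hx

theorem reward_zero_ne_zero (hvV : v ≤ V) (hr : r ≠ 0) (s : SearchState B V) (a : Bool) :
    (formulaMDP φ B V r).reward s a 0 ≠ 0 := by
  by_cases hC : s.clause φ = none
  · rw [reward_of_clause_eq_none hC, zeroOneReward_zero]
    exact (tsub_pos_of_lt (rewardProb_lt_one hvV hr s)).ne'
  · rw [reward_of_clause_ne_none hC]; simp

theorem one_le_reward_zero_add (hvV : v ≤ V) {s : SearchState B V}
    (hs : firstFalsified φ s.assign ≠ none) (a : Bool) :
    1 ≤ (formulaMDP φ B V r).reward s a 0 + ENNReal.ofReal (((V + 3) / 2 ^ B) ^ r) := by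
  by_cases hC : s.clause φ = none
  · have hcount : s.count.all id := by
      by_contra hcount
      rw [SearchState.clause, if_neg hcount] at hC
      exact hs hC
    rw [reward_of_clause_eq_none hC, zeroOneReward_zero]
    exact tsub_le_iff_right.mp (tsub_le_tsub_left (rewardProb_le_of_all_count hvV hcount) 1)
  · rw [reward_of_clause_ne_none hC]; simp

theorem zeroRewardAnswer_mem_support_oracle (hvV : v ≤ V) (hr : r ≠ 0) (q : Str) :
    MDP.zeroRewardAnswer (formulaFeatures φ B V r) q ∈
      ((formulaMDP φ B V r).oracle (formulaFeatures φ B V r) q).support := by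
  rcases MDP.oracle_eq_reward_or_eq_pure (ψ := formulaFeatures φ B V r) q with
    ⟨s, a, -, horacle, hanswer⟩ | horacle
  · rw [horacle, hanswer, PMF.support_map]
    exact ⟨0, reward_zero_ne_zero hvV hr s a, rfl⟩
  · rw [horacle]; simp

theorem one_le_oracle_zeroRewardAnswer_add (hvV : v ≤ V) (q : Str) :
    (∃ s : SearchState B V, q.drop 3 = s.code ∧ firstFalsified φ s.assign = none) ∨
      1 ≤ (formulaMDP φ B V r).oracle (formulaFeatures φ B V r) q
        (MDP.zeroRewardAnswer (formulaFeatures φ B V r) q) +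
          ENNReal.ofReal (((V + 3) / 2 ^ B) ^ r) := by
  rcases MDP.oracle_eq_reward_or_eq_pure (ψ := formulaFeatures φ B V r) q with
    ⟨s, a, hq, horacle, hanswer⟩ | horacle
  · refine or_iff_not_imp_left.mpr fun hnot => ?_
    refine (one_le_reward_zero_add (r := r) hvV (fun hs => hnot ⟨s, hq, hs⟩) a).trans ?_
    rw [horacle, hanswer, PMF.map_apply]
    gcongr
    exact le_trans (by rw [if_pos rfl]) (ENNReal.le_tsum (0 : ℚ))
  · right; rw [horacle]; simp

theorem length_zeroRewardAnswer_le (hr : r ≠ 0) (q : Str) :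
    (MDP.zeroRewardAnswer (formulaFeatures φ B V r) q).length ≤ 7 * (2 + B + 3 * V) ^ (2 * r) := by
  have hle : 2 + B + 3 * V ≤ (2 + B + 3 * V) ^ (2 * r) := Nat.le_self_pow (by omega) _
  have hvector (s : SearchState B V) :
      (MDP.encVector (zeroOneVector ((2 + B + 3 * V) ^ (2 * r)) (s.featureVector r φ))).length ≤
        7 * (2 + B + 3 * V) ^ (2 * r) := by
    have hlength := s.length_featureVector (φ := φ) r
    rw [encVector_zeroOneVector hlength, ← hlength, mul_comm]
    exact length_flatMap_le _ length_encRat_toNat_le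
  refine MDP.length_zeroRewardAnswer_le (by omega) (fun s => ?_) hvector
    (fun s a => hvector _) q
  have hcode : ((formulaMDP φ B V r).code s).length = 1 + B + V := SearchState.length_code s
  omega

theorem isInstance (hvV : v ≤ V) (hr : r ≠ 0) (hB : 2 ^ B ≤ (2 + B + 3 * V) ^ (2 * r)) :
    (formulaMDP φ B V r).IsInstance 8 ((2 + B + 3 * V) ^ (2 * r)) (formulaFeatures φ B V r) := by
  have hle : 2 + B + 3 * V ≤ (2 + B + 3 * V) ^ (2 * r) := Nat.le_self_pow (by omega) _
  have hpow : (2 + B + 3 * V) ^ (2 * r) ≤ ((2 + B + 3 * V) ^ (2 * r)) ^ 8 :=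
    Nat.le_self_pow (by norm_num) _
  refine ⟨linear_formulaFeatures hvV hr, ?_, fun s => ?_, fun q y hy => ?_⟩
  · change 2 * 2 ^ B ≤ _
    omega
  · have hcode : ((formulaMDP φ B V r).code s).length = 1 + B + V := SearchState.length_code s
    omega
  rcases MDP.oracle_eq_reward_or_eq_pure (ψ := formulaFeatures φ B V r) q with
    ⟨s, a, -, horacle, -⟩ | horacle
  · rw [horacle, PMF.support_map] at hy
    obtain ⟨x, hx, rfl⟩ := hy
    have hseven : (encRat x).length ≤ 7 := by
      rcases eq_zero_or_eq_one_of_mem_support_reward hx with rfl | rfl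
      · simpa using length_encRat_toNat_le false
      · simpa using length_encRat_toNat_le true
    omega
  · rw [horacle, PMF.mem_support_pure_iff] at hy
    have hanswer := length_zeroRewardAnswer_le (φ := φ) (B := B) (V := V) hr q
    rw [← hy] at hanswer
    omega

theorem V_le_value_lastState (hφ : Satisfiable φ) (hvV : v ≤ V) (hr : r ≠ 0)
    {π : (formulaMDP φ B V r).Policy} {as : List Bool}
    (hπ : (formulaMDP φ B V r).Executes π (some (SearchState.start B V)) as) :
    (formulaMDP φ B V r).V π (SearchState.start B V) ≤
      SearchState.value r φ (satisfyingAssignment φ)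
        ((formulaMDP φ B V r).lastState (SearchState.start B V) as : SearchState B V) :=
  (MDP.totalReward_le_of_executes (G := fun s : SearchState B V => (rewardProb φ r s).toReal)
    (fun _ _ _ h => SearchState.next_of_clause_eq_none (SearchState.next_eq_none_iff.mp h))
    (fun _ a h => searchMDP.meanReward_of_clause_ne_none
      (fun hC => h (SearchState.next_of_clause_eq_none hC)) a)
    (fun _ a h => (searchMDP.meanReward_of_clause_eq_none
      (SearchState.next_eq_none_iff.mp h) a).le)
    (fun _ => ENNReal.toReal_nonneg) hπ _).trans_eq (toReal_rewardProb hφ hvV hr _)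

theorem firstFalsified_of_isGood (hφ : Satisfiable φ) (hvV : v ≤ V) (hr : r ≠ 0)
    (hstart : (r : ℝ) * ((V + 1) / 2 ^ B) ≤ 1 / 4) (hfull : (((V : ℝ) + 3) / 2 ^ B) ^ r ≤ 1 / 4)
    {as : List Bool} (h : (formulaMDP φ B V r).IsGood as) :
    firstFalsified φ (SearchState.assign
      ((formulaMDP φ B V r).lastState (SearchState.start B V) as : SearchState B V)) = none := by
  obtain ⟨π, hπ, hV⟩ := h
  have hle := V_le_value_lastState hφ hvV hr hπ
  have hVStar := ((isBellmanSolution (φ := φ) hvV hr).VStar_eq (SearchState.start B V)).trans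
    (toReal_rewardProb hφ hvV hr _)
  have hlast := SearchState.next_eq_none_iff.mp (MDP.next_lastState_of_executes
    (fun _ _ _ h => SearchState.next_of_clause_eq_none (SearchState.next_eq_none_iff.mp h)) hπ true)
  by_contra hne
  have hcount := SearchState.all_count_of_firstFalsified_ne_none hlast hne
  have hvalue := hle.trans (SearchState.value_le_of_all_count hvV hcount)
  have hvalue_start := SearchState.one_sub_le_value_start (B := B) (V := V) (r := r) (φ := φ)
    (ws := satisfyingAssignment φ)
  replace hV : (formulaMDP φ B V r).VStar (SearchState.start B V) - 1 / 4 <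
    (formulaMDP φ B V r).V π (SearchState.start B V) := hV
  linarith

end formulaMDP

end RL

namespace Machine

open ThreeSat

/-! ## Searching for a falsified clause in polynomial time -/

/-- Codes of the clauses of a formula. -/
def encClauses {v : ℕ} (φ : CNF v) : Str := (φ.flatMap fun C => true :: encClause C) ++ [false]

/-- A code of a sequence of literals, without the first literal. -/
def dropLiteral (c : Str) : Str := (c.tail.dropWhile id).tail

/-- The variable of the first literal of a sequence, in unary. -/
def firstVariable (c : Str) : Str := c.tail.takeWhile id

/-- Whether the first literal of a sequence is false under the assignment `w`. -/
def firstLiteralFalse (w c : Str) : Bool :=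
  !((w.drop (firstVariable c).length).headD false == c.headD false)

/-- Whether the first three literals of a sequence are false under the assignment `w`. -/
def firstClauseFalse (w c : Str) : Bool :=
  firstLiteralFalse w c && (firstLiteralFalse w (dropLiteral c) &&
    firstLiteralFalse w (dropLiteral (dropLiteral c)))

/-- Skip the first clause in a code of a sequence of clauses, if it is true. -/
def skipTrueClause (w c : Str) : Str :=
  bif c.headD false && !firstClauseFalse w c.tail then
    dropLiteral (dropLiteral (dropLiteral c.tail)) else c

/-- Codes of the clauses of a formula, from the first falsified clause on. -/
def encFalsified {v : ℕ} (φ : CNF v) (w : Str) : Str := encClauses (φ.dropWhile (Clause.eval w))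

theorem dropWhile_encUnary_append (n : ℕ) (c : Str) :
    (encUnary n ++ c).dropWhile id = false :: c := by
  rw [encUnary, List.append_assoc, List.dropWhile_append_of_pos (by simp)]
  rfl

theorem takeWhile_encUnary_append (n : ℕ) (c : Str) :
    (encUnary n ++ c).takeWhile id = List.replicate n true := by
  rw [encUnary, List.append_assoc, List.takeWhile_append_of_pos (by simp)]
  simp

theorem headD_drop (w : Str) (i : ℕ) : (w.drop i).headD false = w.getD i false := by
  rw [List.headD_eq_head?_getD, List.head?_drop, List.getD_eq_getElem?_getD]

theorem length_dropLiteral_le (c : Str) : (dropLiteral c).length ≤ c.length := by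
  rw [dropLiteral]
  exact ((List.tail_sublist _).trans
    ((List.dropWhile_sublist _).trans (List.tail_sublist _))).length_le

theorem length_skipTrueClause_le (w c : Str) : (skipTrueClause w c).length ≤ c.length := by
  rw [skipTrueClause]
  cases c.headD false && !firstClauseFalse w c.tail
  · exact le_rfl
  · exact (length_dropLiteral_le _).trans ((length_dropLiteral_le _).trans
      ((length_dropLiteral_le _).trans (List.tail_sublist c).length_le))

section Codes

variable {v : ℕ} (w c : Str)

theorem dropLiteral_append (l : Literal v) : dropLiteral (encLiteral l ++ c) = c := by
  rw [dropLiteral, encLiteral, List.cons_append, List.tail_cons, dropWhile_encUnary_append,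
    List.tail_cons]

theorem firstVariable_append (l : Literal v) :
    firstVariable (encLiteral l ++ c) = List.replicate l.1 true := by
  rw [firstVariable, encLiteral, List.cons_append, List.tail_cons, takeWhile_encUnary_append]

theorem firstLiteralFalse_append (l : Literal v) :
    firstLiteralFalse w (encLiteral l ++ c) = !Literal.eval w l := by
  rw [firstLiteralFalse, firstVariable_append, Literal.eval, headD_drop, List.length_replicate]
  rfl

theorem encClause_append (C : Clause v) : encClause C ++ c =
    encLiteral C.1 ++ (encLiteral C.2.1 ++ (encLiteral C.2.2 ++ c)) := by
  simp [encClause]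

theorem firstClauseFalse_append (C : Clause v) :
    firstClauseFalse w (encClause C ++ c) = !Clause.eval w C := by
  simp only [firstClauseFalse, encClause_append, dropLiteral_append, firstLiteralFalse_append,
    Clause.eval, Bool.not_or, Bool.and_assoc]

theorem encClauses_cons (C : Clause v) (φ : CNF v) :
    encClauses (C :: φ) = true :: (encClause C ++ encClauses φ) := by
  simp [encClauses]

theorem encCNF_eq (φ : CNF v) : encCNF φ = encUnary v ++ encClauses φ := by
  rw [encCNF, encClauses, List.append_assoc]

theorem skipTrueClause_cons (C : Clause v) (φ : CNF v) :
    skipTrueClause w (encClauses (C :: φ)) =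
      bif Clause.eval w C then encClauses φ else encClauses (C :: φ) := by
  rw [encClauses_cons, skipTrueClause, List.tail_cons, firstClauseFalse_append, encClause_append,
    dropLiteral_append, dropLiteral_append, dropLiteral_append]
  simp

theorem iterate_skipTrueClause {φ : CNF v} {m : ℕ} (hm : φ.length ≤ m) :
    (skipTrueClause w)^[m] (encClauses φ) = encFalsified φ w := by
  rw [encFalsified]
  induction φ generalizing m with
  | nil => exact Function.iterate_fixed rfl m
  | cons C φ ih =>
    have hskip := skipTrueClause_cons w C φ
    rcases h : Clause.eval w C
    · rw [h, cond_false] at hskip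
      rw [Function.iterate_fixed hskip, List.dropWhile_cons_of_neg (by simp [h])]
    · rw [h, cond_true] at hskip
      obtain ⟨m, rfl⟩ := Nat.exists_eq_add_of_le' (Nat.one_le_of_lt hm)
      rw [Function.iterate_succ_apply, hskip, List.dropWhile_cons_of_pos h]
      exact ih (Nat.succ_le_succ_iff.mp hm)

theorem length_le_length_encClauses (φ : CNF v) : φ.length ≤ (encClauses φ).length := by
  induction φ with
  | nil => exact Nat.zero_le _
  | cons C φ ih =>
    rw [encClauses_cons, List.length_cons, List.length_cons, List.length_append]
    omega

theorem firstFalsified_eq_head?_dropWhile (φ : CNF v) :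
    firstFalsified φ w = (φ.dropWhile (Clause.eval w)).head? := by
  rw [firstFalsified, List.find?_not_eq_head?_dropWhile]

theorem headD_encFalsified (φ : CNF v) :
    (encFalsified φ w).headD false = (firstFalsified φ w).isSome := by
  rw [encFalsified, firstFalsified_eq_head?_dropWhile]
  rcases φ.dropWhile (Clause.eval w) with _ | ⟨C, ψ⟩
  · rfl
  · rw [encClauses_cons]; rfl

theorem exists_tail_encFalsified {φ : CNF v} {C : Clause v} {w : Str}
    (h : firstFalsified φ w = some C) : ∃ c, (encFalsified φ w).tail = encClause C ++ c := by
  rw [firstFalsified_eq_head?_dropWhile] at h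
  obtain ⟨ψ, hψ⟩ := List.head?_eq_some_iff.mp h
  exact ⟨encClauses ψ, by rw [encFalsified, hψ, encClauses_cons, List.tail_cons]⟩

end Codes

namespace PolyComputable

variable {X : Type*} {V : List (X → Str)} {S : X → ℕ} {f g : X → Str}

theorem dropLiteral (hf : PolyComputable V S f) : PolyComputable V S fun x => dropLiteral (f x) :=
  tail (dropWhile (tail hf))

theorem firstVariable (hf : PolyComputable V S f) :
    PolyComputable V S fun x => firstVariable (f x) := takeWhile (tail hf)

theorem firstLiteralFalse (hf : PolyComputable V S f) (hg : PolyComputable V S g) :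
    PolyComputable V S fun x => [firstLiteralFalse (f x) (g x)] :=
  not (beq (headD (drop (firstVariable hg) hf)) (headD hg))

theorem firstClauseFalse (hf : PolyComputable V S f) (hg : PolyComputable V S g) :
    PolyComputable V S fun x => [firstClauseFalse (f x) (g x)] :=
  and (firstLiteralFalse hf hg) (and (firstLiteralFalse hf (dropLiteral hg))
    (firstLiteralFalse hf (dropLiteral (dropLiteral hg))))

theorem skipTrueClause (hf : PolyComputable V S f) (hg : PolyComputable V S g) :
    PolyComputable V S fun x => skipTrueClause (f x) (g x) :=
  cond (and (headD hg) (not (firstClauseFalse hf (tail hg))))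
    (dropLiteral (dropLiteral (dropLiteral (tail hg)))) hg

theorem iterate_skipTrueClause (hf : PolyComputable V S f) (hg : PolyComputable V S g) :
    PolyComputable V S fun x => (Machine.skipTrueClause (f x))^[(g x).length] (g x) := by
  have hstep : PolyComputable (extend [Prod.fst, Prod.snd])
      (fun y : (Str × Str) × Str => y.1.1.length + y.1.2.length + y.2.length)
      fun y => Machine.skipTrueClause y.1.1 y.2 :=
    skipTrueClause (.var 1 rfl (.of_le fun _ => by omega)) accumulator
  refine comp₂ (G := fun w c => (Machine.skipTrueClause w)^[c.length] c)
    (iterate (X := Str × Str) (l := Prod.snd) (init := Prod.snd) snd snd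
      (h := fun y => Machine.skipTrueClause y.1) hstep .self fun y m _ => ?_) hf hg
  have hlength : ((Machine.skipTrueClause y.1)^[m] y.2).length ≤ y.2.length := by
    induction m with
    | zero => exact le_rfl
    | succ m ih =>
      rw [Function.iterate_succ_apply']
      exact (length_skipTrueClause_le _ _).trans (ih (by omega))
  omega

theorem encFalsified {v : X → ℕ} {φ : ∀ x, CNF (v x)}
    (hφ : PolyComputable V S fun x => encCNF (φ x))
    (hf : PolyComputable V S f) : PolyComputable V S fun x => encFalsified (φ x) (f x) :=
  (iterate_skipTrueClause hf (tail (dropWhile hφ))).congr fun x => by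
    rw [encCNF_eq, dropWhile_encUnary_append, List.tail_cons,
      Machine.iterate_skipTrueClause _ (length_le_length_encClauses _)]

/-! ## Computing with binary counters, tensor powers and roots -/

theorem increment (hf : PolyComputable V S f) : PolyComputable V S fun x => increment (f x) :=
  append (replicate false (takeWhile hf)) (cons true (tail (dropWhile hf)))

theorem all_id (hf : PolyComputable V S f) : PolyComputable V S fun x => [(f x).all _root_.id] :=
  (isEmpty (dropWhile hf)).congr fun x => by
    rw [List.singleton_inj, Bool.eq_iff_iff, List.isEmpty_iff, List.dropWhile_eq_nil_iff,
      List.all_eq_true]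

theorem modify_not {u : X → Str} (hf : PolyComputable V S f) (hu : PolyComputable V S u) :
    PolyComputable V S fun x => (f x).modify (u x).length Bool.not :=
  (cond (isEmpty (drop hu hf)) hf
    (append (take hu hf) (cons_bit (not (headD (drop hu hf))) (tail (drop hu hf))))).congr
    fun x => by
      rcases lt_or_ge (u x).length (f x).length with h | h
      · rw [List.modify_eq_take_cons_drop h, List.drop_eq_getElem_cons h]
        rfl
      · rw [List.modify_eq_self h, List.drop_of_length_le h]
        rfl

theorem bits {u : X → Str} (hu : PolyComputable V S u) :
    PolyComputable V S fun x => (u x).length.bits := by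
  have hiterate (m : ℕ) : Machine.increment^[m] [] = m.bits := by
    induction m with
    | zero => rfl
    | succ m ih => rw [Function.iterate_succ_apply', ih, increment_bits]
  have hlength (m : ℕ) : m.bits.length ≤ m := by
    rw [Nat.size_eq_bits_len]
    exact Nat.size_le.mpr Nat.lt_two_pow_self
  exact comp₁ (G := fun u => u.length.bits) ((iterate id (const [])
    (h := fun _ => Machine.increment) (increment accumulator) .self fun x m hm => by
      rw [hiterate]; exact (hlength m).trans hm).congr fun x => hiterate _) hu

theorem tensorPower {u : X → Str} (hf : PolyComputable V S f) (hu : PolyComputable V S u)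
    (hlength : PolyBounded S fun x => (f x).length ^ (u x).length) :
    PolyComputable V S fun x => tensorPower (f x) (u x).length := by
  have hiterate (w : Str) (m : ℕ) : (Machine.kron w)^[m] [true] = Machine.tensorPower w m := by
    induction m with
    | zero => rfl
    | succ m ih => rw [Function.iterate_succ_apply', ih]; rfl
  let S' (y : Str × Str) := y.1.length + y.2.length + y.1.length ^ y.2.length
  have hG : PolyComputable [Prod.fst, Prod.snd] S' fun y => Machine.tensorPower y.1 y.2.length := by
    have hfst : PolyComputable (extend [Prod.fst, Prod.snd]) (fun y => S' y.1 + y.2.length)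
        fun y => y.1.1 := .var 1 rfl (.of_le fun _ => by simp only [S']; omega)
    refine (iterate (.var 1 rfl (.of_le fun _ => by simp only [S']; omega)) (const [true])
      (h := fun y => Machine.kron y.1) (kron hfst accumulator) (B := fun y => 1 + S' y)
      ((PolyBounded.const 1).add .self) fun y m hm => ?_).congr fun y => hiterate _ _
    rw [hiterate, length_tensorPower]
    rcases Nat.eq_zero_or_pos y.1.length with h | h
    · rw [h]
      exact (zero_pow_le_one m).trans (Nat.le_add_right _ _)
    · have hpow := Nat.pow_le_pow_right h hm
      simp only [S']
      omega
  exact hG.comp (fun x => (f x, u x)) (by simpa using ⟨hf, hu⟩)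
    ((hf.length_bounded.add hu.length_bounded).add hlength)

theorem replicate_nthRoot_three {u : X → Str} (hu : PolyComputable V S u) :
    PolyComputable V S fun x => List.replicate (Nat.nthRoot 3 (u x).length) true := by
  let step (n : ℕ) (c : Str) : Str := if (c.length + 1) ^ 3 ≤ n then true :: c else c
  have hiterate (n m : ℕ) : (step n)^[m] [] = List.replicate (min m (Nat.nthRoot 3 n)) true := by
    induction m with
    | zero => rfl
    | succ m ih =>
      rw [Function.iterate_succ_apply', ih]
      simp only [step, List.length_replicate, ← Nat.le_nthRoot_iff three_ne_zero]
      split_ifs with h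
      · rw [← List.replicate_succ]; congr 1; omega
      · congr 1; omega
  have hstep : PolyComputable (extend [_root_.id]) (fun y : Str × Str => y.1.length + y.2.length)
      fun y => step y.1.length y.2 := by
    have hsucc := cons true (accumulator (W := [fun y : Str × Str => y.1])
      (S' := fun y => y.1.length + y.2.length))
    refine (ite (decide_length_le (replicate_mul hsucc (replicate_mul hsucc hsucc))
      (.var 1 rfl (.of_le fun _ => Nat.le_add_right _ _))) hsucc accumulator).congr fun y => ?_
    simp only [step, List.length_replicate, List.length_cons, pow_succ', pow_zero, mul_one]
  refine comp₁ (G := fun u => List.replicate (Nat.nthRoot 3 u.length) true)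
    ((iterate id (const []) (h := fun x => step x.length) hstep .self fun x m hm => ?_).congr
      fun x => ?_) hu
  · rw [hiterate, List.length_replicate]
    exact (min_le_left _ _).trans hm
  · rw [hiterate, min_eq_right]
    exact (Nat.le_self_pow three_ne_zero _).trans (Nat.pow_nthRoot_le_iff.mpr (.inl three_ne_zero))

end PolyComputable

end Machine

namespace RL

open Machine ThreeSat

/-! ## Computing the simulated oracle -/

/-- The code of the variable of the clause coded by `c` which `SearchState.repair` flips. -/
def chosenVariable (phase a : Bool) (c : Str) : Str :=
  firstVariable (bif phase then bif a then dropLiteral (dropLiteral c) else dropLiteral c else c)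

namespace SearchState

variable {v B V : ℕ} {φ : CNF v} {s : SearchState B V} {a : Bool}

/-- Read a state from a string, which is padded by zeros. -/
def ofStr (B V : ℕ) (x : Str) : SearchState B V :=
  let y := x.tail ++ List.replicate (B + V) false
  ⟨x.headD false, y.take B, (y.drop B).take V, by simp [y]; omega, by simp [y]; omega⟩

theorem ofStr_code (s : SearchState B V) : ofStr B V s.code = s := by
  ext1
  · rfl
  · simp [ofStr, code, ← s.length_count]
  · simp [ofStr, code, ← s.length_count, ← s.length_assign]

theorem ofStr_nil : ofStr B V [] = start B V := by
  ext1 <;> simp [ofStr, start]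

theorem isNone_next : (s.next φ a).isNone =
    (s.count.all id || !(encFalsified φ s.assign).headD false) := by
  rw [headD_encFalsified]
  rcases hC : s.clause φ with _ | C
  · rw [next_of_clause_eq_none hC]
    by_cases h : firstFalsified φ s.assign = none
    · simp [h]
    · simp [all_count_of_firstFalsified_ne_none hC h]
  · simp [next_of_clause_eq_some hC, all_count_of_clause hC, firstFalsified_of_clause hC]

theorem phase_getD_next : ((s.next φ a).getD s).phase =
    bif (s.next φ a).isNone then s.phase else !s.phase && !a := by
  rcases hC : s.clause φ with _ | C
  · simp [next_of_clause_eq_none hC]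
  · rcases hphase : s.phase <;> cases a <;>
      simp [next_of_clause_eq_some hC, repair, hphase, flip, toSecondPhase]

theorem count_getD_next : ((s.next φ a).getD s).count =
    bif (s.next φ a).isNone || (!s.phase && !a) then s.count else increment s.count := by
  rcases hC : s.clause φ with _ | C
  · simp [next_of_clause_eq_none hC]
  · rcases hphase : s.phase <;> cases a <;>
      simp [next_of_clause_eq_some hC, repair, hphase, flip, toSecondPhase]

theorem assign_getD_next : ((s.next φ a).getD s).assign =
    bif (s.next φ a).isNone || (!s.phase && !a) then s.assign else
      s.assign.modify (chosenVariable s.phase a (encFalsified φ s.assign).tail).length not := by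
  rcases hC : s.clause φ with _ | C
  · simp [next_of_clause_eq_none hC]
  · obtain ⟨c, hc⟩ := exists_tail_encFalsified (firstFalsified_of_clause hC)
    rw [hc, encClause_append]
    rcases hphase : s.phase <;> cases a <;>
      simp [next_of_clause_eq_some hC, repair, hphase, flip, toSecondPhase, chosenVariable,
        dropLiteral_append, firstVariable_append]

theorem options_eq_next : s.options φ =
    bif s.phase && !(s.next φ false).isNone then
      (true, ((s.next φ false).getD s).assign, ((s.next φ true).getD s).assign)
    else (false, s.assign, s.assign) := by
  rcases hC : s.clause φ with _ | C
  · simp [next_of_clause_eq_none hC, options_of_clause_eq_none hC]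
  · rcases hphase : s.phase
    · simp [options_of_phase_eq_false hphase]
    · simp [options_of_phase_eq_true hC hphase, next_of_clause_eq_some hC, repair, hphase, flip]

end SearchState

/-- The code of the state in a query. -/
def queriedCode (q : Str) : Str :=
  bif q.headD false && !q.tail.headD false then q.tail.tail else q.tail.tail.tail

namespace formulaMDP

variable {v B V r : ℕ} {φ : CNF v}

theorem decode_eq (x : Str) : (formulaMDP φ B V r).decode x =
    if x.length = 1 + B + V then some (SearchState.ofStr B V x) else none := by
  split_ifs with h
  · obtain ⟨s, rfl⟩ := SearchState.exists_code_eq h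
    rw [SearchState.ofStr_code]
    exact MDP.decode_code (M := formulaMDP φ B V r) s
  · refine Option.eq_none_iff_forall_ne_some.mpr fun s hs => h ?_
    rw [← MDP.code_of_decode_eq_some hs]
    exact SearchState.length_code s

theorem elim_decode (x : Str) (f : SearchState B V → Str) :
    ((formulaMDP φ B V r).decode x).elim [] f =
      if x.length = 1 + B + V then f (.ofStr B V x) else [] := by
  rw [decode_eq]
  split_ifs <;> rfl

theorem encVector_featureVector (s : SearchState B V) :
    MDP.encVector (zeroOneVector ((2 + B + 3 * V) ^ (2 * r)) (s.featureVector r φ)) =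
      (s.featureVector r φ).flatMap fun b => encRat b.toNat :=
  encVector_zeroOneVector (s.length_featureVector r)

theorem encNext_next (s : SearchState B V) (a : Bool) :
    (formulaMDP φ B V r).encNext ((formulaMDP φ B V r).next s a) =
      bif (s.next φ a).isNone then [false] else true :: ((s.next φ a).getD s).code := by
  change (formulaMDP φ B V r).encNext (s.next φ a) = _
  cases s.next φ a <;> rfl

theorem zeroRewardAnswer_eq (q : Str) :
    MDP.zeroRewardAnswer (formulaFeatures φ B V r) q =
      let x := queriedCode q
      let s := SearchState.ofStr B V x
      let t := (s.next φ (q.tail.tail.headD false)).getD s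
      if x.length = 1 + B + V then
        bif q.headD false then
          (SearchState.featureVector r φ (bif q.tail.headD false then t else s)).flatMap
            fun b => encRat b.toNat
        else bif q.tail.headD false then
          bif (s.next φ (q.tail.tail.headD false)).isNone then [false] else true :: t.code
        else encRat 0
      else [] := by
  have hempty : ¬ 0 = 1 + B + V := by omega
  rcases q with _ | ⟨_ | _, _ | ⟨_ | _, q⟩⟩
  · exact (if_neg hempty).symm
  · exact (if_neg hempty).symm
  · rcases q with _ | ⟨_, x⟩
    · exact (if_neg hempty).symm
    · exact elim_decode x _
  · rcases q with _ | ⟨a, x⟩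
    · exact (if_neg hempty).symm
    · refine (elim_decode x _).trans (if_congr Iff.rfl ?_ rfl)
      exact encNext_next _ a
  · exact (if_neg hempty).symm
  · refine (elim_decode q _).trans (if_congr Iff.rfl ?_ rfl)
    exact encVector_featureVector _
  · rcases q with _ | ⟨_, x⟩
    · exact (if_neg hempty).symm
    · refine (elim_decode x _).trans (if_congr Iff.rfl ?_ rfl)
      exact encVector_featureVector _

end formulaMDP

/-- The data of the decision processes of the formulas `φ x` are computable in polynomial time, and
their dimensions are polynomially bounded. -/
structure ComputableParameters {X : Type*} (Vs : List (X → Str)) (S : X → ℕ) {v : X → ℕ}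
    (φ : ∀ x, CNF (v x)) (B V r : X → ℕ) : Prop where
  formula : PolyComputable Vs S fun x => encCNF (φ x)
  countBits : PolyComputable Vs S fun x => List.replicate (B x) true
  assignBits : PolyComputable Vs S fun x => List.replicate (V x) true
  power : PolyComputable Vs S fun x => List.replicate (r x) true
  dimension_bounded : PolyBounded S fun x => (2 + B x + 3 * V x) ^ (2 * r x)

/-- The components of the states `s x` are computable in polynomial time. -/
structure ComputableState {X : Type*} (Vs : List (X → Str)) (S : X → ℕ) {B V : X → ℕ}
    (s : ∀ x, SearchState (B x) (V x)) : Prop where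
  phase : PolyComputable Vs S fun x => [(s x).phase]
  count : PolyComputable Vs S fun x => (s x).count
  assign : PolyComputable Vs S fun x => (s x).assign

section Computable

variable {X : Type*} {Vs : List (X → Str)} {S v B V r : X → ℕ} {φ : ∀ x, CNF (v x)}

namespace ComputableParameters

theorem lift (hVs : ∀ g ∈ Vs, PolyBounded S fun x => (g x).length)
    (h : ComputableParameters Vs S φ B V r) :
    ComputableParameters (extend Vs) (fun y : X × Str => S y.1 + y.2.length) (fun y => φ y.1)
      (fun y => B y.1) (fun y => V y.1) (fun y => r y.1) where
  formula := h.formula.lift hVs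
  countBits := h.countBits.lift hVs
  assignBits := h.assignBits.lift hVs
  power := h.power.lift hVs
  dimension_bounded := h.dimension_bounded.comp Prod.fst (.of_le fun _ => Nat.le_add_right _ _)

theorem ofStr (h : ComputableParameters Vs S φ B V r) {q : X → Str}
    (hq : PolyComputable Vs S q) :
    ComputableState Vs S fun x => SearchState.ofStr (B x) (V x) (q x) := by
  have hpad : PolyComputable Vs S fun x => (q x).tail ++ List.replicate (B x + V x) false :=
    (hq.tail.append (.replicate false (h.countBits.append h.assignBits))).congr fun x => by simp
  exact ⟨hq.headD, (PolyComputable.take h.countBits hpad).congr fun x => by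
      rw [List.length_replicate]; rfl,
    (PolyComputable.take h.assignBits (.drop h.countBits hpad)).congr fun x => by
      rw [List.length_replicate, List.length_replicate]; rfl⟩

end ComputableParameters

namespace ComputableState

variable {s t : ∀ x, SearchState (B x) (V x)} {a c : X → Bool}

theorem congr (hs : ComputableState Vs S s) (hst : ∀ x, s x = t x) : ComputableState Vs S t :=
  (funext hst : s = t) ▸ hs

theorem code (hs : ComputableState Vs S s) : PolyComputable Vs S fun x => (s x).code :=
  hs.phase.cons_bit (hs.count.append hs.assign)

theorem cond (hc : PolyComputable Vs S fun x => [c x]) (hs : ComputableState Vs S s)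
    (ht : ComputableState Vs S t) : ComputableState Vs S fun x => bif c x then s x else t x where
  phase := (PolyComputable.cond hc hs.phase ht.phase).congr fun x => by cases c x <;> rfl
  count := (PolyComputable.cond hc hs.count ht.count).congr fun x => by cases c x <;> rfl
  assign := (PolyComputable.cond hc hs.assign ht.assign).congr fun x => by cases c x <;> rfl

theorem isNone_firstFalsified (hs : ComputableState Vs S s)
    (hφ : PolyComputable Vs S fun x => encCNF (φ x)) :
    PolyComputable Vs S fun x => [(firstFalsified (φ x) (s x).assign).isNone] :=
  (PolyComputable.not (PolyComputable.encFalsified hφ hs.assign).headD).congr fun x => by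
    rw [headD_encFalsified, Option.not_isSome]

theorem isNone_next (hs : ComputableState Vs S s)
    (hφ : PolyComputable Vs S fun x => encCNF (φ x)) (a : X → Bool) :
    PolyComputable Vs S fun x => [((s x).next (φ x) (a x)).isNone] :=
  (PolyComputable.or hs.count.all_id
    (PolyComputable.not (PolyComputable.encFalsified hφ hs.assign).headD)).congr
    fun x => by rw [SearchState.isNone_next]

theorem next (hs : ComputableState Vs S s) (hφ : PolyComputable Vs S fun x => encCNF (φ x))
    (ha : PolyComputable Vs S fun x => [a x]) :
    ComputableState Vs S fun x => ((s x).next (φ x) (a x)).getD (s x) := by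
  have hfinal := hs.isNone_next hφ a
  have hpass := PolyComputable.and (.not hs.phase) (.not ha)
  have hclause := (PolyComputable.encFalsified hφ hs.assign).tail
  have hvariable : PolyComputable Vs S fun x =>
      chosenVariable (s x).phase (a x) (encFalsified (φ x) (s x).assign).tail :=
    .firstVariable (.cond hs.phase (.cond ha hclause.dropLiteral.dropLiteral hclause.dropLiteral)
      hclause)
  exact ⟨(PolyComputable.cond hfinal hs.phase hpass).congr fun x => by
      rw [SearchState.phase_getD_next, Bool.apply_cond (fun b => [b])],
    (PolyComputable.cond (.or hfinal hpass) hs.count hs.count.increment).congr fun x =>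
      SearchState.count_getD_next.symm,
    (PolyComputable.cond (.or hfinal hpass) hs.assign (.modify_not hs.assign hvariable)).congr
      fun x => SearchState.assign_getD_next.symm⟩

theorem bitVector (hs : ComputableState Vs S s)
    (hφ : PolyComputable Vs S fun x => encCNF (φ x)) :
    PolyComputable Vs S fun x => (s x).bitVector (φ x) := by
  have hsecond := PolyComputable.and hs.phase (.not (hs.isNone_next hφ fun _ => false))
  have hoption (a : Bool) := PolyComputable.cond hsecond
    (hs.next hφ (a := fun _ => a) (.const [a])).assign hs.assign
  refine (PolyComputable.cons true (hsecond.cons_bit (hs.count.append (hs.assign.append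
    ((hoption false).append (hoption true)))))).congr fun x => ?_
  rw [SearchState.bitVector, SearchState.options_eq_next]
  cases (s x).phase && !((s x).next (φ x) false).isNone <;> rfl

theorem featureVector (hs : ComputableState Vs S s) (h : ComputableParameters Vs S φ B V r) :
    PolyComputable Vs S fun x => (s x).featureVector (r x) (φ x) := by
  have hbits := hs.bitVector h.formula
  refine (PolyComputable.tensorPower (hbits.kron hbits) h.power
    (h.dimension_bounded.mono fun x => ?_)).congr fun x => ?_
  · rw [length_kron, SearchState.length_bitVector, List.length_replicate, ← pow_two, ← pow_mul]
  · rw [List.length_replicate]; rfl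

end ComputableState

namespace ComputableParameters

theorem zeroRewardAnswer (h : ComputableParameters Vs S φ B V r) {q : X → Str}
    (hq : PolyComputable Vs S q) :
    PolyComputable Vs S fun x =>
      MDP.zeroRewardAnswer (formulaFeatures (φ x) (B x) (V x) (r x)) (q x) := by
  have hfst := hq.headD
  have hsnd := hq.tail.headD
  have hx : PolyComputable Vs S fun x => queriedCode (q x) :=
    .cond (.and hfst (.not hsnd)) hq.tail.tail hq.tail.tail.tail
  have hs := h.ofStr hx
  have ht := hs.next h.formula hq.tail.tail.headD
  have hlength := PolyComputable.decide_length_eq hx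
    (PolyComputable.cons true (h.countBits.append h.assignBits))
  have hfeatures := PolyComputable.flatMap ((ComputableState.cond hsnd ht hs).featureVector h)
    fun b => PolyComputable.const (encRat b.toNat)
  have hnext := PolyComputable.cond (hs.isNone_next h.formula fun x => (q x).tail.tail.headD false)
    (.const [false]) (.cons true ht.code)
  refine (PolyComputable.ite hlength (.cond hfst hfeatures (.cond hsnd hnext (.const (encRat 0))))
    (.const [])).congr fun x => ?_
  rw [formulaMDP.zeroRewardAnswer_eq]
  simp only [List.length_replicate, List.length_cons, List.length_append]
  rw [show B x + V x + 1 = 1 + B x + V x by ring]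

theorem lastState (h : ComputableParameters Vs S φ B V r)
    (hVs : ∀ g ∈ Vs, PolyBounded S fun x => (g x).length) {as : X → Str}
    (has : PolyComputable Vs S as) :
    ComputableState Vs S fun x => ((formulaMDP (φ x) (B x) (V x) (r x)).lastState
      (SearchState.start (B x) (V x)) (as x) : SearchState (B x) (V x)) := by
  let step (a : Bool) (x : X) (w : Str) : Str :=
    let s := SearchState.ofStr (B x) (V x) w
    ((s.next (φ x) a).getD s).code
  let last (x : X) (u : Str) : SearchState (B x) (V x) :=
    (formulaMDP (φ x) (B x) (V x) (r x)).lastState (SearchState.start (B x) (V x)) u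
  have hfoldl (x : X) (u : Str) :
      u.foldl (fun w a => step a x w) (SearchState.start (B x) (V x)).code = (last x u).code :=
    List.foldl_hom SearchState.code fun s a => by simp only [step, SearchState.ofStr_code]; rfl
  have hstart : PolyComputable Vs S fun x => (SearchState.start (B x) (V x)).code :=
    (h.ofStr (.const [])).code.congr fun x => by rw [SearchState.ofStr_nil]
  have hlift := h.lift hVs
  have hstep (a : Bool) := ((hlift.ofStr .accumulator).next hlift.formula (a := fun _ => a)
    (.const [a])).code
  have hcode := PolyComputable.foldl (h := step) has hstart hstep
    (((PolyBounded.const 1).add h.countBits.length_bounded).add h.assignBits.length_bounded)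
    fun x u _ _ => by
      rw [hfoldl, SearchState.length_code, List.length_replicate, List.length_replicate]
  exact (h.ofStr hcode).congr (t := fun x => last x (as x)) fun x => by
    rw [hfoldl, SearchState.ofStr_code]

end ComputableParameters

end Computable

end RL

namespace RL

open Machine Filter

/-! ## The choice of the parameters -/

/-- The exponent of the rewards of the decision process for `V` variables, about `V ^ (1 / 3)`. -/
def rewardExponent (V : ℕ) : ℕ := Nat.nthRoot 3 V + 1

/-- The number of digits of the counter of the decision process for `V` variables. -/
def counterLength (V : ℕ) : ℕ := V.size * rewardExponent V

/-- The feature dimension of the decision process for `V` variables. -/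
def dimension (V : ℕ) : ℕ := (2 + counterLength V + 3 * V) ^ (2 * rewardExponent V)

/-- The parameters of the decision process for `V` variables are such that an optimal policy finds
a satisfying assignment, but `t` queries are unlikely to meet a nonzero reward. -/
structure HidesRewards (t V : ℕ) : Prop where
  start_le : (rewardExponent V : ℝ) * ((V + 1) / 2 ^ counterLength V) ≤ 1 / 4
  full_le : (((V : ℝ) + 3) / 2 ^ counterLength V) ^ rewardExponent V ≤ 1 / 4
  queries_le : t * (((V : ℝ) + 3) / 2 ^ counterLength V) ^ rewardExponent V ≤ 1 / 40

section Parameters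

variable {V : ℕ}

theorem two_pow_size_le (hV : V ≠ 0) : 2 ^ V.size ≤ 2 * V := by
  obtain ⟨m, hm⟩ := Nat.exists_eq_succ_of_ne_zero (Nat.size_eq_zero.not.mpr hV)
  have hpow : 2 ^ m ≤ V := Nat.lt_size.mp (by omega)
  rw [hm, pow_succ]
  omega

theorem logb_le_size (V : ℕ) : Real.logb 2 V ≤ V.size := by
  rcases eq_or_ne V 0 with rfl | hV
  · simp
  · rw [Real.logb_le_iff_le_rpow one_lt_two (by positivity), Real.rpow_natCast]
    exact_mod_cast (Nat.lt_size_self V).le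

theorem size_sub_one_le_logb (hV : V ≠ 0) : (V.size : ℝ) - 1 ≤ Real.logb 2 V := by
  rw [Real.le_logb_iff_rpow_le one_lt_two (by positivity), Real.rpow_sub two_pos, Real.rpow_one,
    Real.rpow_natCast, div_le_iff₀ two_pos, mul_comm]
  exact_mod_cast two_pow_size_le hV

theorem lt_rewardExponent_pow (V : ℕ) : V < rewardExponent V ^ 3 :=
  Nat.lt_pow_nthRoot_add_one three_ne_zero V

theorem rewardExponent_pow_le (hV : V ≠ 0) : rewardExponent V ^ 3 ≤ 8 * V := by
  have hroot : 1 ≤ Nat.nthRoot 3 V :=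
    (Nat.le_nthRoot_iff three_ne_zero).mpr (by rw [one_pow]; omega)
  calc rewardExponent V ^ 3 ≤ (2 * Nat.nthRoot 3 V) ^ 3 := by
        refine Nat.pow_le_pow_left ?_ 3
        rw [rewardExponent]
        omega
    _ = 8 * Nat.nthRoot 3 V ^ 3 := by ring
    _ ≤ 8 * V := by gcongr; exact Nat.pow_nthRoot_le_iff.mpr (.inl three_ne_zero)

theorem tendsto_size : Tendsto Nat.size atTop atTop :=
  tendsto_atTop.mpr fun m => by
    filter_upwards [eventually_ge_atTop (2 ^ m)] with V hV
    exact (Nat.lt_size.mpr hV).le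

theorem tendsto_rewardExponent : Tendsto rewardExponent atTop atTop :=
  tendsto_atTop.mpr fun m => by
    filter_upwards [eventually_ge_atTop (m ^ 3)] with V hV
    exact (lt_of_pow_lt_pow_left₀ 3 (Nat.zero_le _) (hV.trans_lt (lt_rewardExponent_pow V))).le

theorem eventually_mul_size_pow_le (C m : ℕ) : ∀ᶠ V in atTop, C * Nat.size V ^ m ≤ V := by
  have hlittle := (isLittleO_pow_const_const_pow_of_one_lt (R := ℝ) m one_lt_two).bound
    (c := 1 / (2 * C + 1)) (by positivity)
  filter_upwards [tendsto_size.eventually hlittle, eventually_ne_atTop 0] with V hsize hV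
  rw [Real.norm_of_nonneg (by positivity), Real.norm_of_nonneg (by positivity),
    one_div_mul_eq_div, le_div_iff₀' (by positivity)] at hsize
  have hpow : (2 * C + 1) * V.size ^ m ≤ 2 * V :=
    (by exact_mod_cast hsize : (2 * C + 1) * V.size ^ m ≤ 2 ^ V.size).trans (two_pow_size_le hV)
  linarith [Nat.zero_le (V.size ^ m)]

theorem eventually_mul_rewardExponent_sq_le (C : ℕ) :
    ∀ᶠ V in atTop, C * (rewardExponent V ^ 2 * Nat.size V ^ 3) ≤ V := by
  filter_upwards [eventually_mul_size_pow_le (64 * C ^ 3) 9, eventually_ne_atTop 0]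
    with V hsize hV
  refine le_of_pow_le_pow_left₀ three_ne_zero (Nat.zero_le _) ?_
  calc (C * (rewardExponent V ^ 2 * V.size ^ 3)) ^ 3
      = C ^ 3 * (rewardExponent V ^ 3) ^ 2 * V.size ^ 9 := by ring
    _ ≤ C ^ 3 * (8 * V) ^ 2 * V.size ^ 9 := by gcongr; exact rewardExponent_pow_le hV
    _ = (64 * C ^ 3 * V.size ^ 9) * V ^ 2 := by ring
    _ ≤ V * V ^ 2 := by gcongr
    _ = V ^ 3 := by ring

theorem eventually_counterLength_add_two_le : ∀ᶠ V in atTop, counterLength V + 2 ≤ V := by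
  filter_upwards [eventually_mul_rewardExponent_sq_le 3, eventually_ne_atTop 0] with V hV hne
  have hsize : 1 ≤ V.size := Nat.size_pos.mpr (by omega)
  have hpos : 1 ≤ counterLength V := Nat.mul_pos hsize (Nat.succ_pos _)
  have hle : counterLength V ≤ rewardExponent V ^ 2 * V.size ^ 3 := by
    rw [counterLength, mul_comm]
    exact Nat.mul_le_mul (Nat.le_self_pow two_ne_zero _) (Nat.le_self_pow three_ne_zero _)
  omega

theorem two_pow_counterLength_le (V : ℕ) : 2 ^ counterLength V ≤ dimension V := by
  have hsize : 2 ^ V.size ≤ 2 * V + 1 := by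
    rcases eq_or_ne V 0 with rfl | hV
    · rw [Nat.size_zero, pow_zero]; omega
    · exact (two_pow_size_le hV).trans (Nat.le_succ _)
  rw [counterLength, dimension, pow_mul, pow_mul]
  refine Nat.pow_le_pow_left (hsize.trans ?_) _
  exact le_trans (by omega) (Nat.le_self_pow two_ne_zero _)

theorem pow_le_dimension (V : ℕ) : V ^ (2 * rewardExponent V) ≤ dimension V :=
  Nat.pow_le_pow_left (by omega) _

theorem dimension_le (h : counterLength V + 2 ≤ V) :
    dimension V ≤ 2 ^ (2 * rewardExponent V * (V.size + 2)) := by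
  rw [dimension, mul_comm _ (V.size + 2), pow_mul 2]
  refine Nat.pow_le_pow_left ?_ _
  have := Nat.lt_size_self V
  rw [pow_add]
  omega

/-! ## The running time of the given algorithm -/

theorem logb_dimension_le (h : counterLength V + 2 ≤ V) :
    Real.logb 2 (dimension V) ≤ 2 * rewardExponent V * (V.size + 2) := by
  have hpos : 0 < dimension V := Nat.pow_pos (by omega)
  rw [Real.logb_le_iff_le_rpow one_lt_two (by positivity)]
  exact_mod_cast dimension_le h

theorem rewardExponent_le_logb_dimension (hV : 2 ≤ V) :
    (rewardExponent V : ℝ) ≤ Real.logb 2 (dimension V) := by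
  have hpos : 0 < dimension V := Nat.pow_pos (by omega)
  rw [Real.le_logb_iff_rpow_le one_lt_two (by positivity), Real.rpow_natCast]
  have hle : 2 ^ rewardExponent V ≤ dimension V :=
    (Nat.pow_le_pow_left hV _).trans
      ((Nat.pow_le_pow_right (by omega) (by omega)).trans (pow_le_dimension V))
  exact_mod_cast hle

theorem le_logb_logb_dimension (hV : 2 ≤ V) :
    ((V.size : ℝ) - 1) / 3 ≤ Real.logb 2 (Real.logb 2 (dimension V)) := by
  have hpos : (0 : ℝ) < rewardExponent V := Nat.cast_pos.mpr (Nat.succ_pos _)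
  have hroot : Real.logb 2 V ≤ 3 * Real.logb 2 (rewardExponent V) := by
    have hpow : (V : ℝ) ≤ rewardExponent V ^ 3 := by
      exact_mod_cast (lt_rewardExponent_pow V).le
    exact (Real.logb_le_logb_of_le one_lt_two (by positivity) hpow).trans_eq (Real.logb_pow ..)
  have hlogb := Real.logb_le_logb_of_le one_lt_two hpos (rewardExponent_le_logb_dimension hV)
  linarith [size_sub_one_le_logb (V := V) (by omega)]

theorem dimension_rpow_le (hV : 2 ≤ V) (hsize : 7 ≤ V.size) (h : counterLength V + 2 ≤ V) :
    (dimension V : ℝ) ^ (Real.logb 2 (dimension V) /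
        (72 * Real.logb 2 (Real.logb 2 (dimension V)))) ≤
      2 ^ ((rewardExponent V ^ 2 * V.size : ℝ) / 3) := by
  have hpos : (0 : ℝ) < dimension V := Nat.cast_pos.mpr (Nat.pow_pos (by omega))
  have hlogb := rewardExponent_le_logb_dimension hV
  have hle := logb_dimension_le h
  have hlogblogb := le_logb_logb_dimension hV
  set ℓ := Real.logb 2 (dimension V)
  set r := (rewardExponent V : ℝ)
  set k := (V.size : ℝ)
  have hr : 0 ≤ r := Nat.cast_nonneg _
  have hk : 7 ≤ k := Nat.ofNat_le_cast.mpr hsize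
  rw [← Real.rpow_logb two_pos one_lt_two.ne' hpos, ← Real.rpow_mul two_pos.le]
  refine Real.rpow_le_rpow_of_exponent_le one_le_two ?_
  rw [← mul_div_assoc, div_le_iff₀ (by linarith)]
  calc ℓ * ℓ ≤ (2 * r * (k + 2)) * (2 * r * (k + 2)) := by
        have : 0 ≤ ℓ := hr.trans hlogb
        gcongr
    _ = 4 * r ^ 2 * (k + 2) ^ 2 := by ring
    _ ≤ 4 * r ^ 2 * (2 * k * (k - 1)) := by gcongr; nlinarith
    _ = r ^ 2 * k / 3 * (72 * ((k - 1) / 3)) := by ring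
    _ ≤ r ^ 2 * k / 3 * (72 * Real.logb 2 ℓ) := by gcongr

theorem eventually_time_dimension_le {T : ℕ → ℕ} (hT : (fun d => (T d : ℝ)) =O[atTop]
      fun d : ℕ => (d : ℝ) ^ (Real.logb 2 d / (72 * Real.logb 2 (Real.logb 2 d)))) :
    ∃ K : ℕ, ∀ᶠ V in atTop,
      (T (dimension V) : ℝ) ≤ K * 2 ^ ((rewardExponent V ^ 2 * V.size : ℝ) / 3) := by
  obtain ⟨K, hK⟩ := hT.bound
  have hdimension : Tendsto dimension atTop atTop := tendsto_atTop_mono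
    (fun V => (Nat.le_self_pow (Nat.mul_ne_zero two_ne_zero (Nat.succ_ne_zero _)) V).trans
      (pow_le_dimension V)) tendsto_id
  refine ⟨⌈|K|⌉₊, ?_⟩
  filter_upwards [hdimension.eventually hK, tendsto_size.eventually_ge_atTop 7,
    eventually_counterLength_add_two_le, eventually_ge_atTop 2] with V hT hsize hcounter hV
  have hrpow := dimension_rpow_le hV hsize hcounter
  rw [Real.norm_of_nonneg (by positivity), Real.norm_of_nonneg (by positivity)] at hT
  refine hT.trans ?_
  gcongr
  exact (le_abs_self K).trans (Nat.le_ceil _)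

/-! ## The rewards are invisible -/

theorem pow_three_le_two_pow_counterLength (hr : 3 ≤ rewardExponent V) :
    (V : ℝ) ^ 3 ≤ 2 ^ counterLength V := by
  calc (V : ℝ) ^ 3 ≤ (2 ^ V.size) ^ 3 := by
        gcongr
        exact_mod_cast (Nat.lt_size_self V).le
    _ = 2 ^ (V.size * 3) := (pow_mul ..).symm
    _ ≤ 2 ^ counterLength V := pow_le_pow_right₀ one_le_two (Nat.mul_le_mul_left _ hr)

theorem mul_div_two_pow_counterLength_le (hV : 8 ≤ V) (hr : 3 ≤ rewardExponent V)
    (hle : rewardExponent V ≤ V) :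
    (rewardExponent V : ℝ) * ((V + 1) / 2 ^ counterLength V) ≤ 1 / 4 := by
  have hpow := pow_three_le_two_pow_counterLength hr
  have hV : (8 : ℝ) ≤ V := Nat.ofNat_le_cast.mpr hV
  have hmul : (rewardExponent V : ℝ) * (V + 1) ≤ V * (V + 1) := by gcongr
  have hcube : 8 * (V : ℝ) ^ 2 ≤ V ^ 3 := by rw [pow_succ' _ 2]; gcongr
  rw [← mul_div_assoc, div_le_iff₀ (by positivity)]
  nlinarith

theorem div_two_pow_counterLength_le (hV : 8 ≤ V) (hr : 3 ≤ rewardExponent V) :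
    ((V : ℝ) + 3) / 2 ^ counterLength V ≤ 1 / 4 := by
  have hpow := pow_three_le_two_pow_counterLength hr
  have hV : (8 : ℝ) ≤ V := Nat.ofNat_le_cast.mpr hV
  have hsq : 8 * V ≤ (V : ℝ) ^ 2 := by nlinarith
  rw [div_le_iff₀ (by positivity)]
  nlinarith

theorem div_two_pow_counterLength_pow_le (hV : 3 ≤ V) :
    (((V : ℝ) + 3) / 2 ^ counterLength V) ^ rewardExponent V ≤
      2 ^ (((V.size : ℝ) + 1 - V.size * rewardExponent V) * rewardExponent V) := by
  have hV : (3 : ℝ) ≤ V := Nat.ofNat_le_cast.mpr hV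
  have hsize : (V : ℝ) ≤ 2 ^ V.size := by exact_mod_cast (Nat.lt_size_self V).le
  rw [Real.rpow_mul_natCast two_pos.le, Real.rpow_sub two_pos, Real.rpow_add two_pos,
    Real.rpow_one, ← Nat.cast_mul, Real.rpow_natCast, Real.rpow_natCast, ← counterLength]
  gcongr
  linarith

theorem mul_div_two_pow_counterLength_pow_le {K : ℕ} {t : ℝ}
    (ht : t ≤ K * 2 ^ ((rewardExponent V ^ 2 * V.size : ℝ) / 3)) (hr : 6 ≤ rewardExponent V)
    (hsize : 7 ≤ V.size) (hV : 3 ≤ V) (hK : 40 * K ≤ V) :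
    t * (((V : ℝ) + 3) / 2 ^ counterLength V) ^ rewardExponent V ≤ 1 / 40 := by
  have hpow := div_two_pow_counterLength_pow_le hV
  have hV : (V : ℝ) ≤ 2 ^ V.size := by exact_mod_cast (Nat.lt_size_self V).le
  have hK : (40 * K : ℝ) ≤ V := by exact_mod_cast hK
  set r := (rewardExponent V : ℝ)
  set k := (V.size : ℝ) with hk
  have hr : 6 ≤ r := Nat.ofNat_le_cast.mpr hr
  have hsize : 7 ≤ k := Nat.ofNat_le_cast.mpr hsize
  have hexponent : r ^ 2 * k / 3 + (k + 1 - k * r) * r ≤ -k := by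
    nlinarith [mul_nonneg (sub_nonneg.mpr hr) (sub_nonneg.mpr hsize),
      mul_nonneg (mul_nonneg (sub_nonneg.mpr hr) (sub_nonneg.mpr hsize)) (by linarith : 0 ≤ r)]
  calc t * (((V : ℝ) + 3) / 2 ^ counterLength V) ^ rewardExponent V
      ≤ (K * 2 ^ (r ^ 2 * k / 3)) * 2 ^ ((k + 1 - k * r) * r) := by gcongr
    _ = K * 2 ^ (r ^ 2 * k / 3 + (k + 1 - k * r) * r) := by
      rw [mul_assoc, ← Real.rpow_add two_pos]
    _ ≤ K * 2 ^ (-k) := by gcongr; exact one_le_two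
    _ ≤ 1 / 40 := by
      rw [Real.rpow_neg two_pos.le, hk, Real.rpow_natCast, ← div_eq_mul_inv,
        div_le_div_iff₀ (by positivity) (by norm_num)]
      linarith

theorem eventually_hidesRewards {T : ℕ → ℕ} {K : ℕ} (hT : ∀ᶠ V in atTop,
      (T (dimension V) : ℝ) ≤ K * 2 ^ ((rewardExponent V ^ 2 * Nat.size V : ℝ) / 3)) :
    ∀ᶠ V in atTop, HidesRewards (T (dimension V)) V := by
  filter_upwards [hT, tendsto_size.eventually_ge_atTop 7,
    tendsto_rewardExponent.eventually_ge_atTop 6, eventually_counterLength_add_two_le,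
    eventually_ge_atTop 8, eventually_ge_atTop (40 * K)] with V hT hsize hr hcounter hV hK
  have hle : rewardExponent V ≤ V :=
    (Nat.le_mul_of_pos_left _ (by omega)).trans ((Nat.le_add_right _ 2).trans hcounter)
  have hquarter := div_two_pow_counterLength_le hV (by omega)
  exact
    { start_le := mul_div_two_pow_counterLength_le hV (by omega) hle
      full_le := (pow_le_of_le_one (by positivity) (hquarter.trans (by norm_num))
        (by omega)).trans hquarter
      queries_le := mul_div_two_pow_counterLength_pow_le hT hr hsize (by omega) hK }

/-! ## The running time of the reduction -/

theorem eventually_mul_add_one_sq_le_dimension (a : ℕ) :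
    ∀ᶠ V in atTop, a * (V + 1) ^ 2 ≤ dimension V := by
  filter_upwards [eventually_ge_atTop a, eventually_ge_atTop 2,
    tendsto_rewardExponent.eventually_ge_atTop 6] with V ha hV hr
  calc a * (V + 1) ^ 2 ≤ V * (V * V) ^ 2 := by gcongr; nlinarith
    _ = V ^ 5 := by ring
    _ ≤ V ^ (2 * rewardExponent V) := Nat.pow_le_pow_right (by omega) (by omega)
    _ ≤ dimension V := pow_le_dimension V

theorem dimension_le_two_pow (h : counterLength V + 2 ≤ V) :
    dimension V ≤ 2 ^ (8 * (rewardExponent V ^ 2 * V.size ^ 2)) := by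
  have hsize : 0 < V.size := Nat.size_pos.mpr (by omega)
  refine (dimension_le h).trans (Nat.pow_le_pow_right two_pos ?_)
  calc 2 * rewardExponent V * (V.size + 2) ≤ 2 * rewardExponent V ^ 2 * (4 * V.size ^ 2) := by
        gcongr
        · exact Nat.le_self_pow two_ne_zero _
        · nlinarith
    _ = 8 * (rewardExponent V ^ 2 * V.size ^ 2) := by ring

theorem eventually_time_le_two_pow {T : ℕ → ℕ} {K : ℕ} (hT : ∀ᶠ V in atTop,
      (T (dimension V) : ℝ) ≤ K * 2 ^ ((rewardExponent V ^ 2 * Nat.size V : ℝ) / 3)) (a : ℕ) :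
    ∀ᶠ V in atTop, a * (V + 1) ^ 2 + dimension V + T (dimension V) ≤
      2 ^ ((K + 10) * (rewardExponent V ^ 2 * Nat.size V ^ 2)) := by
  filter_upwards [hT, eventually_mul_add_one_sq_le_dimension a,
    eventually_counterLength_add_two_le] with V hT ha hcounter
  have hdimension := dimension_le_two_pow hcounter
  have hpos : 0 < rewardExponent V ^ 2 * V.size ^ 2 :=
    Nat.mul_pos (Nat.pow_pos (Nat.succ_pos _)) (Nat.pow_pos (Nat.size_pos.mpr (by omega)))
  have htime : T (dimension V) ≤ K * 2 ^ (8 * (rewardExponent V ^ 2 * V.size ^ 2)) := by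
    have hexponent : (rewardExponent V ^ 2 * V.size : ℝ) / 3 ≤
        (8 * (rewardExponent V ^ 2 * V.size ^ 2) : ℕ) := by
      have hsq : (V.size : ℝ) ≤ V.size ^ 2 := by exact_mod_cast Nat.le_self_pow two_ne_zero _
      push_cast
      nlinarith [sq_nonneg (rewardExponent V : ℝ), mul_le_mul_of_nonneg_left hsq
        (sq_nonneg (rewardExponent V : ℝ)), mul_nonneg (sq_nonneg (rewardExponent V : ℝ))
        (Nat.cast_nonneg (α := ℝ) V.size)]
    have := hT.trans (mul_le_mul_of_nonneg_left
      (Real.rpow_le_rpow_of_exponent_le one_le_two hexponent) K.cast_nonneg)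
    rw [Real.rpow_natCast] at this
    exact_mod_cast this
  set y := rewardExponent V ^ 2 * V.size ^ 2
  calc a * (V + 1) ^ 2 + dimension V + T (dimension V)
      ≤ 2 ^ (8 * y) + 2 ^ (8 * y) + K * 2 ^ (8 * y) := by
        gcongr
        exact ha.trans hdimension
    _ = (K + 2) * 2 ^ (8 * y) := by ring
    _ ≤ 2 ^ (K + 2) * 2 ^ (8 * y) := by gcongr; exact Nat.lt_two_pow_self.le
    _ = 2 ^ (K + 2 + 8 * y) := (pow_add ..).symm
    _ ≤ 2 ^ ((K + 10) * y) := Nat.pow_le_pow_right two_pos (by nlinarith)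

theorem mul_le_mul_div_logb {v m : ℕ} {C : ℝ} (hv : 2 ≤ v) (hvV : v ≤ V)
    (h : m * V.size ≤ C * v) : m ≤ C * (v / Real.logb 2 v) := by
  have hlogb : Real.logb 2 v ≤ V.size :=
    (Real.logb_le_logb_of_le one_lt_two (by positivity) (by exact_mod_cast hvV)).trans
      (logb_le_size V)
  rw [← mul_div_assoc, le_div_iff₀ (Real.logb_pos one_lt_two (by exact_mod_cast hv))]
  exact (mul_le_mul_of_nonneg_left hlogb m.cast_nonneg).trans h

theorem isBigO_time_pow {T : ℕ → ℕ} {K : ℕ} (hT : ∀ᶠ V in atTop,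
      (T (dimension V) : ℝ) ≤ K * 2 ^ ((rewardExponent V ^ 2 * Nat.size V : ℝ) / 3))
    {C : ℝ} (hC : 0 < C) (v₀ a m : ℕ) :
    (fun v => (((a * (v + 1) ^ 2 + dimension (v + v₀) + T (dimension (v + v₀))) ^ m : ℕ) : ℝ))
      =O[atTop] (fun v : ℕ => (2 : ℝ) ^ (C * (v / Real.logb 2 v))) := by
  have hshift : Tendsto (fun v => v + v₀) atTop atTop := tendsto_add_atTop_nat v₀
  refine Asymptotics.IsBigO.of_bound 1 ?_
  filter_upwards [hshift.eventually (eventually_time_le_two_pow hT a),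
    hshift.eventually (eventually_mul_rewardExponent_sq_le ⌈2 * (m * (K + 10)) / C⌉₊),
    eventually_ge_atTop v₀, eventually_ge_atTop 2] with v htime hexponent hv₀ hv
  set V := v + v₀
  set n := (K + 10) * (rewardExponent V ^ 2 * V.size ^ 2) * m
  have hn : n * V.size ≤ C * v := by
    have hceil := Nat.le_ceil (2 * (m * (K + 10)) / C)
    rw [div_le_iff₀ hC] at hceil
    have hV : (V : ℝ) ≤ 2 * v := by exact_mod_cast (by omega : V ≤ 2 * v)
    have hexponent : (⌈2 * (m * (K + 10)) / C⌉₊ : ℝ) * (rewardExponent V ^ 2 * V.size ^ 3) ≤ V := by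
      exact_mod_cast hexponent
    have hmul := mul_le_mul_of_nonneg_right hceil
      (by positivity : (0 : ℝ) ≤ rewardExponent V ^ 2 * V.size ^ 3)
    have hcast : (n * V.size : ℝ) = m * (K + 10) * (rewardExponent V ^ 2 * V.size ^ 3) := by
      push_cast [n]
      ring
    nlinarith [mul_le_mul_of_nonneg_left (hexponent.trans hV) hC.le]
  rw [one_mul, Real.norm_of_nonneg (by positivity), Real.norm_of_nonneg (by positivity)]
  calc (((a * (v + 1) ^ 2 + dimension V + T (dimension V)) ^ m : ℕ) : ℝ)
      ≤ ((2 ^ n : ℕ) : ℝ) := by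
        rw [pow_mul]
        gcongr
        refine le_trans ?_ htime
        gcongr
        omega
    _ = 2 ^ (n : ℝ) := by rw [Real.rpow_natCast]; push_cast; rfl
    _ ≤ 2 ^ (C * (v / Real.logb 2 v)) :=
      Real.rpow_le_rpow_of_exponent_le one_le_two (mul_le_mul_div_logb hv (by omega) hn)

end Parameters

end RL

namespace Machine

/-! ## Decision by simulation -/

section Decision

variable {O : Oracle} {ans : Str → Str} {flagged verdict : Str → Bool} {p P : Prog} {u w : Str}
  {n N : ℕ}

theorem HaltsWithin.answerOracle (hans : ∀ q, ans q ∈ (O q).support) (h : HaltsWithin O p u n) :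
    HaltsWithin (answerOracle ans) p u n :=
  fun c hc => h c (support_run_answerOracle_subset hans n _ hc)

theorem outputProb_le_add_of_output_eq_map
    (hP : output noOracle P w N = (runFlagged ans flagged n false (initial p u)).map
      fun y => [y.1 || verdict (y.2.regs 0)])
    {A : Str → Prop} (hA : ∀ y, A y → verdict y = true) {ε : ℝ≥0∞}
    (hε : ∀ q, flagged q = true ∨ 1 ≤ O q (ans q) + ε) :
    outputProb O p u n A ≤ outputProb noOracle P w N (· = [true]) + n * ε := by
  rw [outputProb, outputProb, hP, output, PMF.toOuterMeasure_map_apply,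
    PMF.toOuterMeasure_map_apply]
  refine (toOuterMeasure_run_le _ hε n false _).trans
    (add_le_add_left (MeasureTheory.measure_mono ?_) _)
  rintro y (hy | hy)
  · simp [hy]
  · simp [hA _ hy]

theorem outputProb_eq_one_of_output_eq_map
    (hP : output noOracle P w N = (runFlagged ans flagged n false (initial p u)).map
      fun y => [y.1 || verdict (y.2.regs 0)])
    (hflagged : ∀ q, flagged q = false) (hverdict : ∀ y, verdict y = false) :
    outputProb noOracle P w N (· = [false]) = 1 := by
  rw [outputProb, hP, PMF.toOuterMeasure_map_apply, PMF.toOuterMeasure_apply_eq_one_iff]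
  intro y hy
  simp [fst_eq_false_of_mem_support_runFlagged hflagged hy, hverdict]

end Decision

end Machine

namespace RL

open Machine ThreeSat

/-! ## The reduction -/

namespace ComputableParameters

variable {X : Type*} {Vs : List (X → Str)} {S v B V r : X → ℕ} {φ : ∀ x, CNF (v x)}

theorem input (h : ComputableParameters Vs S φ B V r) (hB : PolyBounded S fun x => 2 ^ B x) :
    PolyComputable Vs S fun x => (formulaMDP (φ x) (B x) (V x) (r x)).input
      ((2 + B x + 3 * V x) ^ (2 * r x)) := by
  have hhorizon : PolyComputable Vs S fun x => List.replicate (2 * 2 ^ B x) true :=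
    (PolyComputable.replicate_mul (.const [true, true]) (.tensorPower (.const [true, true])
      h.countBits (by simpa using hB))).congr fun x => by
        rw [length_tensorPower, List.length_replicate]; rfl
  let ones (x : X) : Str := true :: true :: (List.replicate (B x) true ++
    (List.replicate (V x) true ++ (List.replicate (V x) true ++ List.replicate (V x) true)))
  have hones (x : X) : (ones x).length = 2 + B x + 3 * V x := by simp [ones]; ring
  have hdimension : PolyComputable Vs S fun x =>
      List.replicate ((2 + B x + 3 * V x) ^ (2 * r x)) true := by
    have hpower : PolyComputable Vs S fun x => List.replicate (2 * r x) true :=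
      (h.power.append h.power).congr fun x => by rw [← List.replicate_add, two_mul]
    refine (PolyComputable.replicate true (PolyComputable.tensorPower (f := ones)
      (.cons true (.cons true (h.countBits.append (h.assignBits.append
        (h.assignBits.append h.assignBits))))) hpower
      (h.dimension_bounded.mono fun x => ?_))).congr fun x => ?_
    · rw [hones, List.length_replicate]
    · rw [length_tensorPower, hones, List.length_replicate]
  refine (((hdimension.append (.const [false])).append
    (hhorizon.append (.const [false]))).append (h.ofStr (.const [])).code).congr fun x => ?_
  rw [SearchState.ofStr_nil]
  rfl

end ComputableParameters

/-- The size of a formula and of its decision process, when `v₀` variables are added. -/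
def formulaSize (v₀ : ℕ) (x : Σ v, CNF v) : ℕ := (encCNF x.2).length + dimension (x.1 + v₀)

/-- The decision process of a formula for the chosen parameters.  The `v₀` additional variables make
the formula large enough for these parameters to work. -/
noncomputable abbrev paddedMDP (v₀ : ℕ) (x : Σ v, CNF v) : MDP :=
  formulaMDP x.2 (counterLength (x.1 + v₀)) (x.1 + v₀) (rewardExponent (x.1 + v₀))

/-- The features of the decision process of a formula for the chosen parameters. -/
noncomputable abbrev paddedFeatures (v₀ : ℕ) (x : Σ v, CNF v) :
    (paddedMDP v₀ x).Features (dimension (x.1 + v₀)) :=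
  formulaFeatures x.2 (counterLength (x.1 + v₀)) (x.1 + v₀) (rewardExponent (x.1 + v₀))

/-- Whether the state in a query contains a satisfying assignment.  The state starts at the fourth
bit of the queries for rewards, and only these matter. -/
def mentionsSolution (v₀ : ℕ) (x : Σ v, CNF v) (q : Str) : Bool :=
  (firstFalsified x.2 (SearchState.ofStr (counterLength (x.1 + v₀)) (x.1 + v₀)
    (q.drop 3)).assign).isNone

/-- Whether the actions lead to a satisfying assignment. -/
noncomputable def reachesSolution (v₀ : ℕ) (x : Σ v, CNF v) (as : Str) : Bool :=
  let last : SearchState (counterLength (x.1 + v₀)) (x.1 + v₀) :=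
    (paddedMDP v₀ x).lastState (SearchState.start _ _) as
  (firstFalsified x.2 last.assign).isNone

theorem computableParameters_padded (v₀ : ℕ) :
    ComputableParameters [fun x : Σ v, CNF v => encCNF x.2] (formulaSize v₀) (fun x => x.2)
      (fun x => counterLength (x.1 + v₀)) (fun x => x.1 + v₀)
      (fun x => rewardExponent (x.1 + v₀)) := by
  have hφ : PolyComputable [fun x : Σ v, CNF v => encCNF x.2] (formulaSize v₀)
      fun x => encCNF x.2 := .var 0 rfl (.of_le fun _ => Nat.le_add_right _ _)
  have hV : PolyComputable [fun x : Σ v, CNF v => encCNF x.2] (formulaSize v₀)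
      fun x => List.replicate (x.1 + v₀) true :=
    (hφ.takeWhile.append (.const (List.replicate v₀ true))).congr fun x => by
      rw [encCNF_eq, takeWhile_encUnary_append, List.replicate_add]
  have hr : PolyComputable [fun x : Σ v, CNF v => encCNF x.2] (formulaSize v₀)
      fun x => List.replicate (rewardExponent (x.1 + v₀)) true :=
    (PolyComputable.cons true hV.replicate_nthRoot_three).congr fun x => by
      rw [List.length_replicate]; rfl
  exact
    { formula := hφ
      countBits := (hV.bits.replicate_mul hr).congr fun x => by
        rw [List.length_replicate, List.length_replicate, counterLength, Nat.size_eq_bits_len]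
      assignBits := hV
      power := hr
      dimension_bounded := .of_le fun _ => Nat.le_add_left _ _ }

variable {v₀ : ℕ} {x : Σ v, CNF v}

theorem mentionsSolution_or_one_le_oracle_add (q : Str) :
    mentionsSolution v₀ x q = true ∨
      1 ≤ (paddedMDP v₀ x).oracle (paddedFeatures v₀ x) q
        (MDP.zeroRewardAnswer (paddedFeatures v₀ x) q) +
        ENNReal.ofReal ((((x.1 + v₀ : ℕ) + 3) / 2 ^ counterLength (x.1 + v₀)) ^
          rewardExponent (x.1 + v₀)) := by
  refine (formulaMDP.one_le_oracle_zeroRewardAnswer_add (Nat.le_add_right x.1 v₀) q).imp_left ?_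
  rintro ⟨s, hq, hs⟩
  rw [mentionsSolution, hq, SearchState.ofStr_code, hs, Option.isNone_none]

theorem isNone_firstFalsified_of_not_satisfiable (h : ¬ Satisfiable x.2) (w : Str) :
    (firstFalsified x.2 w).isNone = false :=
  Bool.eq_false_iff.mpr fun hnone =>
    h ⟨_, satisfies_iff_firstFalsified_eq_none.mpr (Option.isNone_iff_eq_none.mp hnone)⟩

theorem computable_mentionsSolution (v₀ : ℕ) :
    PolyComputable (extend [fun x : Σ v, CNF v => encCNF x.2])
      (fun y => formulaSize v₀ y.1 + y.2.length) fun y => [mentionsSolution v₀ y.1 y.2] := by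
  have h := (computableParameters_padded v₀).lift
    (by simpa using (computableParameters_padded v₀).formula.length_bounded)
  have hstate := h.ofStr (PolyComputable.tail (.tail (.tail .accumulator)))
  exact (hstate.isNone_firstFalsified h.formula).congr fun y => by
    rw [mentionsSolution, ← List.drop_one, List.drop_tail, List.drop_tail]

theorem computable_reachesSolution (v₀ : ℕ) :
    PolyComputable (extend [fun x : Σ v, CNF v => encCNF x.2])
      (fun y => formulaSize v₀ y.1 + y.2.length) fun y => [reachesSolution v₀ y.1 y.2] := by
  have hformula := (computableParameters_padded v₀).formula.length_bounded
  have h := (computableParameters_padded v₀).lift (by simpa using hformula)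
  refine (h.lastState ?_ .accumulator).isNone_firstFalsified h.formula
  simpa [extend] using And.intro (PolyBounded.of_le fun y => Nat.le_add_left _ _)
    h.formula.length_bounded

theorem exists_program_output_eq (v₀ : ℕ) (p : Prog) (T : (Σ v, CNF v) → ℕ) :
    ∃ (P : Prog) (τ : (Σ v, CNF v) → ℕ), PolyBounded (fun x => formulaSize v₀ x + T x) τ ∧
      ∀ x N, τ x ≤ N →
        HaltsWithin (answerOracle (MDP.zeroRewardAnswer (paddedFeatures v₀ x))) p
          ((paddedMDP v₀ x).input (dimension (x.1 + v₀))) (T x) →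
        HaltsWithin noOracle P (encCNF x.2) N ∧
        output noOracle P (encCNF x.2) N =
          (runFlagged (MDP.zeroRewardAnswer (paddedFeatures v₀ x)) (mentionsSolution v₀ x) (T x)
            false (initial p ((paddedMDP v₀ x).input (dimension (x.1 + v₀))))).map
          fun y => [y.1 || reachesSolution v₀ x (y.2.regs 0)] := by
  have h := computableParameters_padded v₀
  have hlift := h.lift (by simpa using h.formula.length_bounded)
  have hinput := h.input (h.dimension_bounded.mono fun x => two_pow_counterLength_le (x.1 + v₀))
  obtain ⟨P, τ, hτ, hrun⟩ := exists_program_simulating (S := formulaSize v₀) (T := T)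
    (ans := fun x => MDP.zeroRewardAnswer (paddedFeatures v₀ x)) (flagged := mentionsSolution v₀)
    (verdict := reachesSolution v₀) (a := fun x => 7 * dimension (x.1 + v₀))
    (fun x => Nat.le_add_right (encCNF x.2).length (dimension (x.1 + v₀))) hinput
    (hlift.zeroRewardAnswer .accumulator) (computable_mentionsSolution v₀)
    (computable_reachesSolution v₀) ((PolyBounded.const 7).mul h.dimension_bounded)
    (fun x q => formulaMDP.length_zeroRewardAnswer_le (Nat.succ_ne_zero _) q) p
  refine ⟨P, τ, hτ, fun x N hN hhalt => ?_⟩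
  have hrun := hrun x N hN hhalt
  constructor
  · intro c hc
    rw [hrun, PMF.support_map] at hc
    obtain ⟨y, -, rfl⟩ := hc
    rfl
  · rw [output, hrun, PMF.map_comp]
    congr 1

theorem HidesRewards.natCast_mul_ofReal_le {t V : ℕ} (h : HidesRewards t V) :
    t * ENNReal.ofReal (((V + 3) / 2 ^ counterLength V) ^ rewardExponent V) ≤ 1 / 40 := by
  rw [← ENNReal.ofReal_natCast, ← ENNReal.ofReal_mul t.cast_nonneg]
  refine (ENNReal.ofReal_le_ofReal h.queries_le).trans_eq ?_
  rw [ENNReal.ofReal_div_of_pos (by norm_num), ENNReal.ofReal_one, ENNReal.ofReal_ofNat]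

theorem exists_program_deciding_satisfiable {p : Prog} {T : ℕ → ℕ} {v₀ : ℕ} {ε : ℝ≥0∞}
    (hp : ∀ (d : ℕ) (M : MDP) (ψ : M.Features d), M.IsInstance 8 d ψ →
      HaltsWithin (M.oracle ψ) p (M.input d) (T d) ∧
      1 - ε ≤ outputProb (M.oracle ψ) p (M.input d) (T d) M.IsGood)
    (hv₀ : ∀ V ≥ v₀, HidesRewards (T (dimension V)) V) :
    ∃ (P : Prog) (τ : (Σ v, CNF v) → ℕ),
      PolyBounded (fun x => formulaSize v₀ x + T (dimension (x.1 + v₀))) τ ∧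
      ∀ x N, τ x ≤ N → HaltsWithin noOracle P (encCNF x.2) N ∧
        (Satisfiable x.2 →
          1 - (ε + 1 / 40) ≤ outputProb noOracle P (encCNF x.2) N (· = [true])) ∧
        (¬ Satisfiable x.2 → outputProb noOracle P (encCNF x.2) N (· = [false]) = 1) := by
  obtain ⟨P, τ, hτ, hP⟩ := exists_program_output_eq v₀ p fun x => T (dimension (x.1 + v₀))
  refine ⟨P, τ, hτ, fun x N hN => ?_⟩
  have hvV : x.1 ≤ x.1 + v₀ := Nat.le_add_right _ _
  have hr : rewardExponent (x.1 + v₀) ≠ 0 := Nat.succ_ne_zero _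
  have hhides := hv₀ (x.1 + v₀) (Nat.le_add_left _ _)
  obtain ⟨hhalt, hprob⟩ :=
    hp _ _ _ (formulaMDP.isInstance (φ := x.2) hvV hr (two_pow_counterLength_le _))
  obtain ⟨hhaltP, houtput⟩ := hP x N hN
    (hhalt.answerOracle (formulaMDP.zeroRewardAnswer_mem_support_oracle hvV hr))
  refine ⟨hhaltP, fun hφ => ?_, fun hφ => outputProb_eq_one_of_output_eq_map houtput
    (fun _ => isNone_firstFalsified_of_not_satisfiable hφ _)
    fun _ => isNone_firstFalsified_of_not_satisfiable hφ _⟩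
  have hgood (as : Str) (has : (paddedMDP v₀ x).IsGood as) : reachesSolution v₀ x as = true := by
    rw [reachesSolution, formulaMDP.firstFalsified_of_isGood hφ hvV hr hhides.start_le
      hhides.full_le has, Option.isNone_none]
  rw [← tsub_tsub, tsub_le_iff_right]
  calc 1 - ε ≤ _ := hprob
    _ ≤ _ := outputProb_le_add_of_output_eq_map houtput hgood mentionsSolution_or_one_le_oracle_add
    _ ≤ _ := add_le_add_right hhides.natCast_mul_ofReal_le _

end RL

namespace ThreeSat

open Machine

section Encoding

variable {v : ℕ}

theorem length_encLiteral_le (l : Literal v) : (encLiteral l).length ≤ v + 1 := by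
  have hlt := l.1.isLt
  simp only [encLiteral, encUnary, List.length_cons, List.length_append, List.length_replicate,
    List.length_nil]
  omega

theorem length_encClause_le (C : Clause v) : (encClause C).length ≤ 3 * (v + 1) := by
  have h₁ := length_encLiteral_le C.1
  have h₂ := length_encLiteral_le C.2.1
  have h₃ := length_encLiteral_le C.2.2
  rw [encClause, List.length_append, List.length_append]
  omega

theorem length_encClauses_le (φ : CNF v) :
    (encClauses φ).length ≤ φ.length * (4 * (v + 1)) + 1 := by
  induction φ with
  | nil => simp [encClauses]
  | cons C φ ih =>
    have hC := length_encClause_le C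
    rw [encClauses_cons, List.length_cons, List.length_append, List.length_cons, add_mul]
    omega

theorem length_encCNF_add_two_le {c : ℕ} {φ : CNF v} (hφ : φ.length ≤ c * v) :
    (encCNF φ).length + 2 ≤ (4 * c + 4) * (v + 1) ^ 2 := by
  have hclauses : φ.length * (4 * (v + 1)) ≤ c * v * (4 * (v + 1)) := Nat.mul_le_mul_right _ hφ
  have hlength := length_encClauses_le φ
  rw [encCNF_eq, encUnary, List.length_append, List.length_append, List.length_replicate,
    List.length_singleton]
  nlinarith

end Encoding

/-- `3-SAT` can be solved in time `O(t v)` with error probability `ε`, in the sense of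
`UniqueThreeSatSolvableInTime` but on all formulas. -/
def ThreeSatSolvableInTime (t : ℕ → ℝ) (ε : ℝ≥0∞) : Prop :=
  ∃ p : Prog, ∀ c : ℕ, ∃ T : ℕ → ℕ,
    (fun v => (T v : ℝ)) =O[Filter.atTop] t ∧
    ∀ (v : ℕ) (φ : CNF v), φ.length ≤ c * v →
      HaltsWithin noOracle p (encCNF φ) (T v) ∧
      (Satisfiable φ → 1 - ε ≤ outputProb noOracle p (encCNF φ) (T v) (· = [true])) ∧
      (¬ Satisfiable φ → outputProb noOracle p (encCNF φ) (T v) (· = [false]) = 1)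

theorem ThreeSatSolvableInTime.unique {t : ℕ → ℝ} {ε : ℝ≥0∞} (h : ThreeSatSolvableInTime t ε) :
    UniqueThreeSatSolvableInTime t ε :=
  h.imp fun _ hp c => (hp c).imp fun _ hT => hT.imp_right fun hφ v φ hle _ => hφ v φ hle

end ThreeSat

theorem proposition3_general
    (h : RL.LinearTwoRLSolvableInTime
      (fun d : ℕ => (d : ℝ) ^ (Real.logb 2 d / (72 * Real.logb 2 (Real.logb 2 d)))) (1 / 10))
    {C : ℝ} (hC : 0 < C) :
    ThreeSat.ThreeSatSolvableInTime
      (fun v : ℕ => (2 : ℝ) ^ (C * (v / Real.logb 2 v))) (1 / 8) := by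
  obtain ⟨p, T, hT, hp⟩ := h 8
  obtain ⟨K, hK⟩ := RL.eventually_time_dimension_le hT
  obtain ⟨v₀, hv₀⟩ := Filter.eventually_atTop.mp (RL.eventually_hidesRewards hK)
  obtain ⟨P, τ, ⟨k, hk⟩, hP⟩ := RL.exists_program_deciding_satisfiable hp hv₀
  have herror : (1 / 10 + 1 / 40 : ℝ≥0∞) = 1 / 8 := by
    rw [← ENNReal.toReal_eq_toReal_iff' (by finiteness) (by finiteness),
      ENNReal.toReal_add (by finiteness) (by finiteness)]
    norm_num
  rw [herror] at hP
  refine ⟨P, fun c => ⟨_, RL.isBigO_time_pow hK hC v₀ (4 * c + 4) k, fun v φ hφ =>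
    hP ⟨v, φ⟩ _ ((hk _).trans (Nat.pow_le_pow_left ?_ k))⟩⟩
  have hsize := ThreeSat.length_encCNF_add_two_le hφ
  simp only [RL.formulaSize]
  omega

theorem proposition3
    (h : RL.LinearTwoRLSolvableInTime
      (fun d : ℕ => (d : ℝ) ^ (Real.logb 2 d / (72 * Real.logb 2 (Real.logb 2 d)))) (1 / 10)) :
    ∃ C : ℝ, ThreeSat.UniqueThreeSatSolvableInTime
      (fun v : ℕ => (2 : ℝ) ^ (C * (v / Real.logb 2 v))) (1 / 8) :=
  ⟨1, (proposition3_general h one_pos).unique⟩
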